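/- **Repeated first-price auctions with win/lose feedback.** A bidder takes part in $T\ge 1$ auctions. An oblivious adversary fixes the highest competing bids $m_1,\dots,m_T\in[0,1]$ in advance. In auction $t$ the bidder observes a value $v_t\in[0,1]$, where $v_1,v_2,\dots$ are i.i.d. from a distribution $\nu$ on $[0,1]$ that is unknown to the bidder, and submits a bid $b_t\in[0,1]$. If $b_t\ge m_t$ she wins and gets utility $v_t-b_t$; otherwise she gets $0$. The only feedback is whether she won. For a measurable mapping $\beta:[0,1]\to[0,1]$ put $$\mathrm{Reg}_T(\beta)=\mathbb E\Big[\sum_{t=1}^{T}(v_t-\beta(v_t))\,\mathbb I(\beta(v_t)\ge m_t)-\sum_{t=1}^{T}(v_t-b_t)\,\mathbb I(b_t\ge m_t)\Big],$$ where the expectation is over the values and the internal randomness of the algorithm. **Corollary.** There are a single randomized algorithm, which receives $T$ as input but knows neither $\nu$ nor $(m_t)$, and constants $C>0$, $a\in\mathbb N$, such that for all $T\ge1$, all distributions $\nu$ on $[0,1]$ and all $m_1,\dots,m_T\in[0,1]$: 1. (regret) $\displaystyle \sup_{\beta}\mathrm{Reg}_T(\beta)\le C\,T^{2/3}\,(1+\log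 T)^a$, the supremum being over all measurable $\beta:[0,1]\to[0,1]$; that is, the expected regret against the best fixed value-to-bid mapping is $\widetilde O(T^{2/3})$; 2. (efficiency) on every run, the algorithm makes at most $C\,T^{1/3}$ steps before the first auction and at most $C\,T^{1/3}$ steps in each auction, and it uses $O(T^{1/3})$ memory cells in total. Steps and memory are counted on a real RAM: arithmetic operations, $\exp$, $\log$ and comparisons of real numbers, additions, subtractions and comparisons of natural-number counters, array accesses, and the drawing of a uniform random number in $[0,1]$ each take one step, and a memory cell holds one number. -/

import Mathlib

open MeasureTheory

/-! ## A randomized real RAM with step and memory counts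

Programs are finite pieces of syntax. They work on natural-number registers (counters and
addresses), real registers, and real arrays. Every operation has unit cost. There is no rounding
operation from reals to natural numbers, the only constants are natural numbers, and
natural-number registers can only be added and subtracted. -/

namespace RealRAM

/-- Expressions for counters and addresses. -/
inductive IdxExpr : Type
  | const (n : ℕ)
  | reg (i : ℕ)
  | add (a b : IdxExpr)
  | sub (a b : IdxExpr)

/-- Real-valued expressions: `cell a e` is entry number `e` of the array `a`. -/
inductive RealExpr : Type
  | ofIdx (e : IdxExpr)
  | reg (i : ℕ)
  | cell (a : ℕ) (e : IdxExpr)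
  | add (x y : RealExpr)
  | sub (x y : RealExpr)
  | mul (x y : RealExpr)
  | div (x y : RealExpr)
  | exp (x : RealExpr)
  | log (x : RealExpr)

/-- Tests. -/
inductive Test : Type
  | idxLt (a b : IdxExpr)
  | realLt (x y : RealExpr)
  | not (p : Test)
  | and (p q : Test)

/-- Programs. `rand i` puts a fresh uniform random number of `[0,1]` into real register `i`.
`loop n p c` executes `c` again and again as long as the test `p` succeeds, but at most `n` times,
where `n` is evaluated once, on entry. -/
inductive Program : Type
  | skip
  | setIdx (i : ℕ) (e : IdxExpr)
  | setReg (i : ℕ) (x : RealExpr)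
  | setCell (a : ℕ) (e : IdxExpr) (x : RealExpr)
  | rand (i : ℕ)
  | seq (c d : Program)
  | ite (p : Test) (c d : Program)
  | loop (n : IdxExpr) (p : Test) (c : Program)

/-- The configuration of the machine. The last three fields are bookkeeping that no program can
read: `draws` is the number of random numbers consumed from the current tape, `time` the number of
steps made so far, and `space` is one more than the largest array address written so far
(`0` before the first write). A program names only finitely many registers and arrays, so the
number of storage cells it uses is at most a constant times `space + 1`. -/
structure Store : Type where
  idx : ℕ → ℕ
  reg : ℕ → ℝ
  arr : ℕ → ℕ → ℝ
  draws : ℕ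
  time : ℕ
  space : ℕ

/-- Everything is zero, except that natural-number register `0` holds `n`. -/
def Store.start (n : ℕ) : Store where
  idx := Function.update (fun _ => 0) 0 n
  reg := fun _ => 0
  arr := fun _ _ => 0
  draws := 0
  time := 0
  space := 0

/-- Let `k` steps pass. -/
def Store.tick (s : Store) (k : ℕ) : Store := { s with time := s.time + k }

def IdxExpr.eval (s : Store) : IdxExpr → ℕ
  | const n => n
  | reg i => s.idx i
  | add a b => a.eval s + b.eval s
  | sub a b => a.eval s - b.eval s

/-- The cost of an expression is its number of nodes. -/
def IdxExpr.cost : IdxExpr → ℕ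
  | const _ => 1
  | reg _ => 1
  | add a b => a.cost + b.cost + 1
  | sub a b => a.cost + b.cost + 1

noncomputable def RealExpr.eval (s : Store) : RealExpr → ℝ
  | ofIdx e => (e.eval s : ℝ)
  | reg i => s.reg i
  | cell a e => s.arr a (e.eval s)
  | add x y => x.eval s + y.eval s
  | sub x y => x.eval s - y.eval s
  | mul x y => x.eval s * y.eval s
  | div x y => x.eval s / y.eval s
  | exp x => Real.exp (x.eval s)
  | log x => Real.log (x.eval s)

def RealExpr.cost : RealExpr → ℕ
  | ofIdx e => e.cost + 1
  | reg _ => 1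
  | cell _ e => e.cost + 1
  | add x y => x.cost + y.cost + 1
  | sub x y => x.cost + y.cost + 1
  | mul x y => x.cost + y.cost + 1
  | div x y => x.cost + y.cost + 1
  | exp x => x.cost + 1
  | log x => x.cost + 1

def Test.eval (s : Store) : Test → Prop
  | idxLt a b => a.eval s < b.eval s
  | realLt x y => x.eval s < y.eval s
  | not p => ¬ p.eval s
  | and p q => p.eval s ∧ q.eval s

def Test.cost : Test → ℕ
  | idxLt a b => a.cost + b.cost + 1
  | realLt x y => x.cost + y.cost + 1
  | not p => p.cost + 1
  | and p q => p.cost + q.cost + 1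

open Classical in
/-- Run `f` while the test `p` succeeds, at most `n` times, paying for each test. -/
noncomputable def iterate (p : Test) (f : Store → Store) : ℕ → Store → Store
  | 0, s => s
  | n + 1, s =>
      if p.eval s then iterate p f n (f (s.tick (p.cost + 1))) else s.tick (p.cost + 1)

open Classical in
/-- The effect of a program, when `tape` is the sequence of random numbers it is supplied with. -/
noncomputable def exec (tape : ℕ → unitInterval) : Program → Store → Store
  | .skip, s => s.tick 1
  | .setIdx i e, s =>
      { s.tick (e.cost + 1) with idx := Function.update s.idx i (e.eval s) }
  | .setReg i x, s =>
      { s.tick (x.cost + 1) with reg := Function.update s.reg i (x.eval s) }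
  | .setCell a e x, s =>
      { s.tick (e.cost + x.cost + 1) with
        arr := Function.update s.arr a (Function.update (s.arr a) (e.eval s) (x.eval s))
        space := max s.space (e.eval s + 1) }
  | .rand i, s =>
      { s.tick 1 with
        reg := Function.update s.reg i (tape s.draws : ℝ)
        draws := s.draws + 1 }
  | .seq c d, s => exec tape d (exec tape c s)
  | .ite p c d, s =>
      if p.eval s then exec tape c (s.tick (p.cost + 1)) else exec tape d (s.tick (p.cost + 1))
  | .loop n p c, s => iterate p (exec tape c) (n.eval s) (s.tick (n.cost + 1))

end RealRAM

/-! ## Repeated first-price auctions with win/lose feedback -/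

namespace FirstPrice

open RealRAM

/-- A bidding algorithm. `init` is run once, with the number of auctions in natural-number register
`0`. In each auction, the current value is put into real register `0` and `bid` is run; the content
of real register `1` is then submitted as the bid. Afterwards natural-number register `1` is set to
`1` if the auction is won and to `0` if it is lost, and `update` is run. -/
structure Bidder : Type where
  init : Program
  bid : Program
  update : Program

/-- All randomness: in auction `t` (counted from `0`), `(ω t).1` is the bidder's value and `(ω t).2`
is the tape of random numbers for the bidder's algorithm. -/
abbrev Outcome : Type := ℕ → unitInterval × (ℕ → unitInterval)

/-- Values are i.i.d. with law `ν`, the numbers on the tapes are i.i.d. uniform on `[0,1]`, and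
values and tapes are independent. -/
noncomputable def law (ν : Measure unitInterval) [IsProbabilityMeasure ν] : Measure Outcome :=
  Measure.infinitePi fun _ : ℕ =>
    ν.prod (Measure.infinitePi fun _ : ℕ => (volume : Measure unitInterval))

/-- The machine right after the bidder, in configuration `s`, has seen the value `r.1` and
computed a bid. -/
noncomputable def afterBid (A : Bidder) (r : unitInterval × (ℕ → unitInterval)) (s : Store) :
    Store :=
  exec r.2 A.bid { s with reg := Function.update s.reg 0 (r.1 : ℝ) }

open Classical in
/-- The machine right before auction `t`, when `T` auctions are announced and `m t` is the highest
bid of the others in auction `t`. -/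
noncomputable def store (A : Bidder) (T : ℕ) (m : ℕ → unitInterval) (ω : Outcome) : ℕ → Store
  | 0 => exec (ω 0).2 A.init (Store.start T)
  | t + 1 =>
      let s := afterBid A (ω t) (store A T m ω t)
      let won : ℕ := if (m t : ℝ) ≤ s.reg 1 then 1 else 0
      { exec (ω t).2 A.update { s with idx := Function.update s.idx 1 won } with draws := 0 }

/-- The bid submitted in auction `t`. -/
noncomputable def bidAt (A : Bidder) (T : ℕ) (m : ℕ → unitInterval) (ω : Outcome) (t : ℕ) : ℝ :=
  (afterBid A (ω t) (store A T m ω t)).reg 1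

open Classical in
/-- Utility of a bidder with value `v` who bids `b` against a highest other bid `m`. -/
noncomputable def utility (v b m : ℝ) : ℝ := if m ≤ b then v - b else 0

/-- Utility of bidding by the fixed mapping `β` in all `T` auctions, minus the bidder's utility. -/
noncomputable def regret (A : Bidder) (T : ℕ) (m : ℕ → unitInterval)
    (β : unitInterval → unitInterval) (ω : Outcome) : ℝ :=
  ∑ t ∈ Finset.range T,
    (utility (ω t).1 (β (ω t).1) (m t) - utility (ω t).1 (bidAt A T m ω t) (m t))

end FirstPrice

/-! ### Exponential weights, and the strategy on a grid of values and bids -/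

namespace FirstPrice

/-! Let $K$ = `gridSize T`, about $T^{1/3}$. Values are rounded down to $c/K$ and bids restricted to
$a/K$; this costs $O(1/K)$ per auction, hence $O(T/K)=O(K^2)$ in all. On the grid the loss is
$(a+(c-a)^+y_a)/K$, where $y_a$ tells whether the bid $a/K$ loses. Then $c/K$ minus the loss never
exceeds the utility (`le_utility`). The adversary enters through $y_a$ alone, which does not depend
on the value. One observation therefore serves all values: every $c$ runs its own exponential
weights with rate $1/K^2$, but all of them read one shared vector of estimated numbers of lost
auctions.

The estimate divides the observed losses of a bid by its frequency averaged over values, $f_a=\sum_c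
q_c\,p(c,a)$, so that its variance does not pay for the number of values. As $q$ is unknown, it is
replaced by an inflated empirical law `mass`, which gives $g_a$ = `freqEst` in place of $f_a$. By
Chernoff's bound `mass` falls below $q$ by at most $4/T^2$ in expectation (`mean_shortfall_le`).
Hence $f_a/g_a\le 1$ up to a negligible error: the losses of a comparator are hardly overestimated
and second moments stay bounded. The bidder's own losses are underestimated, but only by the excess
of `mass` over $q$ (`bias_le`), which decays like $1/K+K^2(1+\log T)/n$ after $n$ auctions.

The policy is frozen during blocks of $K+1$ auctions. In a block the losses of bid $a$ have
conditional second moment at most $(K+1)f_a+(K+1)^2f_a^2$, so the averaged second moment of the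
estimated block losses is $O(K^2)$. The three costs are $K^2\log(K+1)$ from the weights,
$O(K^{-2}\cdot(T/K)\cdot K^2)=O(K^2)$ from the variance and $O(K^2(1+\log T)^2)$ from the bias
(`IsPlay.regret_le`).

Blocks also give the running time. The sum $g_a$ has one term for each of the $K+1$ values; auction
$k$ of a block adds the term of value $k$ for all $a$ in $O(K)$ steps, and the sums are complete
when the block ends. Weights are recomputed from the shared vector when needed, so five arrays of
length $K+1$ suffice.

The regret bound is proved for any expectation satisfying `IsPlay`; `isPlay_integral` supplies one,
and `store_tracks` shows that the machine plays accordingly. -/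

lemma exp_neg_le_quadratic {x : ℝ} (hx : 0 ≤ x) : Real.exp (-x) ≤ 1 - x + x ^ 2 / 2 := by
  have h := Real.quadratic_le_exp_of_nonneg hx
  have hpos : 0 < 1 + x + x ^ 2 / 2 := by positivity
  rw [Real.exp_neg]
  calc (Real.exp x)⁻¹ ≤ (1 + x + x ^ 2 / 2)⁻¹ := inv_anti₀ hpos h
    _ ≤ 1 - x + x ^ 2 / 2 := by
      rw [inv_le_iff_one_le_mul₀ hpos]
      -- The product $(1+x+x^2/2)(1-x+x^2/2)$ equals $1+x^4/4$.
      nlinarith [sq_nonneg (x ^ 2)]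

/-- The regret bound of exponential weights with nonnegative losses. -/
lemma exponential_weights_regret {ι : Type*} (A : Finset ι) (η : ℝ) (hη : 0 < η)
    (l L p : ℕ → ι → ℝ) (hl : ∀ j, ∀ a ∈ A, 0 ≤ l j a) (hL0 : ∀ a ∈ A, L 0 a = 0)
    (hL : ∀ j, ∀ a ∈ A, L (j + 1) a = L j a + l j a)
    (hp : ∀ j, ∀ a ∈ A, p j a = Real.exp (-(η * L j a)) / ∑ i ∈ A, Real.exp (-(η * L j i)))
    (J : ℕ) (b : ι) (hb : b ∈ A) :
    ∑ j ∈ Finset.range J, ∑ a ∈ A, p j a * l j a ≤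
      ∑ j ∈ Finset.range J, l j b + Real.log A.card / η +
        η / 2 * ∑ j ∈ Finset.range J, ∑ a ∈ A, p j a * l j a ^ 2 := by
  have hW : ∀ j, 0 < ∑ i ∈ A, Real.exp (-(η * L j i)) := fun j =>
    Finset.sum_pos (fun i _ => Real.exp_pos _) ⟨b, hb⟩
  have hLb : ∀ j, L j b = ∑ i ∈ Finset.range j, l i b := by
    intro j
    induction j with
    | zero => simpa using hL0 b hb
    | succ j ih => rw [hL j b hb, ih, Finset.sum_range_succ]
  -- The potential is the logarithm of the total weight. Its increment is the logarithm of the mean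
  -- of $e^{-\eta l}$ under `p j`, estimated by $\log x\le x-1$ and the quadratic bound, which needs
  -- nonnegative losses.
  have hstep : ∀ j, Real.log (∑ i ∈ A, Real.exp (-(η * L (j + 1) i))) -
      Real.log (∑ i ∈ A, Real.exp (-(η * L j i))) ≤
      -(η * ∑ a ∈ A, p j a * l j a) + η ^ 2 / 2 * ∑ a ∈ A, p j a * l j a ^ 2 := by
    intro j
    rw [← Real.log_div (hW _).ne' (hW _).ne']
    refine (Real.log_le_sub_one_of_pos (div_pos (hW _) (hW _))).trans ?_
    have h1 : (∑ i ∈ A, Real.exp (-(η * L (j + 1) i))) / ∑ i ∈ A, Real.exp (-(η * L j i)) =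
        ∑ i ∈ A, p j i * Real.exp (-(η * l j i)) := by
      rw [Finset.sum_div]
      refine Finset.sum_congr rfl fun i hi => ?_
      rw [hL j i hi, hp j i hi, div_mul_eq_mul_div, ← Real.exp_add]
      congr 2
      ring
    have h2 : ∑ i ∈ A, p j i = 1 := by
      rw [Finset.sum_congr rfl (hp j), ← Finset.sum_div, div_self (hW j).ne']
    have h3 : ∑ i ∈ A, p j i * Real.exp (-(η * l j i)) ≤
        ∑ i ∈ A, p j i * (1 - η * l j i + (η * l j i) ^ 2 / 2) := by
      refine Finset.sum_le_sum fun i hi => ?_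
      refine mul_le_mul_of_nonneg_left (exp_neg_le_quadratic ?_) ?_
      · exact mul_nonneg hη.le (hl j i hi)
      · rw [hp j i hi]
        exact div_nonneg (Real.exp_pos _).le (hW j).le
    have h4 : ∑ i ∈ A, p j i * (1 - η * l j i + (η * l j i) ^ 2 / 2) =
        ∑ i ∈ A, p j i - η * ∑ a ∈ A, p j a * l j a +
          η ^ 2 / 2 * ∑ a ∈ A, p j a * l j a ^ 2 := by
      rw [Finset.mul_sum, Finset.mul_sum, ← Finset.sum_sub_distrib,
        ← Finset.sum_add_distrib]
      refine Finset.sum_congr rfl fun i _ => ?_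
      ring
    rw [h1]
    linarith
  have hsum := Finset.sum_le_sum fun j (_ : j ∈ Finset.range J) => hstep j
  rw [Finset.sum_range_sub (fun j => Real.log (∑ i ∈ A, Real.exp (-(η * L j i)))),
    Finset.sum_add_distrib, Finset.sum_neg_distrib, ← Finset.mul_sum, ← Finset.mul_sum] at hsum
  have h0 : Real.log (∑ i ∈ A, Real.exp (-(η * L 0 i))) = Real.log A.card := by
    congr 1
    rw [Finset.sum_congr rfl fun i hi => by rw [hL0 i hi]]
    simp
  -- The weight of the comparator alone bounds the final potential from below.
  have hJ : -(η * L J b) ≤ Real.log (∑ i ∈ A, Real.exp (-(η * L J i))) := by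
    rw [Real.le_log_iff_exp_le (hW J)]
    exact Finset.single_le_sum (f := fun i => Real.exp (-(η * L J i)))
      (fun i _ => (Real.exp_pos _).le) hb
  rw [h0] at hsum
  rw [hLb] at hJ
  have h5 : η * ∑ j ∈ Finset.range J, ∑ a ∈ A, p j a * l j a ≤
      η * (∑ j ∈ Finset.range J, l j b + Real.log A.card / η +
        η / 2 * ∑ j ∈ Finset.range J, ∑ a ∈ A, p j a * l j a ^ 2) := by
    have : η * (Real.log A.card / η) = Real.log A.card := by field_simp
    rw [mul_add, mul_add, this]
    nlinarith
  exact le_of_mul_le_mul_left h5 hη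

/-! ### The bidding strategy -/

/-- The unnormalized probability of the bid `a / K` at the value `c / K` after `n` auctions, when
`Y` is the vector of estimated numbers of lost auctions. -/
noncomputable def weight (K n : ℕ) (Y : ℕ → ℝ) (c a : ℕ) : ℝ :=
  Real.exp (0 - ((a : ℝ) * n + ((c - a : ℕ) : ℝ) * Y a) / ((K : ℝ) * K * K))

/-- The probability of the bid `a / K` at the value `c / K`. -/
noncomputable def policy (K n : ℕ) (Y : ℕ → ℝ) (c a : ℕ) : ℝ :=
  weight K n Y c a / ∑ i ∈ Finset.range (K + 1), weight K n Y c i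

open Classical in
/-- Whether the bid `a / K` loses auction `t`. -/
noncomputable def lost (m : ℕ → unitInterval) (K t a : ℕ) : ℝ :=
  if (m t : ℝ) ≤ (a : ℝ) / K then 0 else 1

/-- The number of auctions before `t` with rounded value `c`. A play is a sequence of pairs: rounded
value and bid. -/
noncomputable def count (ξ : ℕ → ℕ × ℕ) (t c : ℕ) : ℝ :=
  ∑ s ∈ Finset.range t, if (ξ s).1 = c then 1 else 0

/-- An upper confidence bound on the probability of the rounded value `c` at the start of block
`j`. -/
noncomputable def mass (K : ℕ) (X : ℝ) (ξ : ℕ → ℕ × ℕ) (j c : ℕ) : ℝ :=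
  ((1 + 1 / K) * count ξ (j * (K + 1)) c + X) / ((j * (K + 1) : ℕ) + 1)

/-- The number of auctions among the first `k` ones of block `j` that are lost with bid `a / K`. -/
noncomputable def losses (m : ℕ → unitInterval) (K : ℕ) (ξ : ℕ → ℕ × ℕ) (j k a : ℕ) : ℝ :=
  ∑ s ∈ Finset.range k,
    if (ξ (j * (K + 1) + s)).2 = a then lost m K (j * (K + 1) + s) a else 0

/-- The estimated numbers of lost auctions at the start of block `j`. -/
noncomputable def estimate (m : ℕ → unitInterval) (K : ℕ) (X : ℝ) (ξ : ℕ → ℕ × ℕ) :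
    ℕ → ℕ → ℝ
  | 0 => fun _ => 0
  | j + 1 => fun a => estimate m K X ξ j a + losses m K ξ j (K + 1) a /
      ∑ c ∈ Finset.range (K + 1),
        mass K X ξ j c * policy K (j * (K + 1)) (estimate m K X ξ j) c a

/-- The probability of the bid `a / K` at the value `c / K` in block `j`. -/
noncomputable def prob (m : ℕ → unitInterval) (K : ℕ) (X : ℝ) (ξ : ℕ → ℕ × ℕ) (j c a : ℕ) : ℝ :=
  policy K (j * (K + 1)) (estimate m K X ξ j) c a

/-- The estimated frequency of the bid `a / K` in block `j`. -/
noncomputable def freqEst (m : ℕ → unitInterval) (K : ℕ) (X : ℝ) (ξ : ℕ → ℕ × ℕ) (j a : ℕ) : ℝ :=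
  ∑ c ∈ Finset.range (K + 1), mass K X ξ j c * prob m K X ξ j c a

/-- The true frequency of the bid `a / K` in block `j`, if `q` is the law of the rounded value. -/
noncomputable def freq (m : ℕ → unitInterval) (K : ℕ) (X : ℝ) (q : ℕ → ℝ) (ξ : ℕ → ℕ × ℕ)
    (j a : ℕ) : ℝ :=
  ∑ c ∈ Finset.range (K + 1), q c * prob m K X ξ j c a

/-- `g` depends on the first `t` entries of a play only. -/
def Adapted (t : ℕ) {α : Type*} (g : (ℕ → ℕ × ℕ) → α) : Prop :=
  ∀ ξ ξ' : ℕ → ℕ × ℕ, (∀ s < t, ξ s = ξ' s) → g ξ = g ξ'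

variable {m : ℕ → unitInterval} {K : ℕ} {X : ℝ} {q : ℕ → ℝ} {ξ : ℕ → ℕ × ℕ}

lemma weight_pos (K n : ℕ) (Y : ℕ → ℝ) (c a : ℕ) : 0 < weight K n Y c a := Real.exp_pos _

lemma weight_sum_pos (K n : ℕ) (Y : ℕ → ℝ) (c : ℕ) :
    0 < ∑ i ∈ Finset.range (K + 1), weight K n Y c i :=
  Finset.sum_pos (fun _ _ => weight_pos ..) ⟨0, by simp⟩

lemma policy_pos (K n : ℕ) (Y : ℕ → ℝ) (c a : ℕ) : 0 < policy K n Y c a :=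
  div_pos (weight_pos ..) (weight_sum_pos ..)

lemma policy_sum (K n : ℕ) (Y : ℕ → ℝ) (c : ℕ) :
    ∑ a ∈ Finset.range (K + 1), policy K n Y c a = 1 := by
  simp only [policy]
  rw [← Finset.sum_div, div_self (weight_sum_pos ..).ne']

lemma prob_pos (ξ) (j c a : ℕ) : 0 < prob m K X ξ j c a := policy_pos ..

lemma prob_sum (ξ) (j c : ℕ) : ∑ a ∈ Finset.range (K + 1), prob m K X ξ j c a = 1 := policy_sum ..

lemma lost_nonneg (t a : ℕ) : 0 ≤ lost m K t a := by
  unfold lost; split_ifs <;> norm_num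

lemma lost_le_one (t a : ℕ) : lost m K t a ≤ 1 := by
  unfold lost; split_ifs <;> norm_num

lemma losses_nonneg (j k a : ℕ) : 0 ≤ losses m K ξ j k a := by
  refine Finset.sum_nonneg fun s _ => ?_
  split_ifs
  · exact lost_nonneg ..
  · exact le_rfl

lemma count_nonneg (t c : ℕ) : 0 ≤ count ξ t c :=
  Finset.sum_nonneg fun s _ => by split_ifs <;> norm_num

/-- This floor turns an additive shortfall of `mass` into a multiplicative one in `freq_div_le`. -/
lemma mass_ge (j c : ℕ) : X / ((j * (K + 1) : ℕ) + 1) ≤ mass K X ξ j c := by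
  unfold mass
  gcongr
  have := count_nonneg (ξ := ξ) (j * (K + 1)) c
  have : 0 ≤ (1 + 1 / (K : ℝ)) * count ξ (j * (K + 1)) c := by positivity
  linarith

lemma mass_pos (hX : 0 < X) (j c : ℕ) : 0 < mass K X ξ j c :=
  lt_of_lt_of_le (by positivity) (mass_ge j c)

lemma freqEst_pos (hX : 0 < X) (j a : ℕ) : 0 < freqEst m K X ξ j a :=
  Finset.sum_pos (fun c _ => mul_pos (mass_pos hX j c) (prob_pos ..)) ⟨0, by simp⟩

lemma freq_nonneg (hq : ∀ c, 0 ≤ q c) (j a : ℕ) : 0 ≤ freq m K X q ξ j a :=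
  Finset.sum_nonneg fun c _ => mul_nonneg (hq c) (prob_pos ..).le

lemma freq_sum (hq1 : ∑ c ∈ Finset.range (K + 1), q c = 1) (j : ℕ) :
    ∑ a ∈ Finset.range (K + 1), freq m K X q ξ j a = 1 := by
  simp only [freq]
  rw [Finset.sum_comm]
  simp only [← Finset.mul_sum, prob_sum, mul_one, hq1]

lemma estimate_succ (j a : ℕ) : estimate m K X ξ (j + 1) a =
    estimate m K X ξ j a + losses m K ξ j (K + 1) a / freqEst m K X ξ j a := rfl

lemma Adapted.mono {α : Type*} {g : (ℕ → ℕ × ℕ) → α} {s t : ℕ} (h : Adapted s g) (hst : s ≤ t) :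
    Adapted t g := fun ξ ξ' hξ => h ξ ξ' fun i hi => hξ i (hi.trans_le hst)

lemma Adapted.comp₂ {α β γ : Type*} {g : (ℕ → ℕ × ℕ) → α} {h : (ℕ → ℕ × ℕ) → β} {t : ℕ}
    (hg : Adapted t g) (hh : Adapted t h) (φ : α → β → γ) : Adapted t fun ξ => φ (g ξ) (h ξ) :=
  fun ξ ξ' hξ => by simp only [hg ξ ξ' hξ, hh ξ ξ' hξ]

lemma Adapted.comp {α γ : Type*} {g : (ℕ → ℕ × ℕ) → α} {t : ℕ}
    (hg : Adapted t g) (φ : α → γ) : Adapted t fun ξ => φ (g ξ) :=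
  fun ξ ξ' hξ => by simp only [hg ξ ξ' hξ]

lemma adapted_count (t c : ℕ) : Adapted t fun ξ => count ξ t c := fun ξ ξ' h =>
  Finset.sum_congr rfl fun s hs => by rw [h s (Finset.mem_range.1 hs)]

lemma adapted_mass (j : ℕ) : Adapted (j * (K + 1)) fun ξ => mass K X ξ j := fun ξ ξ' h => by
  funext c
  simp only [mass, adapted_count _ c ξ ξ' h]

lemma adapted_losses (j k a : ℕ) : Adapted (j * (K + 1) + k) fun ξ => losses m K ξ j k a :=
  fun ξ ξ' h => Finset.sum_congr rfl fun s hs => by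
    rw [h _ (Nat.add_lt_add_left (Finset.mem_range.1 hs) _)]

/-- The policy of block `j` uses statistics of earlier blocks only, so it is a constant given the
past of the block. -/
lemma adapted_estimate (j : ℕ) : Adapted (j * (K + 1)) fun ξ => estimate m K X ξ j := by
  induction j with
  | zero => exact fun ξ ξ' _ => rfl
  | succ j ih =>
    intro ξ ξ' h
    have h' : ∀ s < j * (K + 1), ξ s = ξ' s := fun s hs => h s (by rw [add_mul]; omega)
    have h1 := ih ξ ξ' h'
    have h2 := adapted_mass (K := K) (X := X) j ξ ξ' h'
    simp only at h1 h2
    funext a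
    have h3 := adapted_losses (m := m) (K := K) j (K + 1) a ξ ξ' (by rwa [← Nat.succ_mul])
    simp only at h3
    simp only [estimate, h1, h2, h3]

lemma adapted_prob (j : ℕ) : Adapted (j * (K + 1)) fun ξ => prob m K X ξ j := fun ξ ξ' h => by
  have := adapted_estimate (m := m) (K := K) (X := X) j ξ ξ' h
  simp only at this
  funext c a
  simp only [prob, this]

lemma adapted_freqEst (j : ℕ) : Adapted (j * (K + 1)) fun ξ => freqEst m K X ξ j :=
  (adapted_mass j).comp₂ (adapted_prob j) fun μ p a => ∑ c ∈ Finset.range (K + 1), μ c * p c a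

lemma adapted_freq (j : ℕ) : Adapted (j * (K + 1)) fun ξ => freq m K X q ξ j :=
  (adapted_prob j).comp fun p a => ∑ c ∈ Finset.range (K + 1), q c * p c a

end FirstPrice

/-! ### Expectations over plays, and moments of counts and losses -/

namespace FirstPrice

/-- An expectation over plays. -/
structure IsMean (E : ((ℕ → ℕ × ℕ) → ℝ) → ℝ) : Prop where
  add : ∀ f g, E (fun ξ => f ξ + g ξ) = E f + E g
  smul : ∀ (r : ℝ) f, E (fun ξ => r * f ξ) = r * E f
  mono : ∀ f g, (∀ ξ, f ξ ≤ g ξ) → E f ≤ E g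
  one : E (fun _ => 1) = 1

/-- The expectation `E` describes a play in which, in each of the first `T` auctions, the rounded
value has law `q` and the bid is drawn from `prob`. -/
structure IsPlay (m : ℕ → unitInterval) (K : ℕ) (X : ℝ) (q : ℕ → ℝ) (T : ℕ)
    (E : ((ℕ → ℕ × ℕ) → ℝ) → ℝ) : Prop extends IsMean E where
  cond : ∀ j s, s < K + 1 → j * (K + 1) + s < T → ∀ F : (ℕ → ℕ × ℕ) → ℕ × ℕ → ℝ,
    Adapted (j * (K + 1) + s) F → E (fun ξ => F ξ (ξ (j * (K + 1) + s))) =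
      E fun ξ => ∑ c ∈ Finset.range (K + 1), ∑ a ∈ Finset.range (K + 1),
        q c * prob m K X ξ j c a * F ξ (c, a)

namespace IsMean

variable {E : ((ℕ → ℕ × ℕ) → ℝ) → ℝ} (hE : IsMean E)
include hE

lemma const (r : ℝ) : E (fun _ => r) = r := by
  have := hE.smul r (fun _ => 1)
  rw [hE.one] at this
  simpa using this

lemma sub (f g) : E (fun ξ => f ξ - g ξ) = E f - E g := by
  have h1 := hE.smul (-1) g
  have h2 := hE.add f (fun ξ => -1 * g ξ)
  rw [h1] at h2
  rw [show (fun ξ => f ξ - g ξ) = fun ξ => f ξ + -1 * g ξ by funext; ring, h2]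
  ring

lemma sum {ι : Type*} (s : Finset ι) (f : ι → (ℕ → ℕ × ℕ) → ℝ) :
    E (fun ξ => ∑ i ∈ s, f i ξ) = ∑ i ∈ s, E (f i) := by
  classical
  induction s using Finset.induction_on with
  | empty => simpa using hE.const 0
  | insert a s ha ih =>
    simp only [Finset.sum_insert ha]
    rw [hE.add, ih]

lemma nonneg {f} (hf : ∀ ξ, 0 ≤ f ξ) : 0 ≤ E f := by
  rw [← hE.const 0]
  exact hE.mono _ _ hf

end IsMean

variable {m : ℕ → unitInterval} {K : ℕ} {X : ℝ} {q : ℕ → ℝ} {T : ℕ}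

namespace IsPlay

variable {E : ((ℕ → ℕ × ℕ) → ℝ) → ℝ} (hE : IsPlay m K X q T E)
include hE

/-- Summing over the value leaves the averaged frequency `freq`, the quantity by which losses have
to be divided if an observation at one value is to serve all values. -/
lemma cond_bid {j s : ℕ} (hs : s < K + 1) (ht : j * (K + 1) + s < T) {G : (ℕ → ℕ × ℕ) → ℝ}
    (hG : Adapted (j * (K + 1) + s) G) {a : ℕ} (ha : a < K + 1) :
    E (fun ξ => G ξ * if (ξ (j * (K + 1) + s)).2 = a then 1 else 0) =
      E fun ξ => G ξ * freq m K X q ξ j a := by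
  rw [hE.cond j s hs ht (fun ξ z => G ξ * if z.2 = a then 1 else 0)
    (hG.comp fun g (z : ℕ × ℕ) => g * if z.2 = a then 1 else 0)]
  congr 1
  funext ξ
  rw [freq, Finset.mul_sum]
  refine Finset.sum_congr rfl fun c _ => ?_
  simp only [mul_ite, mul_one, mul_zero]
  rw [Finset.sum_ite_eq' (Finset.range (K + 1)) a, if_pos (Finset.mem_range.2 ha)]
  ring

lemma cond_value {t : ℕ} (ht : t < T) {G : (ℕ → ℕ × ℕ) → ℝ} (hG : Adapted t G) (φ : ℕ → ℝ) :
    E (fun ξ => G ξ * φ (ξ t).1) = (∑ c ∈ Finset.range (K + 1), q c * φ c) * E G := by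
  obtain ⟨j, s, hs, rfl⟩ : ∃ j s, s < K + 1 ∧ t = j * (K + 1) + s :=
    ⟨t / (K + 1), t % (K + 1), Nat.mod_lt _ (Nat.succ_pos _), (Nat.div_add_mod' _ _).symm⟩
  rw [hE.cond j s hs ht (fun ξ z => G ξ * φ z.1) (hG.comp fun g (z : ℕ × ℕ) => g * φ z.1), ← hE.smul]
  congr 1
  funext ξ
  rw [Finset.sum_mul]
  refine Finset.sum_congr rfl fun c _ => ?_
  dsimp only
  rw [← Finset.sum_mul, ← Finset.mul_sum, prob_sum]
  ring

lemma mean_count {c : ℕ} (hc : c < K + 1)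
    {t : ℕ} (ht : t ≤ T) : E (fun ξ => count ξ t c) = t * q c := by
  induction t with
  | zero => simpa [count] using hE.const 0
  | succ t ih =>
    simp only [count, Finset.sum_range_succ] at ih ⊢
    rw [hE.add, ih (by omega)]
    have := hE.cond_value (t := t) (by omega) (G := fun _ => 1) (fun _ _ _ => rfl)
      (fun i => if i = c then 1 else 0)
    simp only [mul_ite, mul_one, mul_zero] at this
    rw [this, hE.one, Finset.sum_ite_eq' (Finset.range (K + 1)) c,
      if_pos (Finset.mem_range.2 hc)]
    push_cast
    ring

/-- Chernoff's bound for the lower tail of the number of occurrences of a value. -/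
lemma mean_exp_count_le (hq : ∀ c, 0 ≤ q c) (hq1 : ∑ c ∈ Finset.range (K + 1), q c = 1)
    {c : ℕ} (hc : c < K + 1) {θ : ℝ} (hθ : 0 ≤ θ) {t : ℕ} (ht : t ≤ T) :
    E (fun ξ => Real.exp (-θ * count ξ t c)) ≤ Real.exp (t * q c * (-θ + θ ^ 2 / 2)) := by
  induction t with
  | zero => simpa [count] using (hE.const 1).le
  | succ t ih =>
    have h1 : (fun ξ => Real.exp (-θ * count ξ (t + 1) c)) = fun ξ =>
        Real.exp (-θ * count ξ t c) * if (ξ t).1 = c then Real.exp (-θ) else 1 := by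
      funext ξ
      simp only [count, Finset.sum_range_succ, mul_add, Real.exp_add]
      split_ifs <;> simp
    have h2 : ∑ i ∈ Finset.range (K + 1), q i * (if i = c then Real.exp (-θ) else 1) =
        1 + q c * (Real.exp (-θ) - 1) := by
      have : ∀ i ∈ Finset.range (K + 1), q i * (if i = c then Real.exp (-θ) else 1) =
          q i + if i = c then q c * (Real.exp (-θ) - 1) else 0 := by
        intro i _
        split_ifs with h
        · rw [h]; ring
        · ring
      rw [Finset.sum_congr rfl this, Finset.sum_add_distrib,
        Finset.sum_ite_eq' (Finset.range (K + 1)) c, if_pos (Finset.mem_range.2 hc), hq1]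
    rw [h1, hE.cond_value (by omega) ((adapted_count t c).comp fun x => Real.exp (-θ * x))
      (fun i => if i = c then Real.exp (-θ) else 1), h2]
    have h3 : 1 + q c * (Real.exp (-θ) - 1) ≤ Real.exp (q c * (-θ + θ ^ 2 / 2)) := by
      refine le_trans ?_ (Real.add_one_le_exp _)
      have := mul_le_mul_of_nonneg_left (exp_neg_le_quadratic hθ) (hq c)
      linarith
    have h4 : Real.exp ((t + 1 : ℕ) * q c * (-θ + θ ^ 2 / 2)) =
        Real.exp (q c * (-θ + θ ^ 2 / 2)) * Real.exp (t * q c * (-θ + θ ^ 2 / 2)) := by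
      rw [← Real.exp_add]; push_cast; congr 1; ring
    rw [h4]
    refine mul_le_mul h3 (ih (by omega)) (hE.nonneg fun _ => (Real.exp_pos _).le)
      (Real.exp_pos _).le

/-- The policy is frozen in the block, so each of its auctions has the same conditional frequency;
the adversary is oblivious, so `lost` is a constant under `E`. -/
lemma mean_losses {j k : ℕ} (hk : k ≤ K + 1) (ht : j * (K + 1) + k ≤ T) {G : (ℕ → ℕ × ℕ) → ℝ}
    (hG : Adapted (j * (K + 1)) G) {a : ℕ} (ha : a < K + 1) :
    E (fun ξ => G ξ * losses m K ξ j k a) =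
      E fun ξ => G ξ * freq m K X q ξ j a * ∑ s ∈ Finset.range k, lost m K (j * (K + 1) + s) a := by
  simp only [losses, Finset.mul_sum]
  rw [hE.sum, hE.sum]
  refine Finset.sum_congr rfl fun s hs => ?_
  have hs' := Finset.mem_range.1 hs
  have := hE.cond_bid (j := j) (s := s) (by omega) (by omega) (G := fun ξ =>
    lost m K (j * (K + 1) + s) a * G ξ)
    ((hG.comp fun g => lost m K (j * (K + 1) + s) a * g).mono (by omega)) ha
  calc _ = _ := by
        congr 1; funext ξ
        split_ifs <;> ring
    _ = _ := this
    _ = _ := by congr 1; funext ξ; ring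

/-- The rounds of a block are independent given the past. -/
lemma mean_losses_sq_le (hq : ∀ c, 0 ≤ q c) {j : ℕ} {G : (ℕ → ℕ × ℕ) → ℝ}
    (hG : Adapted (j * (K + 1)) G) (hG0 : ∀ ξ, 0 ≤ G ξ) {a : ℕ} (ha : a < K + 1) {k : ℕ}
    (hk : k ≤ K + 1) (ht : j * (K + 1) + k ≤ T) :
    E (fun ξ => G ξ * losses m K ξ j k a ^ 2) ≤
      E fun ξ => G ξ * (k * freq m K X q ξ j a + k ^ 2 * freq m K X q ξ j a ^ 2) := by
  induction k with
  | zero => simp [losses]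
  | succ k ih =>
    set y := lost m K (j * (K + 1) + k) a with hy
    have hy0 : 0 ≤ y := lost_nonneg ..
    have hy1 : y ≤ 1 := lost_le_one ..
    have hf : Adapted (j * (K + 1)) fun ξ => freq m K X q ξ j a :=
      (adapted_freq j).comp fun f => f a
    -- The indicator equals its square, and the factor in front of it depends on the past only, so
    -- `cond_bid` applies.
    have h1 : (fun ξ => G ξ * losses m K ξ j (k + 1) a ^ 2) = fun ξ =>
        G ξ * losses m K ξ j k a ^ 2 + (2 * y * (G ξ * losses m K ξ j k a) + y ^ 2 * G ξ) *
          if (ξ (j * (K + 1) + k)).2 = a then 1 else 0 := by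
      funext ξ
      simp only [losses, Finset.sum_range_succ]
      split_ifs <;> ring
    have h2 : Adapted (j * (K + 1) + k) fun ξ =>
        2 * y * (G ξ * losses m K ξ j k a) + y ^ 2 * G ξ :=
      (hG.mono (by omega)).comp₂ (adapted_losses j k a)
        fun g l => 2 * y * (g * l) + y ^ 2 * g
    have h3 := hE.mean_losses (j := j) (k := k) (by omega) (by omega)
      (hG.comp₂ hf fun g f => g * f) ha
    -- Twice this cross term adds $2k$ to the coefficient $k^2$ of the squared frequency, which
    -- stays below $(k+1)^2$.
    have h4 : E (fun ξ => G ξ * freq m K X q ξ j a * losses m K ξ j k a) ≤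
        E fun ξ => k * (G ξ * freq m K X q ξ j a ^ 2) := by
      rw [h3]
      refine hE.mono _ _ fun ξ => ?_
      have : ∑ s ∈ Finset.range k, lost m K (j * (K + 1) + s) a ≤ k := by
        refine (Finset.sum_le_sum fun s _ => lost_le_one ..).trans ?_
        simp
      have h5 : 0 ≤ G ξ * freq m K X q ξ j a ^ 2 := mul_nonneg (hG0 ξ) (sq_nonneg _)
      nlinarith
    have h4' : 0 ≤ E (fun ξ => G ξ * freq m K X q ξ j a * losses m K ξ j k a) :=
      hE.nonneg fun ξ => mul_nonneg (mul_nonneg (hG0 ξ) (freq_nonneg hq ..)) (losses_nonneg ..)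
    have h6 : 0 ≤ E (fun ξ => G ξ * freq m K X q ξ j a) :=
      hE.nonneg fun ξ => mul_nonneg (hG0 ξ) (freq_nonneg hq ..)
    have h7 : 0 ≤ E (fun ξ => G ξ * freq m K X q ξ j a ^ 2) :=
      hE.nonneg fun ξ => mul_nonneg (hG0 ξ) (sq_nonneg _)
    rw [h1, hE.add, hE.cond_bid (by omega) (by omega) h2 ha,
      show (fun ξ => (2 * y * (G ξ * losses m K ξ j k a) + y ^ 2 * G ξ) * freq m K X q ξ j a) =
        fun ξ => 2 * y * (G ξ * freq m K X q ξ j a * losses m K ξ j k a) +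
          y ^ 2 * (G ξ * freq m K X q ξ j a) by funext ξ; ring, hE.add, hE.smul, hE.smul]
    have h8 := ih (by omega) (by omega)
    rw [show (fun ξ => G ξ * (k * freq m K X q ξ j a + k ^ 2 * freq m K X q ξ j a ^ 2)) =
        fun ξ => k * (G ξ * freq m K X q ξ j a) + k ^ 2 * (G ξ * freq m K X q ξ j a ^ 2) by
        funext ξ; ring, hE.add, hE.smul, hE.smul] at h8
    rw [show (fun ξ => G ξ * ((k + 1 : ℕ) * freq m K X q ξ j a +
        (k + 1 : ℕ) ^ 2 * freq m K X q ξ j a ^ 2)) =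
        fun ξ => (k + 1) * (G ξ * freq m K X q ξ j a) +
          (k + 1) ^ 2 * (G ξ * freq m K X q ξ j a ^ 2) by
        funext ξ; push_cast; ring, hE.add, hE.smul, hE.smul]
    rw [hE.smul] at h4
    have h9 : 2 * y * E (fun ξ => G ξ * freq m K X q ξ j a * losses m K ξ j k a) ≤
        2 * (k * E fun ξ => G ξ * freq m K X q ξ j a ^ 2) :=
      mul_le_mul (by linarith) h4 h4' (by norm_num)
    have h10 : y ^ 2 * E (fun ξ => G ξ * freq m K X q ξ j a) ≤
        1 * E (fun ξ => G ξ * freq m K X q ξ j a) :=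
      mul_le_mul_of_nonneg_right (by nlinarith) h6
    nlinarith

end IsPlay

end FirstPrice

/-! ### Bias and second moment of the loss estimates -/

namespace FirstPrice

variable {m : ℕ → unitInterval} {K : ℕ} {X : ℝ} {q : ℕ → ℝ} {T : ℕ}

/-- The total underestimation of the law of the rounded values at the start of block `j`. -/
noncomputable def shortfall (K : ℕ) (X : ℝ) (q : ℕ → ℝ) (ξ : ℕ → ℕ × ℕ) (j : ℕ) : ℝ :=
  ∑ c ∈ Finset.range (K + 1), max (q c - mass K X ξ j c) 0

/-- The loss of the bid `a / K` at the value `c / K` in auction `t`. -/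
noncomputable def loss (m : ℕ → unitInterval) (K t c a : ℕ) : ℝ :=
  ((a : ℝ) + ((c - a : ℕ) : ℝ) * lost m K t a) / K

/-- The estimated loss of the bid `a / K` at the value `c / K` in block `j`. -/
noncomputable def lossEst (m : ℕ → unitInterval) (K : ℕ) (X : ℝ) (ξ : ℕ → ℕ × ℕ)
    (j c a : ℕ) : ℝ :=
  (((K + 1 : ℕ) : ℝ) * a +
    ((c - a : ℕ) : ℝ) * (losses m K ξ j (K + 1) a / freqEst m K X ξ j a)) / K

/-- The bias of the estimated losses of the bidder in block `j`. -/
noncomputable def bias (m : ℕ → unitInterval) (K : ℕ) (X : ℝ) (q : ℕ → ℝ) (ξ : ℕ → ℕ × ℕ)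
    (j : ℕ) : ℝ :=
  ∑ a ∈ Finset.range (K + 1),
    freq m K X q ξ j a * max (1 - freq m K X q ξ j a / freqEst m K X ξ j a) 0

lemma shortfall_nonneg (ξ : ℕ → ℕ × ℕ) (j : ℕ) : 0 ≤ shortfall K X q ξ j :=
  Finset.sum_nonneg fun _ _ => le_max_right _ _

lemma shortfall_le_one (hX : 0 < X) (hq : ∀ c, 0 ≤ q c)
    (hq1 : ∑ c ∈ Finset.range (K + 1), q c = 1) (ξ : ℕ → ℕ × ℕ) (j : ℕ) :
    shortfall K X q ξ j ≤ 1 := by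
  rw [← hq1]
  refine Finset.sum_le_sum fun c _ => max_le ?_ (hq c)
  linarith [mass_pos (K := K) (ξ := ξ) hX j c]

/-- Termwise, $q_c$ is at most `mass` plus the shortfall, and $1\le\frac{n+1}{X}\cdot$ `mass` by
`mass_ge`. -/
lemma freq_div_le (hX : 0 < X) (ξ : ℕ → ℕ × ℕ) (j a : ℕ) :
    freq m K X q ξ j a / freqEst m K X ξ j a ≤
      1 + shortfall K X q ξ j * (((j * (K + 1) : ℕ) + 1) / X) := by
  rw [div_le_iff₀ (freqEst_pos hX j a), freq, freqEst, Finset.mul_sum]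
  refine Finset.sum_le_sum fun c hc => ?_
  rw [← mul_assoc]
  refine mul_le_mul_of_nonneg_right ?_ (prob_pos ..).le
  have h1 : q c - mass K X ξ j c ≤ shortfall K X q ξ j :=
    (le_max_left _ 0).trans (Finset.single_le_sum
      (f := fun c => max (q c - mass K X ξ j c) 0) (fun _ _ => le_max_right _ _) hc)
  have h2 : 1 ≤ ((j * (K + 1) : ℕ) + 1) / X * mass K X ξ j c := by
    have := mul_le_mul_of_nonneg_left (mass_ge (K := K) (X := X) (ξ := ξ) j c)
      (show 0 ≤ (((j * (K + 1) : ℕ) : ℝ) + 1) / X by positivity)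
    refine le_trans (le_of_eq ?_) this
    field_simp
  have h3 := mul_le_mul_of_nonneg_left h2 (shortfall_nonneg (K := K) (X := X) (q := q) ξ j)
  nlinarith

lemma freq_div_nonneg (hX : 0 < X) (hq : ∀ c, 0 ≤ q c) (ξ : ℕ → ℕ × ℕ) (j a : ℕ) :
    0 ≤ freq m K X q ξ j a / freqEst m K X ξ j a :=
  div_nonneg (freq_nonneg hq j a) (freqEst_pos hX j a).le

/-- Serves the first block, where nothing has been counted yet and the bound through `mass` is too
weak. -/
lemma bias_le_one (hX : 0 < X) (hq : ∀ c, 0 ≤ q c)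
    (hq1 : ∑ c ∈ Finset.range (K + 1), q c = 1) (ξ : ℕ → ℕ × ℕ) (j : ℕ) :
    bias m K X q ξ j ≤ 1 := by
  rw [← freq_sum (m := m) (X := X) (ξ := ξ) hq1 j]
  refine Finset.sum_le_sum fun a _ => mul_le_of_le_one_right (freq_nonneg hq j a) ?_
  exact max_le (by linarith [freq_div_nonneg (m := m) (K := K) hX hq ξ j a]) zero_le_one

/-- Where $f\le g$, the summand $f(1-f/g)=(f/g)(g-f)$ is at most $g-f$. Summing over bids removes
the policy and leaves the positive part of `mass` minus $q$, which is the signed difference plus the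
shortfall; the signed difference has a computable mean. -/
lemma bias_le (hX : 0 < X) (ξ : ℕ → ℕ × ℕ) (j : ℕ) :
    bias m K X q ξ j ≤
      ∑ c ∈ Finset.range (K + 1), (mass K X ξ j c - q c) + shortfall K X q ξ j := by
  have h1 : bias m K X q ξ j ≤ ∑ a ∈ Finset.range (K + 1), ∑ c ∈ Finset.range (K + 1),
      max (mass K X ξ j c - q c) 0 * prob m K X ξ j c a := by
    refine Finset.sum_le_sum fun a _ => ?_
    have hpos := freqEst_pos (m := m) (K := K) (ξ := ξ) hX j a
    have h2 : freqEst m K X ξ j a - freq m K X q ξ j a ≤ ∑ c ∈ Finset.range (K + 1),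
        max (mass K X ξ j c - q c) 0 * prob m K X ξ j c a := by
      rw [freqEst, freq, ← Finset.sum_sub_distrib]
      refine Finset.sum_le_sum fun c _ => ?_
      rw [← sub_mul]
      exact mul_le_mul_of_nonneg_right (le_max_left _ _) (prob_pos ..).le
    rcases le_total (freq m K X q ξ j a) (freqEst m K X ξ j a) with h | h
    · refine le_trans ?_ h2
      have h3 : freq m K X q ξ j a / freqEst m K X ξ j a ≤ 1 := (div_le_one hpos).2 h
      rw [max_eq_left (by linarith)]
      have h4 : freq m K X q ξ j a * (1 - freq m K X q ξ j a / freqEst m K X ξ j a) =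
          freq m K X q ξ j a / freqEst m K X ξ j a *
            (freqEst m K X ξ j a - freq m K X q ξ j a) := by field_simp
      rw [h4]
      exact mul_le_of_le_one_left (by linarith) h3
    · have h3 : 1 ≤ freq m K X q ξ j a / freqEst m K X ξ j a := (one_le_div hpos).2 h
      rw [max_eq_right (by linarith), mul_zero]
      exact Finset.sum_nonneg fun c _ => mul_nonneg (le_max_right _ _) (prob_pos ..).le
  refine h1.trans (le_of_eq ?_)
  rw [Finset.sum_comm, shortfall, ← Finset.sum_add_distrib]
  refine Finset.sum_congr rfl fun c _ => ?_
  rw [← Finset.mul_sum, prob_sum, mul_one]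
  rcases le_total (q c) (mass K X ξ j c) with h | h
  · rw [max_eq_left (by linarith), max_eq_right (by linarith)]; ring
  · rw [max_eq_right (by linarith), max_eq_left (by linarith)]; ring

lemma sub_div_mem {c a : ℕ} (hc : c < K + 1) :
    0 ≤ ((c - a : ℕ) : ℝ) / K ∧ ((c - a : ℕ) : ℝ) / K ≤ 1 := by
  refine ⟨by positivity, div_le_one_of_le₀ ?_ (by positivity)⟩
  exact_mod_cast (Nat.sub_le c a).trans (Nat.lt_succ_iff.1 hc)

lemma loss_nonneg (t c a : ℕ) : 0 ≤ loss m K t c a :=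
  div_nonneg (add_nonneg (Nat.cast_nonneg _) (mul_nonneg (Nat.cast_nonneg _) (lost_nonneg ..)))
    (Nat.cast_nonneg _)

lemma loss_le_one {t c a : ℕ} (hc : c < K + 1) (ha : a < K + 1) : loss m K t c a ≤ 1 := by
  refine div_le_one_of_le₀ ?_ (Nat.cast_nonneg _)
  have h1 := mul_le_mul_of_nonneg_left (lost_le_one (m := m) (K := K) t a)
    (Nat.cast_nonneg (c - a : ℕ) : (0 : ℝ) ≤ _)
  have h2 : (a : ℝ) + ((c - a : ℕ) : ℝ) ≤ K := by norm_cast; omega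
  linarith

lemma lossEst_nonneg (hX : 0 < X) (ξ : ℕ → ℕ × ℕ) (j c a : ℕ) : 0 ≤ lossEst m K X ξ j c a :=
  div_nonneg (add_nonneg (by positivity) (mul_nonneg (Nat.cast_nonneg _)
    (div_nonneg (losses_nonneg ..) (freqEst_pos hX j a).le))) (Nat.cast_nonneg _)

/-- The regret bound of exponential weights with respect to the estimated losses. -/
lemma sum_lossEst_le (hX : 0 < X) (hK : 1 ≤ K) (ξ : ℕ → ℕ × ℕ) (J c : ℕ) {b : ℕ}
    (hb : b < K + 1) :
    ∑ j ∈ Finset.range J, ∑ a ∈ Finset.range (K + 1), prob m K X ξ j c a * lossEst m K X ξ j c a ≤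
      ∑ j ∈ Finset.range J, lossEst m K X ξ j c b + Real.log (K + 1) * K ^ 2 +
        1 / (2 * K ^ 2) * ∑ j ∈ Finset.range J, ∑ a ∈ Finset.range (K + 1),
          prob m K X ξ j c a * lossEst m K X ξ j c a ^ 2 := by
  have hK' : (0 : ℝ) < K := by exact_mod_cast hK
  -- The rate $1/K^2$ and the normalization of losses by $K$ make up the $K^3$ in `weight`. The
  -- cumulative loss consists of the known part $a$ times the number of past auctions and of the
  -- estimated part.
  have h := exponential_weights_regret (Finset.range (K + 1)) (1 / (K : ℝ) ^ 2) (by positivity)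
    (fun j a => lossEst m K X ξ j c a)
    (fun j a => ((a : ℝ) * (j * (K + 1) : ℕ) + ((c - a : ℕ) : ℝ) * estimate m K X ξ j a) / K)
    (fun j a => prob m K X ξ j c a) (fun j a _ => lossEst_nonneg hX ξ j c a)
    (fun a _ => by simp [estimate]) (fun j a _ => by
      simp only [lossEst, estimate_succ]; push_cast; ring)
    (fun j a _ => by
      have : ∀ i, weight K (j * (K + 1)) (estimate m K X ξ j) c i = Real.exp (-(1 / (K : ℝ) ^ 2 *
          (((i : ℝ) * (j * (K + 1) : ℕ) + ((c - i : ℕ) : ℝ) * estimate m K X ξ j i) / K))) := by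
        intro i
        rw [weight]
        congr 1
        field_simp
        ring
      simp only [prob, policy, this]) J b (Finset.mem_range.2 hb)
  simp only [Finset.card_range] at h
  convert h using 2
  · congr 1
    push_cast
    field_simp
  · field_simp

namespace IsPlay

variable {E : ((ℕ → ℕ × ℕ) → ℝ) → ℝ} (hE : IsPlay m K X q T E)
include hE

/-- The positive part of $q_c$ minus `mass` is dominated by an exponential of `count`, to which the
Chernoff bound applies. The inflation $1+1/K$ absorbs the quadratic term of that bound, and $X$
supplies the factor $T^{-4}$. -/
lemma mean_shortfall_le (hT : 1 ≤ T) (hK : 1 ≤ K) (hKT : K ≤ T)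
    (hX : X = 8 * K * (1 + Real.log T)) (hq : ∀ c, 0 ≤ q c)
    (hq1 : ∑ c ∈ Finset.range (K + 1), q c = 1) {j : ℕ} (hj : j * (K + 1) ≤ T) :
    E (fun ξ => shortfall K X q ξ j) ≤ 4 / T ^ 2 := by
  have hK' : (1 : ℝ) ≤ K := by exact_mod_cast hK
  have hT' : (1 : ℝ) ≤ T := by exact_mod_cast hT
  have hKT' : (K : ℝ) ≤ T := by exact_mod_cast hKT
  set n := j * (K + 1) with hn
  have key : ∀ c ∈ Finset.range (K + 1),
      E (fun ξ => max (q c - mass K X ξ j c) 0) ≤ 2 * K / T ^ 4 := by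
    intro c hc
    have hqc : q c ≤ 1 := by
      rw [← hq1]; exact Finset.single_le_sum (f := q) (fun i _ => hq i) hc
    -- With this scale the inflation factor is $1+2s$, and $\theta=s+2s^2$ satisfies
    -- $-\theta+\theta^2/2\le -s$ exactly when $2s+2s^2\le 3/2$, which $s\le 1/2$ ensures.
    set s : ℝ := 1 / (2 * K) with hs
    have hs0 : 0 < s := by positivity
    have hs1 : s ≤ 1 / 2 := by
      rw [hs]; apply one_div_le_one_div_of_le <;> linarith
    set θ : ℝ := s * (1 + 1 / K) with hθ
    have hθ0 : 0 ≤ θ := by positivity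
    have hθs : -θ + θ ^ 2 / 2 ≤ -s := by
      have h1 : 1 / (K : ℝ) = 2 * s := by rw [hs]; field_simp
      rw [hθ, h1]
      nlinarith [mul_pos hs0 hs0, mul_nonneg (mul_pos hs0 hs0).le (sub_nonneg.2 hs1)]
    -- For a positive gap $y$ the chain is $y\le (n+1)y=2K\cdot s(n+1)y\le 2K e^{s(n+1)y}$, and
    -- $s(n+1)$ times `mass` is $\theta$ times the count plus $sX$.
    have hpt : ∀ ξ, max (q c - mass K X ξ j c) 0 ≤
        2 * K * Real.exp (s * (n + 1) * q c - s * X) * Real.exp (-θ * count ξ n c) := by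
      intro ξ
      refine max_le ?_ (by positivity)
      rw [mul_assoc, ← Real.exp_add]
      have h1 : s * (n + 1) * q c - s * X + -θ * count ξ n c =
          s * (n + 1) * (q c - mass K X ξ j c) := by
        rw [mass, ← hn, hθ]
        field_simp
        ring
      rw [h1]
      rcases le_total (q c - mass K X ξ j c) 0 with h | h
      · exact h.trans (by positivity)
      · have h2 := Real.add_one_le_exp (s * (n + 1) * (q c - mass K X ξ j c))
        have h3 : q c - mass K X ξ j c ≤ (n + 1) * (q c - mass K X ξ j c) :=
          le_mul_of_one_le_left h (by linarith [(Nat.cast_nonneg n : (0 : ℝ) ≤ n)])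
        have h4 : 2 * K * (s * (n + 1) * (q c - mass K X ξ j c)) =
            (n + 1) * (q c - mass K X ξ j c) := by rw [hs]; field_simp
        have h5 := mul_le_mul_of_nonneg_left
          (show s * (n + 1) * (q c - mass K X ξ j c) ≤ _ by linarith)
          (show (0 : ℝ) ≤ 2 * K by positivity)
        linarith
    refine (hE.mono _ _ hpt).trans ?_
    rw [hE.smul]
    have h6 := hE.mean_exp_count_le hq hq1 (Finset.mem_range.1 hc) hθ0 hj
    have h7 : Real.exp (s * (n + 1) * q c - s * X) * Real.exp (n * q c * (-θ + θ ^ 2 / 2)) ≤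
        1 / T ^ 4 := by
      rw [← Real.exp_add]
      -- The summand 4 pays for the leftover $sq_c\le 1$ coming from $n+1$ against $n$; the rest is
      -- $T^{-4}$.
      have h8 : s * X = 4 * (1 + Real.log T) := by
        rw [hs, hX]
        field_simp
        ring
      have h9 : n * q c * (-θ + θ ^ 2 / 2) ≤ n * q c * (-s) :=
        mul_le_mul_of_nonneg_left hθs (mul_nonneg (Nat.cast_nonneg _) (hq c))
      have h10 : s * q c ≤ 1 := by nlinarith [hq c]
      calc _ ≤ Real.exp (-(4 * Real.log T)) := by
            apply Real.exp_le_exp.2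
            rw [h8]
            nlinarith
        _ = 1 / T ^ 4 := by
            rw [Real.exp_neg, one_div, ← Real.exp_log (show (0 : ℝ) < T by linarith),
              ← Real.exp_nat_mul, Real.log_exp]
            norm_num
    calc _ ≤ 2 * K * Real.exp (s * (n + 1) * q c - s * X) *
          Real.exp (n * q c * (-θ + θ ^ 2 / 2)) :=
          mul_le_mul_of_nonneg_left h6 (by positivity)
      _ ≤ 2 * K * (1 / T ^ 4) := by
          rw [mul_assoc]; exact mul_le_mul_of_nonneg_left h7 (by positivity)
      _ = _ := by ring
  simp only [shortfall]
  rw [hE.sum]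
  refine (Finset.sum_le_sum key).trans ?_
  rw [Finset.sum_const, Finset.card_range, nsmul_eq_mul]
  push_cast
  rw [mul_div_assoc', div_le_div_iff₀ (by positivity) (by positivity)]
  have h1 : (K + 1) * (2 * (K : ℝ)) ≤ 4 * T ^ 2 := by nlinarith
  calc ((K : ℝ) + 1) * (2 * K) * T ^ 2 ≤ 4 * T ^ 2 * T ^ 2 :=
        mul_le_mul_of_nonneg_right h1 (by positivity)
    _ = _ := by ring

/-- The inflation factor contributes $1/K$ in total, and the additive term $X/(n+1)$ is paid once
for each of the $K+1$ values. -/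
lemma mean_bias_le (hX : 0 < X) (hq : ∀ c, 0 ≤ q c)
    (hq1 : ∑ c ∈ Finset.range (K + 1), q c = 1) {j : ℕ} (hj : j * (K + 1) ≤ T) :
    E (fun ξ => bias m K X q ξ j) ≤ 1 / K + (K + 1) * X / ((j * (K + 1) : ℕ) + 1) +
      E (fun ξ => shortfall K X q ξ j) := by
  refine (hE.mono _ _ (bias_le hX · j)).trans ?_
  rw [hE.add, hE.sum]
  gcongr
  set n := j * (K + 1) with hn
  have h1 : ∀ c ∈ Finset.range (K + 1), E (fun ξ => mass K X ξ j c - q c) ≤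
      1 / K * q c + X / (n + 1) := by
    intro c hc
    have h2 : (fun ξ => mass K X ξ j c) = fun ξ =>
        (1 + 1 / (K : ℝ)) / (n + 1) * count ξ n c + X / (n + 1) := by
      funext ξ; rw [mass, ← hn]; ring
    rw [hE.sub (fun ξ => mass K X ξ j c), hE.const, h2, hE.add, hE.smul, hE.const,
      hE.mean_count (Finset.mem_range.1 hc) hj]
    have h3 : (1 + 1 / (K : ℝ)) / (n + 1) * (n * q c) ≤ (1 + 1 / K) * q c := by
      rw [div_mul_eq_mul_div, div_le_iff₀ (by positivity)]
      have : 0 ≤ (1 + 1 / (K : ℝ)) * q c := mul_nonneg (by positivity) (hq c)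
      nlinarith
    linarith
  refine (Finset.sum_le_sum h1).trans (le_of_eq ?_)
  rw [Finset.sum_add_distrib, ← Finset.mul_sum, hq1]
  simp
  ring

lemma mean_loss {j s : ℕ} (hs : s < K + 1) (ht : j * (K + 1) + s < T) :
    E (fun ξ => loss m K (j * (K + 1) + s) (ξ (j * (K + 1) + s)).1 (ξ (j * (K + 1) + s)).2) =
      E fun ξ => ∑ c ∈ Finset.range (K + 1), ∑ a ∈ Finset.range (K + 1),
        q c * prob m K X ξ j c a * loss m K (j * (K + 1) + s) c a :=
  hE.cond j s hs ht (fun _ z => loss m K (j * (K + 1) + s) z.1 z.2) fun _ _ _ => rfl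

lemma mean_loss_le_one (hq : ∀ c, 0 ≤ q c) (hq1 : ∑ c ∈ Finset.range (K + 1), q c = 1)
    {t : ℕ} (ht : t < T) : E (fun ξ => loss m K t (ξ t).1 (ξ t).2) ≤ 1 := by
  obtain ⟨j, s, hs, rfl⟩ : ∃ j s, s < K + 1 ∧ t = j * (K + 1) + s :=
    ⟨t / (K + 1), t % (K + 1), Nat.mod_lt _ (Nat.succ_pos _), (Nat.div_add_mod' _ _).symm⟩
  rw [hE.mean_loss hs ht]
  refine (hE.mono _ (fun _ => 1) fun ξ => ?_).trans hE.one.le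
  rw [← hq1]
  refine Finset.sum_le_sum fun c hc => ?_
  calc _ ≤ ∑ a ∈ Finset.range (K + 1), q c * prob m K X ξ j c a * 1 :=
        Finset.sum_le_sum fun a ha => mul_le_mul_of_nonneg_left
          (loss_le_one (Finset.mem_range.1 hc) (Finset.mem_range.1 ha))
          (mul_nonneg (hq c) (prob_pos ..).le)
    _ = q c := by simp only [mul_one]; rw [← Finset.mul_sum, prob_sum, mul_one]

/-- The payment part of the loss is known and not estimated; dividing by `freqEst` instead of `freq`
scales only the unknown part, by the ratio of the two. -/
lemma mean_lossEst {j : ℕ} (ht : j * (K + 1) + (K + 1) ≤ T)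
    {G : (ℕ → ℕ × ℕ) → ℝ} (hG : Adapted (j * (K + 1)) G) (c : ℕ) {a : ℕ} (ha : a < K + 1) :
    E (fun ξ => G ξ * lossEst m K X ξ j c a) =
      E fun ξ => G ξ * ((((K + 1 : ℕ) : ℝ) * a + ((c - a : ℕ) : ℝ) *
        (freq m K X q ξ j a / freqEst m K X ξ j a *
          ∑ s ∈ Finset.range (K + 1), lost m K (j * (K + 1) + s) a)) / K) := by
  have h := hE.mean_losses (j := j) le_rfl ht (hG.comp₂ (adapted_freqEst (m := m) (X := X) j)
    fun g f => g * (((c - a : ℕ) : ℝ) / (f a * K))) ha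
  have h1 : (fun ξ => G ξ * lossEst m K X ξ j c a) = fun ξ =>
      G ξ * ((((K + 1 : ℕ) : ℝ) * a) / K) + G ξ * (((c - a : ℕ) : ℝ) /
        (freqEst m K X ξ j a * K)) * losses m K ξ j (K + 1) a := by
    funext ξ
    rw [lossEst, mul_comm (freqEst m K X ξ j a), ← div_div]
    ring
  rw [h1, hE.add, h, ← hE.add]
  congr 1
  funext ξ
  rw [mul_comm (freqEst m K X ξ j a) (K : ℝ), ← div_div]
  ring

/-- The expected loss of the bidder in a block is at most the expected estimated loss, up to the
bias. -/
lemma mean_block_loss_le (hq : ∀ c, 0 ≤ q c) {j : ℕ} (ht : j * (K + 1) + (K + 1) ≤ T) :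
    ∑ s ∈ Finset.range (K + 1),
      E (fun ξ => loss m K (j * (K + 1) + s) (ξ (j * (K + 1) + s)).1 (ξ (j * (K + 1) + s)).2) ≤
    E (fun ξ => ∑ c ∈ Finset.range (K + 1), q c * ∑ a ∈ Finset.range (K + 1),
        prob m K X ξ j c a * lossEst m K X ξ j c a) +
      (K + 1) * E (fun ξ => bias m K X q ξ j) := by
  have h1 : E (fun ξ => ∑ c ∈ Finset.range (K + 1), q c * ∑ a ∈ Finset.range (K + 1),
        prob m K X ξ j c a * lossEst m K X ξ j c a) =
      E fun ξ => ∑ c ∈ Finset.range (K + 1), ∑ a ∈ Finset.range (K + 1),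
        q c * prob m K X ξ j c a * ((((K + 1 : ℕ) : ℝ) * a + ((c - a : ℕ) : ℝ) *
        (freq m K X q ξ j a / freqEst m K X ξ j a *
          ∑ s ∈ Finset.range (K + 1), lost m K (j * (K + 1) + s) a)) / K) := by
    rw [hE.sum, hE.sum]
    refine Finset.sum_congr rfl fun c _ => ?_
    rw [show (fun ξ => q c * ∑ a ∈ Finset.range (K + 1),
        prob m K X ξ j c a * lossEst m K X ξ j c a) = fun ξ => ∑ a ∈ Finset.range (K + 1),
          q c * prob m K X ξ j c a * lossEst m K X ξ j c a by
        funext ξ; rw [Finset.mul_sum]; simp only [mul_assoc], hE.sum, hE.sum]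
    refine Finset.sum_congr rfl fun a ha => ?_
    exact hE.mean_lossEst ht ((adapted_prob j).comp fun p => q c * p c a) c
      (Finset.mem_range.1 ha)
  rw [Finset.sum_congr rfl fun s hs => hE.mean_loss (j := j) (Finset.mem_range.1 hs)
    (by have := Finset.mem_range.1 hs; omega), ← hE.sum, h1, ← hE.smul, ← hE.add]
  refine hE.mono _ _ fun ξ => ?_
  have h0 : (K + 1) * bias m K X q ξ j = ∑ c ∈ Finset.range (K + 1),
      ∑ a ∈ Finset.range (K + 1), (K + 1) * (q c * prob m K X ξ j c a *
        max (1 - freq m K X q ξ j a / freqEst m K X ξ j a) 0) := by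
    rw [Finset.sum_comm, bias, Finset.mul_sum]
    refine Finset.sum_congr rfl fun a _ => ?_
    rw [← Finset.mul_sum, ← Finset.sum_mul]
    rfl
  rw [Finset.sum_comm, h0, ← sub_le_iff_le_add', ← Finset.sum_sub_distrib]
  refine Finset.sum_le_sum fun c hc => ?_
  rw [Finset.sum_comm, ← Finset.sum_sub_distrib]
  refine Finset.sum_le_sum fun a _ => ?_
  set r := freq m K X q ξ j a / freqEst m K X ξ j a
  set p := q c * prob m K X ξ j c a with hp
  have hp0 : 0 ≤ p := mul_nonneg (hq c) (prob_pos ..).le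
  have hd := sub_div_mem (a := a) (Finset.mem_range.1 hc)
  have h2 : ∑ s ∈ Finset.range (K + 1), p * loss m K (j * (K + 1) + s) c a =
      p * ((((K + 1 : ℕ) : ℝ) * a + ((c - a : ℕ) : ℝ) *
        ∑ s ∈ Finset.range (K + 1), lost m K (j * (K + 1) + s) a) / K) := by
    rw [← Finset.mul_sum]
    simp only [loss]
    rw [← Finset.sum_div, Finset.sum_add_distrib, ← Finset.mul_sum]
    simp
  set Y := ∑ s ∈ Finset.range (K + 1), lost m K (j * (K + 1) + s) a with hY
  have hY0 : 0 ≤ Y := Finset.sum_nonneg fun _ _ => lost_nonneg ..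
  have hY1 : Y ≤ K + 1 := by
    refine (Finset.sum_le_sum fun s _ => lost_le_one ..).trans ?_
    simp
  -- The bidder's loss is underestimated only if the ratio is below 1, and a block contains at most
  -- $K+1$ lost auctions.
  have h3 : ((c - a : ℕ) : ℝ) / K * Y * (1 - r) ≤ (K + 1) * max (1 - r) 0 := by
    have h4 : 0 ≤ ((c - a : ℕ) : ℝ) / K * Y := mul_nonneg hd.1 hY0
    have h5 : ((c - a : ℕ) : ℝ) / K * Y ≤ K + 1 := by nlinarith
    calc _ ≤ ((c - a : ℕ) : ℝ) / K * Y * max (1 - r) 0 :=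
          mul_le_mul_of_nonneg_left (le_max_left _ _) h4
      _ ≤ _ := mul_le_mul_of_nonneg_right h5 (le_max_right _ _)
  rw [h2]
  have h6 := mul_le_mul_of_nonneg_left h3 hp0
  refine le_trans (le_of_eq ?_) (h6.trans (le_of_eq ?_)) <;> ring

/-- The expected estimated loss of a fixed bid in a block. -/
lemma mean_lossEst_le (hX : 0 < X) {j c b : ℕ} (ht : j * (K + 1) + (K + 1) ≤ T)
    (hc : c < K + 1) (hb : b < K + 1) :
    E (fun ξ => lossEst m K X ξ j c b) ≤
      ∑ s ∈ Finset.range (K + 1), loss m K (j * (K + 1) + s) c b +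
        (K + 1) * (((j * (K + 1) : ℕ) + 1) / X) * E (fun ξ => shortfall K X q ξ j) := by
  have h := hE.mean_lossEst ht (G := fun _ => 1) (fun _ _ _ => rfl) c hb
  simp only [one_mul] at h
  rw [h, ← hE.const (∑ s ∈ Finset.range (K + 1), loss m K (j * (K + 1) + s) c b), ← hE.smul,
    ← hE.add]
  refine hE.mono _ _ fun ξ => ?_
  simp only [loss]
  rw [← Finset.sum_div, Finset.sum_add_distrib, ← Finset.mul_sum]
  have hr := freq_div_le (m := m) (K := K) (q := q) hX ξ j b
  have hd := sub_div_mem (a := b) hc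
  set r := freq m K X q ξ j b / freqEst m K X ξ j b
  set Y := ∑ s ∈ Finset.range (K + 1), lost m K (j * (K + 1) + s) b with hY
  set D := shortfall K X q ξ j * (((j * (K + 1) : ℕ) + 1) / X) with hD
  have hD0 : 0 ≤ D := mul_nonneg (shortfall_nonneg ..) (by positivity)
  have hY0 : 0 ≤ Y := Finset.sum_nonneg fun _ _ => lost_nonneg ..
  have hY1 : Y ≤ K + 1 := by
    refine (Finset.sum_le_sum fun s _ => lost_le_one ..).trans ?_
    simp
  have h4 : 0 ≤ ((c - b : ℕ) : ℝ) / K * Y := mul_nonneg hd.1 hY0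
  have h5 : ((c - b : ℕ) : ℝ) / K * Y ≤ K + 1 := by nlinarith
  -- For a comparator only a ratio above 1 does harm, and that requires a shortfall.
  have h6 : ((c - b : ℕ) : ℝ) / K * Y * r ≤ ((c - b : ℕ) : ℝ) / K * Y + (K + 1) * D := by
    calc _ ≤ ((c - b : ℕ) : ℝ) / K * Y * (1 + D) := mul_le_mul_of_nonneg_left hr h4
      _ ≤ _ := by nlinarith
  rw [show ((K : ℝ) + 1) * (((j * (K + 1) : ℕ) + 1) / X) * shortfall K X q ξ j =
    (K + 1) * D by rw [hD]; ring]
  simp only [Finset.sum_const, Finset.card_range, nsmul_eq_mul]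
  refine le_trans (le_of_eq ?_) ((add_le_add_right h6 (((K + 1 : ℕ) : ℝ) * b / K)).trans
    (le_of_eq ?_)) <;> ring

/-- The second moment of the estimated losses. -/
lemma mean_lossEst_sq_le (hT : 1 ≤ T) (hX : 1 ≤ X) (hq : ∀ c, 0 ≤ q c)
    (hq1 : ∑ c ∈ Finset.range (K + 1), q c = 1) {j : ℕ} (ht : j * (K + 1) + (K + 1) ≤ T) :
    E (fun ξ => ∑ c ∈ Finset.range (K + 1), q c * ∑ a ∈ Finset.range (K + 1),
        prob m K X ξ j c a * lossEst m K X ξ j c a ^ 2) ≤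
      (K + 1) ^ 2 * (6 + 12 * T ^ 2 * E (fun ξ => shortfall K X q ξ j)) := by
  have hX0 : 0 < X := by linarith
  have h1 : ∀ ξ, ∑ c ∈ Finset.range (K + 1), q c * ∑ a ∈ Finset.range (K + 1),
        prob m K X ξ j c a * lossEst m K X ξ j c a ^ 2 ≤ 2 * (K + 1) ^ 2 +
      ∑ a ∈ Finset.range (K + 1), 2 * (freq m K X q ξ j a / freqEst m K X ξ j a ^ 2 *
        losses m K ξ j (K + 1) a ^ 2) := by
    intro ξ
    have h2 : ∀ c ∈ Finset.range (K + 1), q c * ∑ a ∈ Finset.range (K + 1),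
        prob m K X ξ j c a * lossEst m K X ξ j c a ^ 2 ≤ q c * (2 * (K + 1) ^ 2) +
        ∑ a ∈ Finset.range (K + 1), q c * prob m K X ξ j c a * (2 *
          (losses m K ξ j (K + 1) a / freqEst m K X ξ j a) ^ 2) := by
      intro c hc
      have h3 : q c * (2 * (K + 1) ^ 2) = ∑ a ∈ Finset.range (K + 1),
          q c * prob m K X ξ j c a * (2 * (K + 1) ^ 2) := by
        rw [← Finset.sum_mul, ← Finset.mul_sum, prob_sum, mul_one]
      rw [h3, ← Finset.sum_add_distrib, Finset.mul_sum]
      refine Finset.sum_le_sum fun a ha => ?_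
      rw [← mul_assoc, ← mul_add]
      refine mul_le_mul_of_nonneg_left ?_ (mul_nonneg (hq c) (prob_pos ..).le)
      have hd := sub_div_mem (a := a) (Finset.mem_range.1 hc)
      have ha' : (a : ℝ) / K ≤ 1 := div_le_one_of_le₀
        (by exact_mod_cast Nat.lt_succ_iff.1 (Finset.mem_range.1 ha)) (by positivity)
      set S := losses m K ξ j (K + 1) a / freqEst m K X ξ j a with hS
      have hS0 : 0 ≤ S := div_nonneg (losses_nonneg ..) (freqEst_pos hX0 ..).le
      -- The known part is at most $K+1$; squaring the sum costs a factor 2 on each part.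
      have h4 : lossEst m K X ξ j c a ≤ (K + 1) + S := by
        have : lossEst m K X ξ j c a =
            (K + 1) * ((a : ℝ) / K) + ((c - a : ℕ) : ℝ) / K * S := by
          rw [lossEst, ← hS]; push_cast; ring
        rw [this]
        nlinarith
      have h5 := lossEst_nonneg (m := m) (K := K) hX0 ξ j c a
      nlinarith [sq_nonneg ((K : ℝ) + 1 - S)]
    refine (Finset.sum_le_sum h2).trans (le_of_eq ?_)
    rw [Finset.sum_add_distrib, ← Finset.sum_mul, hq1, one_mul, Finset.sum_comm]
    congr 1
    refine Finset.sum_congr rfl fun a _ => ?_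
    rw [← Finset.sum_mul, ← freq]
    ring
  refine (hE.mono _ _ h1).trans ?_
  rw [hE.add, hE.const, hE.sum]
  have h6 : ∀ a ∈ Finset.range (K + 1),
      E (fun ξ => 2 * (freq m K X q ξ j a / freqEst m K X ξ j a ^ 2 *
        losses m K ξ j (K + 1) a ^ 2)) ≤
      E fun ξ => 2 * ((1 + 3 * T ^ 2 * shortfall K X q ξ j) *
        ((K + 1) + (K + 1) ^ 2 * freq m K X q ξ j a)) := by
    intro a ha
    rw [hE.smul, hE.smul]
    refine mul_le_mul_of_nonneg_left ?_ (by norm_num)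
    refine (hE.mean_losses_sq_le hq (G := fun ξ => freq m K X q ξ j a / freqEst m K X ξ j a ^ 2)
      ((adapted_freq j).comp₂ (adapted_freqEst j) fun f g => f a / g a ^ 2)
      (fun ξ => div_nonneg (freq_nonneg hq j a) (sq_nonneg _)) (Finset.mem_range.1 ha) le_rfl
      ht).trans (hE.mono _ _ fun ξ => ?_)
    have hf0 := freq_nonneg (m := m) (K := K) (X := X) (ξ := ξ) hq j a
    have hpos := freqEst_pos (m := m) (K := K) (ξ := ξ) hX0 j a
    have hr := freq_div_le (m := m) (K := K) (q := q) hX0 ξ j a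
    have hr0 := freq_div_nonneg (m := m) (K := K) hX0 hq ξ j a
    -- One factor `freq` comes from averaging the policy over values, another from the second moment
    -- of the losses; together they offset the squared `freqEst`.
    have h7 : freq m K X q ξ j a / freqEst m K X ξ j a ^ 2 *
        ((K + 1 : ℕ) * freq m K X q ξ j a + (K + 1 : ℕ) ^ 2 * freq m K X q ξ j a ^ 2) =
        (freq m K X q ξ j a / freqEst m K X ξ j a) ^ 2 *
          ((K + 1) + (K + 1) ^ 2 * freq m K X q ξ j a) := by
      push_cast
      field_simp
    rw [h7]
    refine mul_le_mul_of_nonneg_right ?_ (by positivity)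
    have hD0 := shortfall_nonneg (K := K) (X := X) (q := q) ξ j
    have hD1 := shortfall_le_one hX0 hq hq1 ξ j
    have hn : (((j * (K + 1) : ℕ) : ℝ) + 1) / X ≤ T := by
      rw [div_le_iff₀ hX0]
      have : (((j * (K + 1) : ℕ) : ℝ) + 1) ≤ T := by norm_cast; omega
      have hT0 : (0 : ℝ) ≤ T := Nat.cast_nonneg _
      nlinarith
    have hT1 : (1 : ℝ) ≤ T := by exact_mod_cast hT
    set D := shortfall K X q ξ j
    -- Since $0\le D\le 1\le T$, the square $(1+DT)^2$ is at most $1+3DT^2$.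
    have h8 : freq m K X q ξ j a / freqEst m K X ξ j a ≤ 1 + D * T :=
      hr.trans (by nlinarith)
    have h9 : (freq m K X q ξ j a / freqEst m K X ξ j a) ^ 2 ≤ (1 + D * T) ^ 2 :=
      pow_le_pow_left₀ hr0 h8 2
    have h10 : D * T ≤ D * T ^ 2 := mul_le_mul_of_nonneg_left (by nlinarith) hD0
    have h11 : D ^ 2 * T ^ 2 ≤ D * T ^ 2 :=
      mul_le_mul_of_nonneg_right (by nlinarith) (by positivity)
    nlinarith
  refine (add_le_add_right (Finset.sum_le_sum h6) _).trans (le_of_eq ?_)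
  rw [← hE.sum]
  -- The frequencies sum to 1 and there are $K+1$ bids, so both terms contribute $(K+1)^2$; this
  -- balance fixes the block length.
  have h12 : (fun ξ => ∑ a ∈ Finset.range (K + 1), 2 * ((1 + 3 * T ^ 2 * shortfall K X q ξ j) *
        ((K + 1) + (K + 1) ^ 2 * freq m K X q ξ j a))) = fun ξ =>
      4 * ((K : ℝ) + 1) ^ 2 + 12 * T ^ 2 * (K + 1) ^ 2 * shortfall K X q ξ j := by
    funext ξ
    rw [← Finset.mul_sum, ← Finset.mul_sum, Finset.sum_add_distrib, ← Finset.mul_sum,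
      freq_sum hq1, Finset.sum_const, Finset.card_range, nsmul_eq_mul]
    push_cast
    ring
  rw [h12, hE.add, hE.const, hE.smul]
  ring

omit hE in
lemma sum_range_block (J : ℕ) (g : ℕ → ℝ) : ∑ t ∈ Finset.range (J * (K + 1)), g t =
    ∑ j ∈ Finset.range J, ∑ s ∈ Finset.range (K + 1), g (j * (K + 1) + s) := by
  induction J with
  | zero => simp
  | succ J ih => rw [Nat.succ_mul, Finset.sum_range_add, ih, Finset.sum_range_succ (n := J)]

end IsPlay

end FirstPrice

/-! ### The regret bound on the grid -/

namespace FirstPrice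

variable {m : ℕ → unitInterval} {K : ℕ} {X : ℝ} {q : ℕ → ℝ} {T : ℕ}

namespace IsPlay

variable {E : ((ℕ → ℕ × ℕ) → ℝ) → ℝ} (hE : IsPlay m K X q T E)
include hE

/-- The terms $1/K$ add up to at most $T/K\le K^2$. The terms $X/n$ at block starts form a harmonic
sum, and with $X$ of order $K(1+\log T)$ this produces $K^2(1+\log T)^2$. -/
lemma sum_mean_bias_le (hT : 1 ≤ T) (hK : 1 ≤ K) (hKT : K ≤ T) (hTK : T ≤ K ^ 3)
    (hX : X = 8 * K * (1 + Real.log T)) (hq : ∀ c, 0 ≤ q c)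
    (hq1 : ∑ c ∈ Finset.range (K + 1), q c = 1) {J : ℕ} (hJ : J * (K + 1) ≤ T) :
    ∑ j ∈ Finset.range J, (K + 1) * E (fun ξ => bias m K X q ξ j) ≤
      23 * K ^ 2 * (1 + Real.log T) ^ 2 := by
  have hK' : (1 : ℝ) ≤ K := by exact_mod_cast hK
  have hT' : (1 : ℝ) ≤ T := by exact_mod_cast hT
  have hTK' : (T : ℝ) ≤ K ^ 3 := by exact_mod_cast hTK
  have hJ' : (J : ℝ) * (K + 1) ≤ T := by exact_mod_cast hJ
  have hlog : 0 ≤ Real.log T := Real.log_nonneg hT'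
  set L := 1 + Real.log T with hL
  have hL1 : 1 ≤ L := by linarith
  have hX0 : 0 < X := by rw [hX]; positivity
  rcases J with _ | J
  · simp only [Finset.range_zero, Finset.sum_empty]; positivity
  rw [Finset.sum_range_succ']
  -- At $n=0$ the general bound would be of order $K^3$, so block 0 is bounded trivially.
  have h0 : (K + 1) * E (fun ξ => bias m K X q ξ 0) ≤ 2 * K := by
    have := (hE.mono _ _ (bias_le_one (m := m) hX0 hq hq1 · 0)).trans hE.one.le
    nlinarith
  have h1 : ∀ j ∈ Finset.range J, (K + 1) * E (fun ξ => bias m K X q ξ (j + 1)) ≤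
      (K + 1) * (1 / K + 4 / T ^ 2) + (K + 1) * X * ((j + 1 : ℕ) : ℝ)⁻¹ := by
    intro j hj
    have hj' : (j + 1) * (K + 1) ≤ T :=
      (Nat.mul_le_mul_right _ (by have := Finset.mem_range.1 hj; omega)).trans hJ
    have h2 := hE.mean_bias_le (j := j + 1) hX0 hq hq1 hj'
    have h3 := hE.mean_shortfall_le hT hK hKT hX hq hq1 hj'
    have h4 : (K + 1) * X / (((j + 1) * (K + 1) : ℕ) + 1) ≤ X * ((j + 1 : ℕ) : ℝ)⁻¹ := by
      rw [← div_eq_mul_inv, div_le_div_iff₀ (by positivity) (by positivity)]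
      push_cast
      nlinarith
    rw [mul_assoc, ← mul_add]
    exact mul_le_mul_of_nonneg_left (by linarith) (by positivity)
  refine (add_le_add (Finset.sum_le_sum h1) h0).trans ?_
  rw [Finset.sum_add_distrib, Finset.sum_const, Finset.card_range, nsmul_eq_mul, ← Finset.mul_sum]
  have h5 : ∑ j ∈ Finset.range J, ((j + 1 : ℕ) : ℝ)⁻¹ ≤ L := by
    have h6 := harmonic_le_one_add_log J
    rw [harmonic] at h6
    push_cast at h6 ⊢
    refine h6.trans ?_
    rcases Nat.eq_zero_or_pos J with rfl | hJ0
    · simpa using hL1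
    · have : (J : ℝ) ≤ T := by
        exact_mod_cast (by nlinarith : J ≤ T)
      have := Real.log_le_log (by exact_mod_cast hJ0) this
      linarith
  have h7 : (J : ℝ) * ((K + 1) * (1 / K + 4 / T ^ 2)) ≤ K ^ 2 + 4 := by
    have h8 : (J : ℝ) * (K + 1) ≤ T := by push_cast at hJ'; nlinarith
    have h9 : (T : ℝ) * (1 / K) ≤ K ^ 2 := by
      rw [mul_one_div, div_le_iff₀ (by positivity)]
      exact hTK'.trans (le_of_eq (by ring))
    have h10 : (T : ℝ) * (4 / T ^ 2) ≤ 4 := by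
      rw [mul_div_assoc', div_le_iff₀ (by positivity)]
      nlinarith
    rw [← mul_assoc]
    refine (mul_le_mul_of_nonneg_right h8 (by positivity)).trans ?_
    linarith
  have h11 : (K + 1) * X * ∑ j ∈ Finset.range J, ((j + 1 : ℕ) : ℝ)⁻¹ ≤ 16 * K ^ 2 * L ^ 2 := by
    refine (mul_le_mul_of_nonneg_left h5 (by positivity)).trans ?_
    rw [hX]
    have : ((K : ℝ) + 1) * (8 * K) ≤ 16 * K ^ 2 := by nlinarith
    have := mul_le_mul_of_nonneg_right this (show 0 ≤ L ^ 2 by positivity)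
    nlinarith
  have h12 : (1 : ℝ) ≤ K ^ 2 := by nlinarith
  have h13 : (K : ℝ) ^ 2 ≤ K ^ 2 * L ^ 2 := le_mul_of_one_le_right (by positivity) (by nlinarith)
  nlinarith

/-- The expected regret in terms of rounded values and bids. -/
theorem regret_le (hT : 1 ≤ T) (hK : 1 ≤ K) (hKT : K ≤ T) (hTK : T ≤ K ^ 3)
    (hX : X = 8 * K * (1 + Real.log T)) (hq : ∀ c, 0 ≤ q c)
    (hq1 : ∑ c ∈ Finset.range (K + 1), q c = 1) (b : ℕ → ℕ) (hb : ∀ c, b c < K + 1) :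
    ∑ t ∈ Finset.range T, E (fun ξ => loss m K t (ξ t).1 (ξ t).2) ≤
      ∑ t ∈ Finset.range T, ∑ c ∈ Finset.range (K + 1), q c * loss m K t c (b c) +
        100 * K ^ 2 * (1 + Real.log T) ^ 2 := by
  have hK' : (1 : ℝ) ≤ K := by exact_mod_cast hK
  have hT' : (1 : ℝ) ≤ T := by exact_mod_cast hT
  have hKT' : (K : ℝ) ≤ T := by exact_mod_cast hKT
  have hTK' : (T : ℝ) ≤ K ^ 3 := by exact_mod_cast hTK
  have hlog : 0 ≤ Real.log T := Real.log_nonneg hT'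
  set L := 1 + Real.log T with hL
  have hL1 : 1 ≤ L := by linarith
  have hX1 : 1 ≤ X := by rw [hX]; nlinarith
  have hX0 : 0 < X := by linarith
  set J := T / (K + 1) with hJ
  have hJT : J * (K + 1) ≤ T := Nat.div_mul_le_self _ _
  have hJT' : (J : ℝ) * (K + 1) ≤ T := by exact_mod_cast hJT
  have hjT : ∀ j ∈ Finset.range J, j * (K + 1) + (K + 1) ≤ T := fun j hj => by
    rw [← Nat.succ_mul]
    exact (Nat.mul_le_mul_right _ (Finset.mem_range.1 hj)).trans hJT
  have hD : ∀ j ∈ Finset.range J, E (fun ξ => shortfall K X q ξ j) ≤ 4 / T ^ 2 := fun j hj =>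
    hE.mean_shortfall_le hT hK hKT hX hq hq1 (by have := hjT j hj; omega)
  -- split into blocks
  have hsplit : ∀ g : ℕ → ℝ, ∑ t ∈ Finset.range T, g t =
      ∑ j ∈ Finset.range J, ∑ s ∈ Finset.range (K + 1), g (j * (K + 1) + s) +
        ∑ s ∈ Finset.range (T % (K + 1)), g (J * (K + 1) + s) := by
    intro g
    rw [← sum_range_block, ← Finset.sum_range_add, hJ, Nat.div_add_mod']
  -- The incomplete last block costs at most 1 per auction.
  have hrest : ∑ s ∈ Finset.range (T % (K + 1)),
      E (fun ξ => loss m K (J * (K + 1) + s) (ξ (J * (K + 1) + s)).1 (ξ (J * (K + 1) + s)).2) ≤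
      K + 1 := by
    refine (Finset.sum_le_sum (g := fun _ => 1) fun s hs =>
      hE.mean_loss_le_one hq hq1 ?_).trans ?_
    · have h1 := Finset.mem_range.1 hs
      have h2 := Nat.div_add_mod' T (K + 1)
      rw [← hJ] at h2
      omega
    · simp only [Finset.sum_const, Finset.card_range, nsmul_eq_mul, mul_one]
      exact_mod_cast (Nat.mod_lt T (Nat.succ_pos K)).le
  have hrest' : 0 ≤ ∑ s ∈ Finset.range (T % (K + 1)), ∑ c ∈ Finset.range (K + 1),
      q c * loss m K (J * (K + 1) + s) c (b c) :=
    Finset.sum_nonneg fun s _ => Finset.sum_nonneg fun c _ => mul_nonneg (hq c) (loss_nonneg ..)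
  -- exponential weights
  have hEW : ∑ j ∈ Finset.range J, E (fun ξ => ∑ c ∈ Finset.range (K + 1), q c *
        ∑ a ∈ Finset.range (K + 1), prob m K X ξ j c a * lossEst m K X ξ j c a) ≤
      ∑ j ∈ Finset.range J, ∑ c ∈ Finset.range (K + 1),
        q c * E (fun ξ => lossEst m K X ξ j c (b c)) + Real.log (K + 1) * K ^ 2 +
      1 / (2 * K ^ 2) * ∑ j ∈ Finset.range J, E (fun ξ => ∑ c ∈ Finset.range (K + 1), q c *
        ∑ a ∈ Finset.range (K + 1), prob m K X ξ j c a * lossEst m K X ξ j c a ^ 2) := by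
    simp only [← hE.smul, ← hE.sum]
    rw [← hE.const (Real.log (K + 1) * K ^ 2), ← hE.add, ← hE.add]
    refine hE.mono _ _ fun ξ => ?_
    have h1 := Finset.sum_le_sum fun c (_ : c ∈ Finset.range (K + 1)) =>
      mul_le_mul_of_nonneg_left (sum_lossEst_le (m := m) hX0 hK ξ J c (hb c)) (hq c)
    simp only [mul_add] at h1
    rw [Finset.sum_add_distrib, Finset.sum_add_distrib, ← Finset.sum_mul, hq1, one_mul] at h1
    simp only [Finset.mul_sum] at h1 ⊢
    rw [Finset.sum_comm] at h1
    refine h1.trans (le_of_eq ?_)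
    congr 1
    · congr 1
      rw [Finset.sum_comm]
    · rw [Finset.sum_comm]
      refine Finset.sum_congr rfl fun j _ => Finset.sum_congr rfl fun c _ =>
        Finset.sum_congr rfl fun a _ => ?_
      ring
  have hA := Finset.sum_le_sum fun j hj => hE.mean_block_loss_le hq (hjT j hj)
  rw [Finset.sum_add_distrib] at hA
  have hbias := hE.sum_mean_bias_le hT hK hKT hTK hX hq hq1 hJT
  -- The shortfall $4/T^2$ times a ratio of at most $T$ gives $4/T$ per auction, 4 in total.
  have hB : ∑ j ∈ Finset.range J, ∑ c ∈ Finset.range (K + 1),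
      q c * E (fun ξ => lossEst m K X ξ j c (b c)) ≤
      ∑ j ∈ Finset.range J, ∑ s ∈ Finset.range (K + 1), ∑ c ∈ Finset.range (K + 1),
        q c * loss m K (j * (K + 1) + s) c (b c) + 4 := by
    have h1 : ∀ j ∈ Finset.range J, ∑ c ∈ Finset.range (K + 1),
        q c * E (fun ξ => lossEst m K X ξ j c (b c)) ≤
        ∑ s ∈ Finset.range (K + 1), ∑ c ∈ Finset.range (K + 1),
          q c * loss m K (j * (K + 1) + s) c (b c) + (K + 1) * (4 / T) := by
      intro j hj
      have h2 : (K + 1) * ((((j * (K + 1) : ℕ) : ℝ) + 1) / X) *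
          E (fun ξ => shortfall K X q ξ j) ≤ (K + 1) * (4 / T) := by
        have h3 : (((j * (K + 1) : ℕ) : ℝ) + 1) / X ≤ T := by
          rw [div_le_iff₀ hX0]
          have h4 : (((j * (K + 1) : ℕ) : ℝ) + 1) ≤ T := by
            have := hjT j hj
            norm_cast
            omega
          nlinarith
        have h5 := mul_le_mul h3 (hD j hj) (hE.nonneg fun ξ => shortfall_nonneg ξ j) (by positivity)
        rw [mul_assoc]
        refine mul_le_mul_of_nonneg_left (h5.trans (le_of_eq ?_)) (by positivity)
        field_simp
      have h6 := Finset.sum_le_sum fun c (hc : c ∈ Finset.range (K + 1)) =>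
        mul_le_mul_of_nonneg_left ((hE.mean_lossEst_le hX0 (hjT j hj) (Finset.mem_range.1 hc)
          (hb c)).trans (add_le_add_right h2 _)) (hq c)
      refine h6.trans (le_of_eq ?_)
      rw [Finset.sum_congr rfl fun c _ => mul_add (q c) _ _, Finset.sum_add_distrib,
        ← Finset.sum_mul, hq1, one_mul, Finset.sum_congr rfl fun c _ => Finset.mul_sum _ _ (q c),
        Finset.sum_comm]
    refine (Finset.sum_le_sum h1).trans ?_
    rw [Finset.sum_add_distrib]
    gcongr
    rw [Finset.sum_const, Finset.card_range, nsmul_eq_mul, ← mul_assoc]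
    refine (mul_le_mul_of_nonneg_right hJT' (by positivity)).trans (le_of_eq ?_)
    field_simp
  -- A block contributes $(K+1)^2(6+48)$. As $J(K+1)\le K^3$, the total is at most $27K(K+1)\le
  -- 54K^2$.
  have hV : 1 / (2 * (K : ℝ) ^ 2) * ∑ j ∈ Finset.range J,
      E (fun ξ => ∑ c ∈ Finset.range (K + 1), q c *
        ∑ a ∈ Finset.range (K + 1), prob m K X ξ j c a * lossEst m K X ξ j c a ^ 2) ≤
      54 * K ^ 2 := by
    have h1 : ∀ j ∈ Finset.range J, E (fun ξ => ∑ c ∈ Finset.range (K + 1), q c *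
        ∑ a ∈ Finset.range (K + 1), prob m K X ξ j c a * lossEst m K X ξ j c a ^ 2) ≤
        (K + 1) * (54 * (K + 1)) := by
      intro j hj
      refine (hE.mean_lossEst_sq_le hT hX1 hq hq1 (hjT j hj)).trans ?_
      have h2 : 12 * (T : ℝ) ^ 2 * E (fun ξ => shortfall K X q ξ j) ≤ 48 := by
        refine (mul_le_mul_of_nonneg_left (hD j hj) (by positivity)).trans (le_of_eq ?_)
        field_simp
        norm_num
      nlinarith [sq_nonneg ((K : ℝ) + 1)]
    have h3 : ∑ j ∈ Finset.range J, E (fun ξ => ∑ c ∈ Finset.range (K + 1), q c *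
        ∑ a ∈ Finset.range (K + 1), prob m K X ξ j c a * lossEst m K X ξ j c a ^ 2) ≤
        54 * (K + 1) * K ^ 3 := by
      refine (Finset.sum_le_sum h1).trans ?_
      rw [Finset.sum_const, Finset.card_range, nsmul_eq_mul, ← mul_assoc]
      have := hJT'.trans hTK'
      nlinarith
    rw [one_div_mul_eq_div, div_le_iff₀ (by positivity)]
    refine h3.trans ?_
    have : ((K : ℝ) + 1) ≤ 2 * K := by linarith
    have := mul_le_mul_of_nonneg_right this (show (0 : ℝ) ≤ 54 * K ^ 3 by positivity)
    nlinarith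
  have hlogN : Real.log (K + 1) ≤ L := by
    have h1 : Real.log (K + 1) ≤ Real.log (2 * T) :=
      Real.log_le_log (by positivity) (by linarith)
    rw [Real.log_mul (by norm_num) (by positivity)] at h1
    have := Real.log_two_lt_d9
    linarith
  rw [hsplit, hsplit (fun t => ∑ c ∈ Finset.range (K + 1), q c * loss m K t c (b c))]
  have h12 : (1 : ℝ) ≤ K ^ 2 := by nlinarith
  have h13 : (K : ℝ) ^ 2 * L ≤ K ^ 2 * L ^ 2 :=
    mul_le_mul_of_nonneg_left (by nlinarith) (by positivity)
  have h14 : (K : ℝ) ^ 2 ≤ K ^ 2 * L := le_mul_of_one_le_right (by positivity) hL1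
  have h15 := mul_le_mul_of_nonneg_right hlogN (show (0 : ℝ) ≤ K ^ 2 by positivity)
  -- In units of $K^2(1+\log T)^2$: at most 2 for the last block, 23 for the bias, 4 for the
  -- comparator, 1 for the logarithm and 54 for the variance.
  nlinarith

end IsPlay

end FirstPrice

/-! ### Rounding, sampling and the law of the play -/

namespace FirstPrice

open Classical in
/-- The number of `i < k` with `θ i ≤ x`. -/
noncomputable def rank (k : ℕ) (θ : ℕ → ℝ) (x : ℝ) : ℕ :=
  ∑ i ∈ Finset.range k, if θ i ≤ x then 1 else 0

/-- The value `v`, rounded down to a multiple of `1 / K`. -/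
noncomputable def roundVal (K : ℕ) (v : ℝ) : ℕ := rank K (fun i => (i : ℝ) + 1) (v * K)

/-- The bid at the rounded value `c` if `u` is drawn. -/
noncomputable def sample (K n : ℕ) (Y : ℕ → ℝ) (c : ℕ) (u : ℝ) : ℕ :=
  rank K (fun i => ∑ i' ∈ Finset.range (i + 1), weight K n Y c i')
    (u * ∑ i ∈ Finset.range (K + 1), weight K n Y c i)

/-- Rounded value and bid in auction `t`, if `ξ` describes the previous auctions. -/
noncomputable def nextPlay (m : ℕ → unitInterval) (K : ℕ) (X : ℝ) (t : ℕ) (ξ : ℕ → ℕ × ℕ)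
    (z : unitInterval × (ℕ → unitInterval)) : ℕ × ℕ :=
  (roundVal K z.1, sample K (t / (K + 1) * (K + 1)) (estimate m K X ξ (t / (K + 1)))
    (roundVal K z.1) (z.2 0))

/-- Rounded values and bids in the first `t` auctions. -/
noncomputable def play (m : ℕ → unitInterval) (K : ℕ) (X : ℝ) (ω : Outcome) :
    ℕ → ℕ → ℕ × ℕ
  | 0 => fun _ => (0, 0)
  | t + 1 => Function.update (play m K X ω t) t (nextPlay m K X t (play m K X ω t) (ω t))

/-- The law of the rounded values. -/
noncomputable def valueLaw (ν : Measure unitInterval) (K c : ℕ) : ℝ :=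
  ν.real {v | roundVal K v = c}

variable {m : ℕ → unitInterval} {K : ℕ} {X : ℝ}

lemma rank_le (k : ℕ) (θ : ℕ → ℝ) (x : ℝ) : rank k θ x ≤ k := by
  refine (Finset.sum_le_card_nsmul _ _ 1 fun i _ => ?_).trans (by simp)
  split_ifs <;> norm_num

/-- For monotone thresholds, those that are met form an initial segment, so counting them locates
`x`. -/
lemma rank_spec {θ : ℕ → ℝ} (hθ : Monotone θ) (k : ℕ) (x : ℝ) :
    (∀ i < rank k θ x, θ i ≤ x) ∧ ∀ i, rank k θ x ≤ i → i < k → x < θ i := by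
  induction k with
  | zero => simp [rank]
  | succ k ih =>
    by_cases h : θ k ≤ x
    · have h1 : rank (k + 1) θ x = k + 1 := by
        have : ∀ i ∈ Finset.range (k + 1), (if θ i ≤ x then 1 else 0) = 1 := fun i hi =>
          if_pos ((hθ (Nat.lt_succ_iff.1 (Finset.mem_range.1 hi))).trans h)
        rw [rank]
        convert Finset.sum_const (s := Finset.range (k + 1)) 1 with i hi
        · exact if_pos ((hθ (Nat.lt_succ_iff.1 (Finset.mem_range.1 hi))).trans h)
        · simp
      rw [h1]
      exact ⟨fun i hi => (hθ (Nat.lt_succ_iff.1 hi)).trans h, fun i h2 h3 => by omega⟩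
    · have h1 : rank (k + 1) θ x = rank k θ x := by
        rw [rank, Finset.sum_range_succ, if_neg h, add_zero, rank]
      rw [h1]
      refine ⟨ih.1, fun i h2 h3 => ?_⟩
      rcases (Nat.lt_succ_iff.1 h3).lt_or_eq with h4 | rfl
      · exact ih.2 i h2 h4
      · exact not_le.1 h

lemma measurable_rank (k : ℕ) (θ : ℕ → ℝ) : Measurable (rank k θ) := by
  classical
  refine Finset.measurable_sum _ fun i _ => ?_
  exact Measurable.ite measurableSet_Ici measurable_const measurable_const

lemma measurable_roundVal (K : ℕ) : Measurable (roundVal K) :=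
  (measurable_rank _ _).comp (measurable_id.mul_const _)

lemma measurable_sample (K n : ℕ) (Y : ℕ → ℝ) (c : ℕ) : Measurable (sample K n Y c) :=
  (measurable_rank _ _).comp (measurable_id.mul_const _)

lemma roundVal_le_mul (hK : 1 ≤ K) {v : ℝ} (hv : 0 ≤ v) : (roundVal K v : ℝ) ≤ v * K := by
  have h := (rank_spec (θ := fun i => (i : ℝ) + 1) (fun i j h => by simpa using h) K (v * K)).1
  rcases Nat.eq_zero_or_pos (roundVal K v) with h0 | h0
  · rw [h0]; push_cast; positivity
  · have h1 := h (roundVal K v - 1) (by unfold roundVal at h0 ⊢; omega)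
    rw [Nat.cast_sub h0] at h1
    simpa using h1

lemma mul_le_roundVal {v : ℝ} (hv : v ≤ 1) : v * K ≤ roundVal K v + 1 := by
  have h := (rank_spec (θ := fun i => (i : ℝ) + 1) (fun i j h => by simpa using h) K (v * K)).2
  rcases (rank_le K (fun i => (i : ℝ) + 1) (v * K)).lt_or_eq with h0 | h0
  · exact (h _ le_rfl h0).le
  · have : (roundVal K v : ℝ) = K := by rw [roundVal, h0]
    rw [this]
    have : (0 : ℝ) ≤ K := Nat.cast_nonneg K
    nlinarith

/-- The threshold with index `k` is never tested, so the last outcome takes all that remains and has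
no upper condition. -/
lemma rank_cumsum_eq_iff {w : ℕ → ℝ} (hw : ∀ i, 0 < w i) {k a : ℕ} (ha : a ≤ k) {x : ℝ}
    (hx : 0 ≤ x) : rank k (fun i => ∑ i' ∈ Finset.range (i + 1), w i') x = a ↔
      ∑ i ∈ Finset.range a, w i ≤ x ∧ (a = k ∨ x < ∑ i ∈ Finset.range (a + 1), w i) := by
  have hmono : Monotone fun i => ∑ i' ∈ Finset.range (i + 1), w i' := fun i j hij =>
    Finset.sum_le_sum_of_subset_of_nonneg (Finset.range_mono (by omega)) fun _ _ _ => (hw _).le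
  have h := rank_spec hmono k x
  have hle := rank_le k (fun i => ∑ i' ∈ Finset.range (i + 1), w i') x
  constructor
  · rintro rfl
    refine ⟨?_, ?_⟩
    · rcases Nat.eq_zero_or_pos
        (rank k (fun i => ∑ i' ∈ Finset.range (i + 1), w i') x) with h0 | h0
      · rw [h0]; simpa using hx
      · have := h.1 _ (Nat.sub_lt h0 one_pos)
        rwa [show ∀ r : ℕ, 0 < r → r - 1 + 1 = r from fun r hr => Nat.sub_add_cancel hr] at this
        exact h0
    · rcases hle.lt_or_eq with h1 | h1
      · exact Or.inr (h.2 _ le_rfl h1)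
      · exact Or.inl h1
  · rintro ⟨h1, h2⟩
    rcases lt_trichotomy (rank k (fun i => ∑ i' ∈ Finset.range (i + 1), w i') x) a with h3 | h3 | h3
    · have h4 := h.2 (a - 1) (by omega) (by omega)
      rw [Nat.sub_add_cancel (by omega)] at h4
      exact absurd h1 (not_le.2 h4)
    · exact h3
    · have h4 := h.1 a h3
      rcases h2 with h2 | h2
      · omega
      · exact absurd h4 (not_le.2 h2)

/-- Inverse transform sampling: after division by the total weight, bid `a` is drawn on an interval
whose length is its probability. -/
lemma volume_sample_eq (K n : ℕ) (Y : ℕ → ℝ) (c : ℕ) {a : ℕ} (ha : a < K + 1) :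
    (volume : Measure unitInterval).real {u | sample K n Y c u = a} = policy K n Y c a := by
  set W := ∑ i ∈ Finset.range (K + 1), weight K n Y c i with hW
  have hWpos : 0 < W := weight_sum_pos ..
  have hle : ∀ i, i ≤ K + 1 → ∑ i' ∈ Finset.range i, weight K n Y c i' ≤ W := fun i hi =>
    Finset.sum_le_sum_of_subset_of_nonneg (Finset.range_mono hi) fun _ _ _ => (weight_pos ..).le
  have h0 : ∀ i, 0 ≤ ∑ i' ∈ Finset.range i, weight K n Y c i' := fun i =>
    Finset.sum_nonneg fun _ _ => (weight_pos ..).le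
  have hx : ∀ i, i ≤ K + 1 → (∑ i' ∈ Finset.range i, weight K n Y c i') / W ∈ unitInterval :=
    fun i hi => ⟨div_nonneg (h0 i) hWpos.le, (div_le_one hWpos).2 (hle i hi)⟩
  have hset : ∀ u : unitInterval, sample K n Y c u = a ↔
      (⟨_, hx a ha.le⟩ : unitInterval) ≤ u ∧
        (a = K ∨ u < (⟨_, hx (a + 1) (by omega)⟩ : unitInterval)) := by
    intro u
    rw [sample, rank_cumsum_eq_iff (fun i => weight_pos K n Y c i) (by omega)
      (mul_nonneg u.2.1 hWpos.le), ← Subtype.coe_le_coe, ← Subtype.coe_lt_coe,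
      div_le_iff₀ hWpos, lt_div_iff₀ hWpos]
  have hp : policy K n Y c a = (∑ i ∈ Finset.range (a + 1), weight K n Y c i) / W -
      (∑ i ∈ Finset.range a, weight K n Y c i) / W := by
    rw [policy, ← hW, Finset.sum_range_succ]
    ring
  have hp0 := (policy_pos K n Y c a).le
  rw [measureReal_def]
  rcases (Nat.lt_succ_iff.1 ha).lt_or_eq with h | h
  · have : {u : unitInterval | sample K n Y c u = a} =
        Set.Ico ⟨_, hx a ha.le⟩ ⟨_, hx (a + 1) (by omega)⟩ := by
      ext u
      rw [Set.mem_ofPred_eq, hset u]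
      simp [h.ne]
    rw [this, unitInterval.volume_Ico, ENNReal.toReal_ofReal]
    · exact hp.symm
    · rw [← hp]; exact hp0
  -- The interval of the last bid includes the right endpoint 1.
  · have : {u : unitInterval | sample K n Y c u = a} = Set.Ici ⟨_, hx a ha.le⟩ := by
      ext u
      rw [Set.mem_ofPred_eq, hset u]
      simp [h]
    have h1 : (∑ i ∈ Finset.range (a + 1), weight K n Y c i) / W = 1 := by
      rw [h]; exact div_self hWpos.ne'
    rw [h1] at hp
    rw [this, unitInterval.volume_Ici, ENNReal.toReal_ofReal]
    · exact hp.symm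
    · rw [← hp]; exact hp0

lemma nextPlay_fst_lt (t : ℕ) (ξ z) : (nextPlay m K X t ξ z).1 < K + 1 :=
  Nat.lt_succ_iff.2 (rank_le ..)

lemma nextPlay_snd_lt (t : ℕ) (ξ z) : (nextPlay m K X t ξ z).2 < K + 1 :=
  Nat.lt_succ_iff.2 (rank_le ..)

lemma measurable_round_sample (K n : ℕ) (Y : ℕ → ℝ) :
    Measurable fun z : unitInterval × (ℕ → unitInterval) =>
      (roundVal K z.1, sample K n Y (roundVal K z.1) (z.2 0)) := by
  have h1 : Measurable fun z : unitInterval × (ℕ → unitInterval) => roundVal K z.1 :=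
    (measurable_roundVal K).comp (measurable_subtype_coe.comp measurable_fst)
  have h3 : Measurable fun z : unitInterval × (ℕ → unitInterval) => ((z.2 0 : unitInterval) : ℝ) :=
    measurable_subtype_coe.comp ((measurable_pi_apply 0).comp measurable_snd)
  have h2 : Measurable fun p : ℕ × ℝ => sample K n Y p.1 p.2 :=
    measurable_from_prod_countable_right fun c => measurable_sample K n Y c
  have h4 := h2.comp (h1.prodMk h3)
  exact h1.prodMk h4

lemma measurable_nextPlay (t : ℕ) (ξ) : Measurable (nextPlay m K X t ξ) := by
  have := measurable_round_sample K (t / (K + 1) * (K + 1)) (estimate m K X ξ (t / (K + 1)))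
  unfold nextPlay
  exact this

/-- A play cut off at `t` takes finitely many values, so every function of it is integrable. This is
why `IsMean` can speak of all functions without measurability conditions. -/
lemma finite_range_play (t : ℕ) : (Set.range fun ω => play m K X ω t).Finite := by
  induction t with
  | zero => exact (Set.finite_singleton _).subset (Set.range_subset_iff.2 fun ω => rfl)
  | succ t ih =>
    refine (Set.Finite.image2 (fun ξ z => Function.update ξ t z) ih
      ((Finset.range (K + 1) ×ˢ Finset.range (K + 1)).finite_toSet)).subset ?_
    refine Set.range_subset_iff.2 fun ω => ?_
    refine ⟨_, ⟨ω, rfl⟩, nextPlay m K X t (play m K X ω t) (ω t), ?_, rfl⟩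
    simp only [Finset.mem_coe, Finset.mem_product, Finset.mem_range]
    exact ⟨nextPlay_fst_lt .., nextPlay_snd_lt ..⟩

/-- The set splits over the finitely many histories; for a fixed history the next move is a
measurable function of one coordinate. -/
lemma measurableSet_play_preimage (t : ℕ) (s : Set (ℕ → ℕ × ℕ)) :
    MeasurableSet {ω | play m K X ω t ∈ s} := by
  induction t generalizing s with
  | zero => exact MeasurableSet.const ((fun _ => (0, 0)) ∈ s)
  | succ t ih =>
    have : {ω | play m K X ω (t + 1) ∈ s} = ⋃ ξ ∈ Set.range fun ω => play m K X ω t,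
        {ω | play m K X ω t ∈ ({ξ} : Set _)} ∩
          (fun ω : Outcome => nextPlay m K X t ξ (ω t)) ⁻¹' {z | Function.update ξ t z ∈ s} := by
      ext ω
      simp only [Set.mem_iUnion, Set.mem_range, Set.mem_inter_iff, Set.mem_ofPred_eq,
        Set.mem_singleton_iff, Set.mem_preimage, exists_prop]
      constructor
      · exact fun h => ⟨_, ⟨ω, rfl⟩, rfl, h⟩
      · rintro ⟨ξ, -, h1, h2⟩
        rw [← h1] at h2
        exact h2
    rw [this]
    refine Set.Finite.measurableSet_biUnion (finite_range_play t) fun ξ _ => (ih _).inter ?_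
    exact ((measurable_nextPlay t ξ).comp (measurable_pi_apply t)) (MeasurableSet.of_discrete)

/-- The first `t` auctions as a simple function of all randomness. -/
noncomputable def simplePlay (m : ℕ → unitInterval) (K : ℕ) (X : ℝ) (t : ℕ) :
    SimpleFunc Outcome (ℕ → ℕ × ℕ) where
  toFun ω := play m K X ω t
  measurableSet_fiber' ξ := measurableSet_play_preimage t {ξ}
  finite_range' := finite_range_play t

variable (ν : Measure unitInterval)

lemma valueLaw_nonneg (c : ℕ) : 0 ≤ valueLaw ν K c := measureReal_nonneg

variable [IsProbabilityMeasure ν]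

instance isProbabilityMeasure_law : IsProbabilityMeasure (law ν) := by
  unfold law; infer_instance

lemma integrable_play (t : ℕ) (g : (ℕ → ℕ × ℕ) → ℝ) :
    Integrable (fun ω => g (play m K X ω t)) (law ν) :=
  SimpleFunc.integrable_of_isFiniteMeasure ((simplePlay m K X t).map g)

lemma play_eq_of_lt {s t : ℕ} (hst : s ≤ t) (ω : Outcome) :
    ∀ i < s, play m K X ω t i = play m K X ω s i := by
  induction t, hst using Nat.le_induction with
  | base => exact fun _ _ => rfl
  | succ t h ih =>
    intro i hi
    rw [play, Function.update_of_ne (by omega), ih i hi]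

lemma play_apply {s t : ℕ} (hst : s < t) (ω : Outcome) :
    play m K X ω t s = nextPlay m K X s (play m K X ω s) (ω s) := by
  rw [play_eq_of_lt (Nat.succ_le_of_lt hst) ω s (Nat.lt_succ_self s), play, Function.update_self]

lemma play_update (t : ℕ) (ω : Outcome) (z) {s : ℕ} (hs : s ≤ t) :
    play m K X (Function.update ω t z) s = play m K X ω s := by
  induction s with
  | zero => rfl
  | succ s ih => rw [play, play, ih (by omega), Function.update_of_ne (by omega)]

/-- The law of what happens in one auction. -/
noncomputable def roundLaw (ν : Measure unitInterval) [IsProbabilityMeasure ν] :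
    Measure (unitInterval × (ℕ → unitInterval)) :=
  ν.prod (Measure.infinitePi fun _ : ℕ => (volume : Measure unitInterval))

instance isProbabilityMeasure_roundLaw : IsProbabilityMeasure (roundLaw ν) := by
  unfold roundLaw; infer_instance

instance sFinite_roundLaw : SFinite (roundLaw ν) := by
  unfold roundLaw; infer_instance

/-- Redrawing one coordinate of a product measure does not change the law. With Fubini this replaces
conditioning on the past in `integral_law_eq`. -/
lemma measurePreserving_update_law (t : ℕ) :
    MeasurePreserving (fun p : Outcome × (unitInterval × (ℕ → unitInterval)) =>
      Function.update p.1 t p.2) ((law ν).prod (roundLaw ν)) (law ν) := by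
  have hmeas : Measurable (fun p : Outcome × (unitInterval × (ℕ → unitInterval)) =>
      Function.update p.1 t p.2) := by
    refine measurable_pi_iff.2 fun i => ?_
    by_cases h : i = t
    · subst h; simpa using measurable_snd
    · simp only [Function.update_of_ne h]
      exact (measurable_pi_apply i).comp measurable_fst
  refine ⟨hmeas, Measure.eq_infinitePi _ fun s B hB => ?_⟩
  rw [Measure.map_apply hmeas (MeasurableSet.pi s.countable_toSet fun i _ => hB i)]
  have h1 : (fun p : Outcome × (unitInterval × (ℕ → unitInterval)) =>
      Function.update p.1 t p.2) ⁻¹' (Set.pi s B) =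
      (Set.pi (s.erase t : Finset ℕ) B) ×ˢ (if t ∈ s then B t else Set.univ) := by
    ext p
    simp only [Set.mem_preimage, Set.mem_pi, Finset.mem_coe, Set.mem_prod, Finset.mem_erase]
    constructor
    · intro h
      refine ⟨fun i hi => ?_, ?_⟩
      · have := h i hi.2
        rwa [Function.update_of_ne hi.1] at this
      · split_ifs with ht
        · have := h t ht
          rwa [Function.update_self] at this
        · trivial
    · rintro ⟨h2, h3⟩ i hi
      by_cases h : i = t
      · subst h
        rw [if_pos hi] at h3
        rwa [Function.update_self]
      · rw [Function.update_of_ne h]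
        exact h2 i ⟨h, hi⟩
  rw [h1, Measure.prod_prod, law, Measure.infinitePi_pi _ fun i _ => hB i]
  change _ * roundLaw ν _ = ∏ i ∈ s, roundLaw ν (B i)
  split_ifs with ht
  · exact Finset.prod_erase_mul s (fun i => roundLaw ν (B i)) ht
  · rw [measure_univ, mul_one, Finset.erase_eq_of_notMem ht]
    rfl

/-- The `t`-th auction is independent of the other ones. -/
lemma integral_law_eq (t : ℕ) (Φ : Outcome → unitInterval × (ℕ → unitInterval) → ℝ)
    (hΦ : ∀ ω z, Φ (Function.update ω t z) = Φ ω)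
    (hint : Integrable (fun ω => Φ ω (ω t)) (law ν)) :
    ∫ ω, Φ ω (ω t) ∂law ν = ∫ ω, ∫ z, Φ ω z ∂roundLaw ν ∂law ν := by
  have hmp := measurePreserving_update_law ν t
  have h1 : Integrable (fun p : Outcome × (unitInterval × (ℕ → unitInterval)) => Φ p.1 p.2)
      ((law ν).prod (roundLaw ν)) := by
    have := hmp.integrable_comp_of_integrable hint
    refine this.congr (Filter.Eventually.of_forall fun p => ?_)
    simp [hΦ]
  have h2 := integral_map (f := fun ω => Φ ω (ω t)) hmp.measurable.aemeasurable
    (by rw [hmp.map_eq]; exact hint.aestronglyMeasurable)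
  rw [hmp.map_eq] at h2
  rw [← integral_prod _ h1, h2]
  simp [hΦ]

lemma roundLaw_nextPlay (t : ℕ) (ξ) {c a : ℕ} (ha : a < K + 1) :
    (roundLaw ν).real {z | nextPlay m K X t ξ z = (c, a)} =
      valueLaw ν K c * policy K (t / (K + 1) * (K + 1)) (estimate m K X ξ (t / (K + 1))) c a := by
  set n := t / (K + 1) * (K + 1)
  set Y := estimate m K X ξ (t / (K + 1))
  have h1 : {z | nextPlay m K X t ξ z = (c, a)} = {v : unitInterval | roundVal K v = c} ×ˢ
      ((Function.eval 0) ⁻¹' {u : unitInterval | sample K n Y c u = a} :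
        Set (ℕ → unitInterval)) := by
    ext z
    simp only [nextPlay, Set.mem_ofPred_eq, Prod.mk.injEq, Set.mem_prod, Set.mem_preimage,
      Function.eval]
    constructor
    · rintro ⟨rfl, h⟩; exact ⟨rfl, h⟩
    · rintro ⟨rfl, h⟩; exact ⟨rfl, h⟩
  have h2 : MeasurableSet {u : unitInterval | sample K n Y c u = a} :=
    ((measurable_sample K n Y c).comp measurable_subtype_coe) (MeasurableSet.singleton a)
  rw [h1, roundLaw, measureReal_prod_prod, valueLaw, ← volume_sample_eq K n Y c ha]
  congr 1
  rw [measureReal_def, (measurePreserving_eval_infinitePi _ 0).measure_preimage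
    h2.nullMeasurableSet, measureReal_def]

lemma integral_nextPlay (t : ℕ) (ξ) (G : ℕ × ℕ → ℝ) :
    ∫ z, G (nextPlay m K X t ξ z) ∂roundLaw ν = ∑ c ∈ Finset.range (K + 1),
      ∑ a ∈ Finset.range (K + 1), valueLaw ν K c *
        policy K (t / (K + 1) * (K + 1)) (estimate m K X ξ (t / (K + 1))) c a * G (c, a) := by
  classical
  have hms : ∀ x, MeasurableSet {z | nextPlay m K X t ξ z = x} := fun x =>
    measurable_nextPlay t ξ (MeasurableSet.singleton x)
  have h1 : ∀ z, G (nextPlay m K X t ξ z) = ∑ c ∈ Finset.range (K + 1),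
      ∑ a ∈ Finset.range (K + 1),
        Set.indicator {z | nextPlay m K X t ξ z = (c, a)} (fun _ => G (c, a)) z := by
    intro z
    rw [Finset.sum_eq_single (nextPlay m K X t ξ z).1, Finset.sum_eq_single
      (nextPlay m K X t ξ z).2]
    · simp
    · intro a _ h
      refine Set.indicator_of_notMem (fun h' => h ?_) _
      rw [Set.mem_ofPred_eq] at h'
      rw [h']
    · exact fun h => absurd (Finset.mem_range.2 (nextPlay_snd_lt ..)) h
    · intro c _ h
      refine Finset.sum_eq_zero fun a _ => Set.indicator_of_notMem (fun h' => h ?_) _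
      rw [Set.mem_ofPred_eq] at h'
      rw [h']
    · exact fun h => absurd (Finset.mem_range.2 (nextPlay_fst_lt ..)) h
  simp only [h1]
  rw [integral_finsetSum _ fun c _ => integrable_finsetSum _ fun a _ =>
    (integrable_const _).indicator (hms _)]
  refine Finset.sum_congr rfl fun c _ => ?_
  rw [integral_finsetSum _ fun a _ => (integrable_const _).indicator (hms _)]
  refine Finset.sum_congr rfl fun a ha => ?_
  rw [integral_indicator_const _ (hms _), roundLaw_nextPlay ν t ξ (Finset.mem_range.1 ha),
    smul_eq_mul]

lemma integral_roundVal (g : ℕ → ℝ) : ∫ v : unitInterval, g (roundVal K v) ∂ν =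
    ∑ c ∈ Finset.range (K + 1), valueLaw ν K c * g c := by
  classical
  have hms : ∀ c, MeasurableSet {v : unitInterval | roundVal K v = c} := fun c =>
    ((measurable_roundVal K).comp measurable_subtype_coe) (MeasurableSet.singleton c)
  have h1 : ∀ v : unitInterval, g (roundVal K v) = ∑ c ∈ Finset.range (K + 1),
      Set.indicator {v : unitInterval | roundVal K v = c} (fun _ => g c) v := by
    intro v
    rw [Finset.sum_eq_single (roundVal K v)]
    · simp
    · exact fun c _ h => Set.indicator_of_notMem (fun h' => h h'.symm) _
    · exact fun h => absurd (Finset.mem_range.2 (Nat.lt_succ_iff.2 (rank_le ..))) h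
  simp only [h1]
  rw [integral_finsetSum _ fun c _ => (integrable_const _).indicator (hms _)]
  refine Finset.sum_congr rfl fun c _ => ?_
  rw [integral_indicator_const _ (hms _), smul_eq_mul, valueLaw]

lemma valueLaw_sum : ∑ c ∈ Finset.range (K + 1), valueLaw ν K c = 1 := by
  have := integral_roundVal (K := K) ν fun _ => 1
  simpa using this.symm

/-- The strategy plays as described by `IsPlay`. -/
theorem isPlay_integral (m : ℕ → unitInterval) (K : ℕ) (X : ℝ) (T : ℕ) :
    IsPlay m K X (valueLaw ν K) T fun g => ∫ ω, g (play m K X ω T) ∂law ν where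
  add f g := integral_add (integrable_play ν T f) (integrable_play ν T g)
  smul r f := integral_const_mul r _
  mono f g h := integral_mono (integrable_play ν T f) (integrable_play ν T g) fun ω => h _
  one := by simp
  cond j s hs ht F hF := by
    set t := j * (K + 1) + s with ht'
    have hdiv : t / (K + 1) = j := by
      rw [ht', Nat.mul_comm, Nat.mul_add_div (Nat.succ_pos K), Nat.div_eq_of_lt hs, add_zero]
    -- `F` sees only the first `t` entries, so the final play can be cut back to the play before
    -- auction `t`, which does not involve coordinate `t`.
    have h1 : ∀ ω, F (play m K X ω T) (play m K X ω T t) =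
        F (play m K X ω t) (nextPlay m K X t (play m K X ω t) (ω t)) := fun ω => by
      rw [play_apply ht, hF _ _ (play_eq_of_lt ht.le ω)]
    have hint : Integrable (fun ω => F (play m K X ω t)
        (nextPlay m K X t (play m K X ω t) (ω t))) (law ν) := by
      have := integrable_play (m := m) (K := K) (X := X) ν T fun ξ => F ξ (ξ t)
      exact this.congr (Filter.Eventually.of_forall h1)
    simp only [h1]
    rw [integral_law_eq ν t (fun ω z => F (play m K X ω t)
      (nextPlay m K X t (play m K X ω t) z)) (fun ω z => by
        funext z'; rw [play_update t ω z le_rfl]) hint]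
    refine integral_congr_ae (Filter.Eventually.of_forall fun ω => ?_)
    dsimp only
    rw [integral_nextPlay ν t (play m K X ω t) (F (play m K X ω t)), hdiv]
    have h2 := hF _ _ (play_eq_of_lt (m := m) (K := K) (X := X) ht.le ω)
    have h3 := ((adapted_prob (m := m) (K := K) (X := X) j).mono (Nat.le_add_right _ s)) _ _
      (play_eq_of_lt (m := m) (K := K) (X := X) ht.le ω)
    simp only at h3
    rw [h2, h3]
    rfl

end FirstPrice

/-! ### Reasoning about programs: frames, resources, loops -/

namespace RealRAM

/-- `c.All φ` says that `φ` holds for all elementary commands and all loops of `c`. -/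
def Program.All (φ : Program → Prop) : Program → Prop
  | .seq c d => c.All φ ∧ d.All φ
  | .ite _ c d => c.All φ ∧ d.All φ
  | .loop n p c => φ (.loop n p c) ∧ c.All φ
  | c => φ c

lemma iterate_invariant {p : Test} {f : Store → Store} {I : Store → Prop}
    (htick : ∀ s k, I s → I (s.tick k)) (hf : ∀ s, I s → I (f s)) (n : ℕ) (s : Store)
    (hs : I s) : I (iterate p f n s) := by
  induction n generalizing s with
  | zero => exact hs
  | succ n ih =>
    rw [iterate]
    split_ifs
    · exact ih _ (hf _ (htick _ _ hs))
    · exact htick _ _ hs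

/-- A property that survives ticks and elementary commands survives programs. -/
lemma exec_invariant {tape : ℕ → unitInterval} {φ : Program → Prop} {I : Store → Prop}
    (htick : ∀ s k, I s → I (s.tick k))
    (hidx : ∀ i e s, φ (.setIdx i e) → I s → I (exec tape (.setIdx i e) s))
    (hreg : ∀ i x s, φ (.setReg i x) → I s → I (exec tape (.setReg i x) s))
    (hcell : ∀ a e x s, φ (.setCell a e x) → I s → I (exec tape (.setCell a e x) s))
    (hrand : ∀ i s, φ (.rand i) → I s → I (exec tape (.rand i) s))
    (c : Program) (hc : c.All φ) (s : Store) (hs : I s) : I (exec tape c s) := by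
  induction c generalizing s with
  | skip => exact htick _ _ hs
  | setIdx i e => exact hidx i e s hc hs
  | setReg i x => exact hreg i x s hc hs
  | setCell a e x => exact hcell a e x s hc hs
  | rand i => exact hrand i s hc hs
  | seq c d ihc ihd => exact ihd hc.2 _ (ihc hc.1 _ hs)
  | ite p c d ihc ihd =>
    rw [exec]
    split_ifs
    · exact ihc hc.1 _ (htick _ _ hs)
    · exact ihd hc.2 _ (htick _ _ hs)
  | loop n p c ih => exact iterate_invariant htick (fun s hs => ih hc.2 s hs) _ _ (htick _ _ hs)

/-- `c` does not write to the natural-number register `r`. -/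
def Program.KeepsIdx (r : ℕ) : Program → Prop :=
  Program.All fun | .setIdx i _ => r ≠ i | _ => True

/-- `c` does not write to the real register `r`. -/
def Program.KeepsReg (r : ℕ) : Program → Prop :=
  Program.All fun | .setReg i _ => r ≠ i | .rand i => r ≠ i | _ => True

/-- `c` does not write to the array `b`. -/
def Program.KeepsArr (b : ℕ) : Program → Prop :=
  Program.All fun | .setCell a _ _ => b ≠ a | _ => True

/-- `c` draws no random numbers. -/
def Program.Deterministic : Program → Prop :=
  Program.All fun | .rand _ => False | _ => True

variable {tape : ℕ → unitInterval} {c : Program} {s : Store}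

lemma Program.KeepsIdx.exec {r : ℕ} (hc : c.KeepsIdx r) : (exec tape c s).idx r = s.idx r := by
  refine exec_invariant (I := fun s' => s'.idx r = s.idx r) (fun _ _ h => h) ?_
    (fun _ _ _ _ h => h) (fun _ _ _ _ _ h => h) (fun _ _ _ h => h) c hc s rfl
  intro i e s' hi h
  rw [← h]
  exact Function.update_of_ne hi _ _

lemma Program.KeepsReg.exec {r : ℕ} (hc : c.KeepsReg r) : (exec tape c s).reg r = s.reg r := by
  refine exec_invariant (I := fun s' => s'.reg r = s.reg r) (fun _ _ h => h)
    (fun _ _ _ _ h => h) ?_ (fun _ _ _ _ _ h => h) ?_ c hc s rfl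
  · intro i x s' hi h
    rw [← h]
    exact Function.update_of_ne hi _ _
  · intro i s' hi h
    rw [← h]
    exact Function.update_of_ne hi _ _

lemma Program.KeepsArr.exec {b : ℕ} (hc : c.KeepsArr b) : (exec tape c s).arr b = s.arr b := by
  refine exec_invariant (I := fun s' => s'.arr b = s.arr b) (fun _ _ h => h)
    (fun _ _ _ _ h => h) (fun _ _ _ _ h => h) ?_ (fun _ _ _ h => h) c hc s rfl
  intro a e x s' hi h
  rw [← h]
  exact Function.update_of_ne hi _ _

lemma Program.Deterministic.exec (hc : c.Deterministic) : (exec tape c s).draws = s.draws :=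
  exec_invariant (I := fun s' => s'.draws = s.draws) (fun _ _ h => h)
    (fun _ _ _ _ h => h) (fun _ _ _ _ h => h) (fun _ _ _ _ _ h => h) (fun _ _ h => h.elim) c hc s
    rfl

/-! ### Running time and memory -/

/-- A bound on the running time if all loops are executed at most `n` times. -/
def Program.cost (n : ℕ) : Program → ℕ
  | .skip => 1
  | .setIdx _ e => e.cost + 1
  | .setReg _ x => x.cost + 1
  | .setCell _ e x => e.cost + x.cost + 1
  | .rand _ => 1
  | .seq c d => c.cost n + d.cost n
  | .ite p c d => p.cost + 1 + c.cost n + d.cost n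
  | .loop e p c => e.cost + 1 + n * (p.cost + 1 + c.cost n)

/-- An address that is never larger than the content of register `2`. -/
def IdxExpr.clamp (e : IdxExpr) : IdxExpr := .sub (.reg 2) (.sub (.reg 2) e)

/-- Programs which do not write to registers `2` and `3`, whose loops are bounded by these
registers, and which write only to array cells with addresses at most register `2`. -/
def Program.Tame : Program → Prop :=
  Program.All fun
    | .setIdx i _ => 2 ≠ i ∧ 3 ≠ i
    | .loop n _ _ => n = .reg 2 ∨ n = .reg 3
    | .setCell _ e _ => ∃ e', e = IdxExpr.clamp e'
    | _ => True

lemma Program.All.mono {φ ψ : Program → Prop} (h : ∀ c, φ c → ψ c) (hc : c.All φ) : c.All ψ := by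
  induction c with
  | seq c d ihc ihd => exact ⟨ihc hc.1, ihd hc.2⟩
  | ite p c d ihc ihd => exact ⟨ihc hc.1, ihd hc.2⟩
  | loop n p c ih => exact ⟨h _ hc.1, ih hc.2⟩
  | _ => exact h _ hc

lemma Program.Tame.keepsIdx_two (hc : c.Tame) : c.KeepsIdx 2 :=
  Program.All.mono (by rintro (_ | _ | _ | _ | _ | _ | _ | _) h <;> first | trivial | exact h.1) hc

lemma Program.Tame.keepsIdx_three (hc : c.Tame) : c.KeepsIdx 3 :=
  Program.All.mono (by rintro (_ | _ | _ | _ | _ | _ | _ | _) h <;> first | trivial | exact h.2) hc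

lemma iterate_time_le {p : Test} {f : Store → Store} {I : Store → Prop} {b : ℕ}
    (htick : ∀ s k, I s → I (s.tick k)) (hf : ∀ s, I s → I (f s) ∧ (f s).time ≤ s.time + b)
    (n : ℕ) (s : Store) (hs : I s) : (iterate p f n s).time ≤ s.time + n * (p.cost + 1 + b) := by
  induction n generalizing s with
  | zero => simp [iterate]
  | succ n ih =>
    rw [iterate]
    split_ifs
    · have h1 := hf _ (htick s (p.cost + 1) hs)
      have h2 := ih _ h1.1
      have h3 : (s.tick (p.cost + 1)).time = s.time + (p.cost + 1) := rfl
      rw [add_mul]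
      omega
    · have h3 : (s.tick (p.cost + 1)).time = s.time + (p.cost + 1) := rfl
      rw [h3, add_mul]
      omega

/-- Loop bounds are registers that the program cannot change, so a bound computed from the syntax
applies to every run. -/
lemma Program.Tame.time_le {n : ℕ} (hc : c.Tame) (h2 : s.idx 2 ≤ n) (h3 : s.idx 3 ≤ n) :
    (exec tape c s).time ≤ s.time + c.cost n := by
  induction c generalizing s with
  | seq c d ihc ihd =>
    have h := ihc hc.1 h2 h3
    have h' := ihd (s := RealRAM.exec tape c s) hc.2
      (by rw [(Program.Tame.keepsIdx_two hc.1).exec]; exact h2)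
      (by rw [(Program.Tame.keepsIdx_three hc.1).exec]; exact h3)
    rw [RealRAM.exec, Program.cost]
    omega
  | ite p c d ihc ihd =>
    rw [RealRAM.exec, Program.cost]
    split_ifs
    · have := ihc (s := s.tick (p.cost + 1)) hc.1 h2 h3
      simp only [Store.tick] at this ⊢
      omega
    · have := ihd (s := s.tick (p.cost + 1)) hc.2 h2 h3
      simp only [Store.tick] at this ⊢
      omega
  | loop e p c ih =>
    have he : e.eval s ≤ n := by rcases hc.1 with rfl | rfl <;> assumption
    have h := iterate_time_le (p := p) (f := RealRAM.exec tape c)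
      (I := fun s => s.idx 2 ≤ n ∧ s.idx 3 ≤ n) (b := c.cost n) (fun _ _ h => h)
      (fun s hs => ⟨by
        rw [(Program.Tame.keepsIdx_two hc.2).exec, (Program.Tame.keepsIdx_three hc.2).exec]
        exact hs, ih hc.2 hs.1 hs.2⟩) (e.eval s) (s.tick (e.cost + 1)) ⟨h2, h3⟩
    rw [RealRAM.exec, Program.cost]
    have h4 := Nat.mul_le_mul_right (p.cost + 1 + c.cost n) he
    simp only [Store.tick] at h ⊢
    omega
  | skip => exact le_rfl
  | rand i => exact le_rfl
  | setIdx i e => exact le_of_eq (by rw [RealRAM.exec, Program.cost]; rfl)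
  | setReg i x => exact le_of_eq (by rw [RealRAM.exec, Program.cost]; rfl)
  | setCell a e x => exact le_of_eq (by rw [RealRAM.exec, Program.cost]; rfl)

lemma Program.Tame.space_le (hc : c.Tame) (hs : s.space ≤ s.idx 2 + 1) :
    (exec tape c s).space ≤ s.idx 2 + 1 := by
  refine (exec_invariant (I := fun s' => s'.idx 2 = s.idx 2 ∧ s'.space ≤ s.idx 2 + 1)
    (fun _ _ h => h) ?_ (fun _ _ _ _ h => h) ?_ (fun _ _ _ h => h) c hc s ⟨rfl, hs⟩).2
  · intro i e s' hi h
    refine ⟨?_, h.2⟩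
    rw [← h.1]
    exact Function.update_of_ne hi.1 _ _
  · rintro a e x s' ⟨e', rfl⟩ h
    refine ⟨h.1, ?_⟩
    -- With truncated subtraction, $x-(x-e)$ is the minimum of $x$ and $e$.
    have h1 : (IdxExpr.clamp e').eval s' ≤ s.idx 2 := by
      rw [← h.1]
      exact Nat.sub_le _ _
    exact max_le h.2 (by omega)

/-! ### Counting loops -/

/-- Run `c` with register `4` counting from `0` up to the content of register `r`. -/
def forLoop (r : ℕ) (c : Program) : Program :=
  .seq (.setIdx 4 (.const 0)) (.loop (.reg r) (.idxLt (.const 0) (.const 1))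
    (.seq c (.setIdx 4 (.add (.reg 4) (.const 1)))))

/-- `s'` differs from `s` at most in register `4` and the bookkeeping. -/
structure Store.Similar (s s' : Store) : Prop where
  idx : ∀ r, r ≠ 4 → s'.idx r = s.idx r
  reg : s'.reg = s.reg
  arr : s'.arr = s.arr

/-- The invariant must be insensitive to register `4` and the bookkeeping, since charging for tests
and advancing the counter alter these; the body must leave the counter alone. -/
lemma exec_forLoop {r : ℕ} (hr : r ≠ 4) (P : ℕ → Store → Prop)
    (hP : ∀ i s s', s.Similar s' → P i s → P i s') (h4 : c.KeepsIdx 4) (h0 : P 0 s)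
    (hstep : ∀ i < s.idx r, ∀ s', s'.idx 4 = i → P i s' → P (i + 1) (exec tape c s')) :
    P (s.idx r) (exec tape (forLoop r c) s) := by
  have key : ∀ n s', s'.idx 4 + n = s.idx r → P (s'.idx 4) s' →
      P (s.idx r) (iterate (.idxLt (.const 0) (.const 1))
        (exec tape (.seq c (.setIdx 4 (.add (.reg 4) (.const 1))))) n s') := by
    intro n
    induction n with
    | zero =>
      intro s' hn h
      rw [add_zero] at hn
      rw [iterate, ← hn]
      exact h
    | succ n ih =>
      intro s' hn h
      rw [iterate, if_pos (show (Test.idxLt (.const 0) (.const 1)).eval s' from one_pos)]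
      set s1 := s'.tick ((Test.idxLt (.const 0) (.const 1)).cost + 1) with hs1
      have h1 : P (s'.idx 4) s1 := hP _ s' s1 ⟨fun _ _ => rfl, rfl, rfl⟩ h
      have h2 := hstep (s'.idx 4) (by omega) s1 rfl h1
      have h3 : (exec tape c s1).idx 4 = s'.idx 4 := h4.exec
      have h5 : (exec tape (.seq c (.setIdx 4 (.add (.reg 4) (.const 1)))) s1).idx 4 =
          s'.idx 4 + 1 := by
        rw [← h3]
        exact Function.update_self 4 ((exec tape c s1).idx 4 + 1) (exec tape c s1).idx
      refine ih _ (by rw [h5]; omega) ?_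
      rw [h5]
      refine hP _ (exec tape c s1) _ ⟨fun i hi => ?_, rfl, rfl⟩ h2
      exact Function.update_of_ne hi ((exec tape c s1).idx 4 + 1) (exec tape c s1).idx
  set s0 := (exec tape (.setIdx 4 (.const 0)) s).tick ((IdxExpr.reg r).cost + 1) with hs0
  have h4' : s0.idx 4 = 0 := Function.update_self 4 0 s.idx
  have hr' : s0.idx r = s.idx r := Function.update_of_ne hr _ _
  have h1 : P (s0.idx 4) s0 := by
    rw [h4']
    refine hP _ s s0 ⟨fun i hi => ?_, rfl, rfl⟩ h0
    exact Function.update_of_ne hi _ _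
  have := key (s0.idx r) s0 (by rw [h4', hr', zero_add]) h1
  exact this

end RealRAM

/-! ### The programs and their effect -/

namespace FirstPrice

open RealRAM

/-- The weight of the bid in register `4` at the value in register `r`. -/
def weightExpr (r : ℕ) : RealExpr :=
  .exp (.sub (.ofIdx (.const 0)) (.div
    (.add (.mul (.ofIdx (.reg 4)) (.ofIdx (.reg 6)))
      (.mul (.ofIdx (.sub (.reg r) (.reg 4))) (.cell 0 (.reg 4))))
    (.mul (.mul (.ofIdx (.reg 2)) (.ofIdx (.reg 2))) (.ofIdx (.reg 2)))))

/-- Put the rounded value into register `7`. -/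
def roundProgram : Program :=
  .seq (.setIdx 7 (.const 0)) (forLoop 2 (.ite
    (.not (.realLt (.mul (.reg 0) (.ofIdx (.reg 2))) (.add (.ofIdx (.reg 4)) (.ofIdx (.const 1)))))
    (.setIdx 7 (.add (.reg 7) (.const 1))) .skip))

/-- Put the sum of the weights at the value in register `r` into real register `3`. -/
def sumProgram (r : ℕ) : Program :=
  .seq (.setReg 3 (.ofIdx (.const 0))) (forLoop 3 (.setReg 3 (.add (.reg 3) (weightExpr r))))

/-- Put the sampled bid into register `8`. -/
def sampleProgram : Program :=
  .seq (.setIdx 8 (.const 0)) (.seq (.setReg 4 (.ofIdx (.const 0))) (forLoop 2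
    (.seq (.setReg 4 (.add (.reg 4) (weightExpr 7)))
      (.ite (.not (.realLt (.mul (.reg 2) (.reg 3)) (.reg 4)))
        (.setIdx 8 (.add (.reg 8) (.const 1))) .skip))))

/-- Natural-number registers `2` and `3` hold $K$ and $K+1$, register `6` the number of auctions
before the block. Real register `2` holds the uniform number and real register `3` the total weight.
-/
def bidProgram : Program :=
  .seq (.rand 2) (.seq roundProgram (.seq (sumProgram 7) (.seq sampleProgram
    (.setReg 1 (.div (.ofIdx (.reg 8)) (.ofIdx (.reg 2)))))))

/-- Add the share of one rounded value to the estimated frequencies of the bids. -/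
def freqProgram : Program :=
  forLoop 3 (.setCell 2 (.clamp (.reg 4)) (.add (.cell 2 (.reg 4)) (.mul
    (.div (.add (.mul (.add (.ofIdx (.const 1)) (.div (.ofIdx (.const 1)) (.ofIdx (.reg 2))))
        (.cell 3 (.reg 5))) (.reg 5))
      (.add (.ofIdx (.reg 6)) (.ofIdx (.const 1))))
    (.div (weightExpr 5) (.reg 3)))))

/-- Update the estimates and reset the block statistics. -/
def blockProgram : Program :=
  forLoop 3 (.seq (.setCell 0 (.clamp (.reg 4))
      (.add (.cell 0 (.reg 4)) (.div (.cell 1 (.reg 4)) (.cell 2 (.reg 4)))))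
    (.seq (.setCell 1 (.clamp (.reg 4)) (.ofIdx (.const 0)))
      (.seq (.setCell 2 (.clamp (.reg 4)) (.ofIdx (.const 0)))
        (.setCell 3 (.clamp (.reg 4)) (.cell 4 (.reg 4))))))

/-- Register `5` plays two roles: it counts the finished auctions of the block, and it is the
rounded value whose term is now added to array `2`. A full block thus covers each value once. Array
`3` keeps the counts of the block start while array `4` goes on counting, so that `mass` stays fixed
within the block. -/
def updateProgram : Program :=
  .seq (sumProgram 5) (.seq freqProgram
    (.seq (.setCell 4 (.clamp (.reg 7)) (.add (.cell 4 (.reg 7)) (.ofIdx (.const 1))))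
      (.seq (.setCell 1 (.clamp (.reg 8)) (.add (.cell 1 (.reg 8))
          (.sub (.ofIdx (.const 1)) (.ofIdx (.reg 1)))))
        (.seq (.setIdx 5 (.add (.reg 5) (.const 1)))
          (.ite (.idxLt (.reg 5) (.reg 3)) .skip
            (.seq blockProgram (.seq (.setIdx 6 (.add (.reg 6) (.reg 3)))
              (.setIdx 5 (.const 0)))))))))

/-- One step in the search for the least number whose cube is at least `T`. -/
def cubeStep : Program :=
  .seq (.setIdx 10 (.add (.add (.reg 10) (.add (.add (.reg 9) (.reg 9)) (.reg 9)))
      (.add (.add (.add (.reg 2) (.reg 2)) (.reg 2)) (.const 1))))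
    (.seq (.setIdx 9 (.add (.reg 9) (.add (.add (.reg 2) (.reg 2)) (.const 1))))
      (.setIdx 2 (.add (.reg 2) (.const 1))))

/-- Counters cannot be multiplied, so registers `9` and `10` carry the square and the cube of the
candidate in register `2`. The bound $T$ on the iterations suffices because $T\le T^3$. -/
def initProgram : Program :=
  .seq (.loop (.reg 0) (.idxLt (.reg 10) (.reg 0)) cubeStep)
    (.seq (.setIdx 3 (.add (.reg 2) (.const 1)))
      (.setReg 5 (.mul (.mul (.ofIdx (.const 8)) (.ofIdx (.reg 2)))
        (.add (.ofIdx (.const 1)) (.log (.ofIdx (.reg 0)))))))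

/-- The bidding algorithm. -/
def bidder : Bidder where
  init := initProgram
  bid := bidProgram
  update := updateProgram

lemma bidProgram_tame : bidProgram.Tame := by
  simp [bidProgram, roundProgram, sumProgram, sampleProgram, forLoop, Program.Tame, Program.All]

lemma updateProgram_tame : updateProgram.Tame := by
  simp [updateProgram, sumProgram, freqProgram, blockProgram, forLoop, Program.Tame, Program.All]

lemma bidProgram_cost (n : ℕ) : bidProgram.cost n ≤ 1000 * (n + 1) := by
  simp [bidProgram, roundProgram, sumProgram, sampleProgram, forLoop, weightExpr, Program.cost,
    RealExpr.cost, IdxExpr.cost, Test.cost]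
  omega

lemma updateProgram_cost (n : ℕ) : updateProgram.cost n ≤ 1000 * (n + 1) := by
  simp [updateProgram, sumProgram, freqProgram, blockProgram, forLoop, weightExpr, Program.cost,
    RealExpr.cost, IdxExpr.cost, Test.cost, IdxExpr.clamp]
  omega

variable {tape : ℕ → unitInterval} {s : Store}

lemma weightExpr_eval (r : ℕ) : (weightExpr r).eval s =
    weight (s.idx 2) (s.idx 6) (s.arr 0) (s.idx r) (s.idx 4) := by
  simp [weightExpr, RealExpr.eval, IdxExpr.eval, weight]

lemma exec_setIdx_self {i : ℕ} {e : IdxExpr} : (exec tape (.setIdx i e) s).idx i = e.eval s := by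
  simp [exec]

lemma exec_setReg_self {i : ℕ} {x : RealExpr} : (exec tape (.setReg i x) s).reg i = x.eval s := by
  simp [exec]

lemma exec_setReg_of_ne {i r : ℕ} {x : RealExpr} (h : r ≠ i) :
    (exec tape (.setReg i x) s).reg r = s.reg r := by
  simp [exec, h]

open Classical in
lemma rank_succ (k : ℕ) (θ : ℕ → ℝ) (x : ℝ) :
    rank (k + 1) θ x = rank k θ x + if θ k ≤ x then 1 else 0 := Finset.sum_range_succ _ _

lemma exec_roundProgram :
    (exec tape roundProgram s).idx 7 = roundVal (s.idx 2) (s.reg 0) := by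
  set s0 := exec tape (.setIdx 7 (.const 0)) s with hs0
  have h2 : s0.idx 2 = s.idx 2 := rfl
  refine (exec_forLoop (s := s0) (r := 2) (by norm_num)
    (fun i s' => s'.idx 7 = rank i (fun i => (i : ℝ) + 1) (s.reg 0 * s.idx 2) ∧
      s'.idx 2 = s.idx 2 ∧ s'.reg 0 = s.reg 0) ?_ ?_ ?_ ?_).1
  · rintro i s1 s2 h ⟨h1, h2, h3⟩
    rw [h.idx 7 (by norm_num), h.idx 2 (by norm_num), h.reg]
    exact ⟨h1, h2, h3⟩
  · simp [Program.KeepsIdx, Program.All]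
  · exact ⟨rfl, rfl, rfl⟩
  · rintro i - s' h4 ⟨h1, h2, h3⟩
    rw [exec]
    simp only [Test.eval, RealExpr.eval, IdxExpr.eval, h2, h3, h4, Nat.cast_one, not_lt]
    rw [rank_succ]
    split_ifs with h
    · refine ⟨?_, h2, h3⟩
      rw [← h1]
      exact exec_setIdx_self
    · exact ⟨h1, h2, h3⟩

lemma exec_sumProgram {r : ℕ} (hr : r ≠ 4) : (exec tape (sumProgram r) s).reg 3 =
    ∑ i ∈ Finset.range (s.idx 3), weight (s.idx 2) (s.idx 6) (s.arr 0) (s.idx r) i := by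
  set s0 := exec tape (.setReg 3 (.ofIdx (.const 0))) s with hs0
  refine (exec_forLoop (s := s0) (r := 3) (by norm_num)
    (fun i s' => s'.reg 3 =
      ∑ i ∈ Finset.range i, weight (s.idx 2) (s.idx 6) (s.arr 0) (s.idx r) i ∧
      s'.idx 2 = s.idx 2 ∧ s'.idx 6 = s.idx 6 ∧ s'.idx r = s.idx r ∧ s'.arr 0 = s.arr 0)
    ?_ ?_ ?_ ?_).1
  · rintro i s1 s2 h ⟨h1, h2, h3, h4, h5⟩
    rw [h.idx 2 (by norm_num), h.idx 6 (by norm_num), h.idx r hr, h.reg, h.arr]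
    exact ⟨h1, h2, h3, h4, h5⟩
  · simp [Program.KeepsIdx, Program.All]
  · refine ⟨?_, rfl, rfl, rfl, rfl⟩
    simp [hs0, exec, RealExpr.eval, IdxExpr.eval]
  · rintro i - s' h4 ⟨h1, h2, h3, h5, h6⟩
    refine ⟨?_, h2, h3, h5, h6⟩
    rw [Finset.sum_range_succ, ← h1, ← h2, ← h3, ← h5, ← h6, ← h4, ← weightExpr_eval]
    exact exec_setReg_self

lemma exec_sampleProgram : (exec tape sampleProgram s).idx 8 =
    rank (s.idx 2) (fun i => ∑ i' ∈ Finset.range (i + 1),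
      weight (s.idx 2) (s.idx 6) (s.arr 0) (s.idx 7) i') (s.reg 2 * s.reg 3) := by
  set w := weight (s.idx 2) (s.idx 6) (s.arr 0) (s.idx 7) with hw
  set s0 := exec tape (.setReg 4 (.ofIdx (.const 0))) (exec tape (.setIdx 8 (.const 0)) s) with hs0
  refine (exec_forLoop (s := s0) (r := 2) (by norm_num)
    (fun i s' => s'.idx 8 = rank i (fun i => ∑ i' ∈ Finset.range (i + 1), w i')
        (s.reg 2 * s.reg 3) ∧ s'.reg 4 = ∑ i' ∈ Finset.range i, w i' ∧
      (s'.idx 2 = s.idx 2 ∧ s'.idx 6 = s.idx 6 ∧ s'.idx 7 = s.idx 7 ∧ s'.arr 0 = s.arr 0) ∧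
      s'.reg 2 = s.reg 2 ∧ s'.reg 3 = s.reg 3)
    ?_ ?_ ?_ ?_).1
  · rintro i s1 s2 h ⟨h1, h2, ⟨h3, h4, h5, h6⟩, h7, h8⟩
    rw [h.idx 2 (by norm_num), h.idx 6 (by norm_num), h.idx 7 (by norm_num),
      h.idx 8 (by norm_num), h.reg, h.arr]
    exact ⟨h1, h2, ⟨h3, h4, h5, h6⟩, h7, h8⟩
  · simp [Program.KeepsIdx, Program.All]
  · refine ⟨rfl, ?_, ⟨rfl, rfl, rfl, rfl⟩, rfl, rfl⟩
    simp [hs0, exec, RealExpr.eval, IdxExpr.eval]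
  · rintro i - s' hi ⟨h1, h2, ⟨h3, h4, h5, h6⟩, h7, h8⟩
    set s1 := exec tape (.setReg 4 (.add (.reg 4) (weightExpr 7))) s' with hs1
    have h9 : s1.reg 4 = ∑ i' ∈ Finset.range (i + 1), w i' := by
      rw [Finset.sum_range_succ, ← h2, hw, ← h3, ← h4, ← h5, ← h6, ← hi, ← weightExpr_eval]
      exact exec_setReg_self
    have h10 : s1.reg 2 = s.reg 2 := by
      rw [← h7]; exact exec_setReg_of_ne (by norm_num)
    have h11 : s1.reg 3 = s.reg 3 := by
      rw [← h8]; exact exec_setReg_of_ne (by norm_num)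
    have h12 : s1.idx 8 = s'.idx 8 := rfl
    rw [exec, ← hs1, exec]
    simp only [Test.eval, RealExpr.eval, not_lt, h9, h10, h11]
    rw [rank_succ]
    split_ifs with h
    · refine ⟨?_, h9, ⟨h3, h4, h5, h6⟩, h10, h11⟩
      rw [← h1]
      exact exec_setIdx_self
    · exact ⟨h1, h9, ⟨h3, h4, h5, h6⟩, h10, h11⟩

/-- Clamping serves only the syntactic memory bound; addresses up to $K$ are unaffected. -/
lemma clamp_eval {e : IdxExpr} (h : e.eval s ≤ s.idx 2) : e.clamp.eval s = e.eval s := by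
  simp only [IdxExpr.clamp, IdxExpr.eval]
  omega

lemma exec_setCell_arr {a : ℕ} {e : IdxExpr} {x : RealExpr} (h : e.eval s ≤ s.idx 2) :
    (exec tape (.setCell a e.clamp x) s).arr a =
      Function.update (s.arr a) (e.eval s) (x.eval s) := by
  rw [← clamp_eval h]
  exact Function.update_self _ _ _

lemma exec_freqProgram (h3 : s.idx 3 = s.idx 2 + 1) {a : ℕ} (ha : a < s.idx 3) :
    (exec tape freqProgram s).arr 2 a = s.arr 2 a +
      ((1 + 1 / s.idx 2) * s.arr 3 (s.idx 5) + s.reg 5) / (s.idx 6 + 1) *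
      (weight (s.idx 2) (s.idx 6) (s.arr 0) (s.idx 5) a / s.reg 3) := by
  refine (exec_forLoop (s := s) (r := 3) (by norm_num)
    (fun i s' => (∀ a, s'.arr 2 a = if a < i then s.arr 2 a +
      ((1 + 1 / s.idx 2) * s.arr 3 (s.idx 5) + s.reg 5) / (s.idx 6 + 1) *
      (weight (s.idx 2) (s.idx 6) (s.arr 0) (s.idx 5) a / s.reg 3) else s.arr 2 a) ∧
      (s'.idx 2 = s.idx 2 ∧ s'.idx 5 = s.idx 5 ∧ s'.idx 6 = s.idx 6) ∧ s'.reg = s.reg ∧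
      s'.arr 0 = s.arr 0 ∧ s'.arr 3 = s.arr 3)
    ?_ ?_ ?_ ?_).1 a |>.trans (if_pos ha)
  · rintro i s1 s2 h ⟨h1, ⟨h2, h3, h4⟩, h5, h6, h7⟩
    rw [h.idx 2 (by norm_num), h.idx 5 (by norm_num), h.idx 6 (by norm_num), h.reg, h.arr]
    exact ⟨h1, ⟨h2, h3, h4⟩, h5, h6, h7⟩
  · simp [Program.KeepsIdx, Program.All]
  · exact ⟨fun a => by simp, ⟨rfl, rfl, rfl⟩, rfl, rfl, rfl⟩
  · rintro i hi s' h4 ⟨h1, ⟨h2, h5, h6⟩, h7, h8, h9⟩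
    refine ⟨fun a => ?_, ⟨h2, h5, h6⟩, h7, h8, h9⟩
    have hle : (IdxExpr.reg 4).eval s' ≤ s'.idx 2 := by
      change s'.idx 4 ≤ s'.idx 2
      omega
    rw [exec_setCell_arr hle]
    have he : (IdxExpr.reg 4).eval s' = i := h4
    rw [he]
    by_cases hai : a = i
    · subst hai
      rw [Function.update_self, if_pos (Nat.lt_succ_self _)]
      simp only [RealExpr.eval, weightExpr_eval, IdxExpr.eval, h2, h4, h5, h6, h7, h8, h9, h1,
        lt_irrefl, if_false, Nat.cast_one]
    · rw [Function.update_of_ne hai, h1]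
      have : a < i + 1 ↔ a < i := by omega
      simp only [this]

lemma exec_blockProgram (h3 : s.idx 3 = s.idx 2 + 1) {a : ℕ} (ha : a < s.idx 3) :
    (exec tape blockProgram s).arr 0 a = s.arr 0 a + s.arr 1 a / s.arr 2 a ∧
    (exec tape blockProgram s).arr 1 a = 0 ∧ (exec tape blockProgram s).arr 2 a = 0 ∧
    (exec tape blockProgram s).arr 3 a = s.arr 4 a := by
  have h := (exec_forLoop (tape := tape) (s := s) (r := 3) (by norm_num)
    (c := .seq (.setCell 0 (.clamp (.reg 4))
      (.add (.cell 0 (.reg 4)) (.div (.cell 1 (.reg 4)) (.cell 2 (.reg 4)))))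
    (.seq (.setCell 1 (.clamp (.reg 4)) (.ofIdx (.const 0)))
      (.seq (.setCell 2 (.clamp (.reg 4)) (.ofIdx (.const 0)))
        (.setCell 3 (.clamp (.reg 4)) (.cell 4 (.reg 4))))))
    (fun i s' => (∀ a,
        (s'.arr 0 a = if a < i then s.arr 0 a + s.arr 1 a / s.arr 2 a else s.arr 0 a) ∧
        (s'.arr 1 a = if a < i then 0 else s.arr 1 a) ∧
        (s'.arr 2 a = if a < i then 0 else s.arr 2 a) ∧
        (s'.arr 3 a = if a < i then s.arr 4 a else s.arr 3 a)) ∧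
      s'.idx 2 = s.idx 2 ∧ s'.arr 4 = s.arr 4)
    ?_ ?_ ?_ ?_).1 a
  · unfold blockProgram
    simpa only [ha, if_true] using h
  · rintro i s1 s2 h ⟨h1, h2, h3⟩
    rw [h.idx 2 (by norm_num), h.arr]
    exact ⟨h1, h2, h3⟩
  · simp [Program.KeepsIdx, Program.All]
  · exact ⟨fun a => by simp, rfl, rfl⟩
  · rintro i hi s' h4 ⟨h1, h2, h5⟩
    have hcl : s'.idx 2 - (s'.idx 2 - i) = i := by omega
    refine ⟨fun a => ?_, h2, h5⟩
    simp only [exec, Store.tick, RealExpr.eval, IdxExpr.eval, IdxExpr.clamp, h4, hcl,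
      Function.update_self, Nat.cast_zero, ne_eq, OfNat.ofNat_ne_zero, OfNat.zero_ne_ofNat,
      Function.update_of_ne, not_false_eq_true, OfNat.ofNat_ne_one, OfNat.one_ne_ofNat,
      Nat.reduceEqDiff, one_ne_zero, zero_ne_one]
    by_cases hai : a = i
    · subst hai
      simp [h1, h5]
    · have : a < i + 1 ↔ a < i := by omega
      simp only [Function.update_of_ne hai, this]
      exact h1 a

end FirstPrice

/-! ### The grid size, and the machine as a simulation of the strategy -/

namespace FirstPrice

open RealRAM

variable {tape : ℕ → unitInterval} {s : Store} {m : ℕ → unitInterval} {K : ℕ} {X : ℝ}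

/-- The least number whose cube is at least `T`. -/
noncomputable def gridSize (T : ℕ) : ℕ :=
  Nat.find (⟨T, Nat.le_self_pow (by norm_num) T⟩ : ∃ k, T ≤ k ^ 3)

lemma le_gridSize_pow (T : ℕ) : T ≤ gridSize T ^ 3 :=
  Nat.find_spec (⟨T, Nat.le_self_pow (by norm_num) T⟩ : ∃ k, T ≤ k ^ 3)

lemma pow_lt_of_lt_gridSize {T k : ℕ} (h : k < gridSize T) : k ^ 3 < T :=
  not_le.1 (Nat.find_min (⟨T, Nat.le_self_pow (by norm_num) T⟩ : ∃ k, T ≤ k ^ 3) h)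

lemma gridSize_pos {T : ℕ} (hT : 1 ≤ T) : 1 ≤ gridSize T := by
  by_contra h
  have h0 : gridSize T = 0 := by omega
  have := le_gridSize_pow T
  rw [h0] at this
  omega

lemma gridSize_le {T : ℕ} (hT : 1 ≤ T) : gridSize T ≤ T := by
  have h1 := pow_lt_of_lt_gridSize (Nat.sub_lt (gridSize_pos hT) one_pos)
  have h2 := Nat.le_self_pow (n := 3) (by norm_num) (gridSize T - 1)
  omega

/-- By minimality the cube of $K-1$ is below $T$, and the missing 1 is at most $T^{1/3}$. -/
lemma gridSize_le_rpow {T : ℕ} (hT : 1 ≤ T) : (gridSize T : ℝ) ≤ 2 * (T : ℝ) ^ (1 / 3 : ℝ) := by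
  have hT' : (1 : ℝ) ≤ T := by exact_mod_cast hT
  have h1 : (1 : ℝ) ≤ (T : ℝ) ^ (1 / 3 : ℝ) := Real.one_le_rpow hT' (by norm_num)
  have h2 : (((gridSize T - 1 : ℕ) : ℝ)) ≤ (T : ℝ) ^ (1 / 3 : ℝ) := by
    have h3 := pow_lt_of_lt_gridSize (Nat.sub_lt (gridSize_pos hT) one_pos)
    have h4 : (((gridSize T - 1 : ℕ) : ℝ)) ^ (3 : ℝ) ≤ T := by
      have : (((gridSize T - 1 : ℕ) : ℝ)) ^ 3 ≤ T := by exact_mod_cast h3.le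
      exact_mod_cast this
    have h5 := Real.rpow_le_rpow (by positivity) h4 (show (0 : ℝ) ≤ 1 / 3 by norm_num)
    rwa [← Real.rpow_mul (Nat.cast_nonneg _), show (3 : ℝ) * (1 / 3) = 1 by norm_num,
      Real.rpow_one] at h5
  rw [Nat.cast_sub (gridSize_pos hT)] at h2
  push_cast at h2
  linarith

/-- In the time bound, `40 * s.idx 2` acts as a potential: each round raises register `2` by one,
which pays for the round, and the final 40 covers the failing test. -/
lemma iterate_cubeStep (n : ℕ) (s : Store) (h9 : s.idx 9 = s.idx 2 ^ 2)
    (h10 : s.idx 10 = s.idx 2 ^ 3) (hn : s.idx 0 ≤ s.idx 2 + n)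
    (hlt : ∀ k < s.idx 2, k ^ 3 < s.idx 0) :
    (iterate (.idxLt (.reg 10) (.reg 0)) (exec tape cubeStep) n s).idx 0 = s.idx 0 ∧
    (iterate (.idxLt (.reg 10) (.reg 0)) (exec tape cubeStep) n s).idx 2 = gridSize (s.idx 0) ∧
    (iterate (.idxLt (.reg 10) (.reg 0)) (exec tape cubeStep) n s).time + 40 * s.idx 2 ≤
      s.time + 40 * gridSize (s.idx 0) + 40 := by
  have hend : ∀ k, s.idx 0 ≤ k ^ 3 → (∀ i < k, i ^ 3 < s.idx 0) → k = gridSize (s.idx 0) := by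
    intro k h1 h2
    exact ((Nat.find_eq_iff (⟨k, h1⟩ : ∃ i, s.idx 0 ≤ i ^ 3)).2 ⟨h1, fun i hi => not_le.2 (h2 i hi)⟩).symm
  induction n generalizing s with
  | zero =>
    have h := hend _ (hn.trans (Nat.le_self_pow (by norm_num) _)) hlt
    refine ⟨rfl, h, ?_⟩
    rw [iterate]
    omega
  | succ n ih =>
    rw [iterate]
    split_ifs with h
    · have h' : s.idx 2 ^ 3 < s.idx 0 := by rw [← h10]; exact h
      set s1 := exec tape cubeStep (s.tick ((Test.idxLt (.reg 10) (.reg 0)).cost + 1)) with hs1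
      have e0 : s1.idx 0 = s.idx 0 := by
        simp [hs1, cubeStep, exec, IdxExpr.eval, Store.tick]
      have e2 : s1.idx 2 = s.idx 2 + 1 := by
        simp [hs1, cubeStep, exec, IdxExpr.eval, Store.tick]
      have e9 : s1.idx 9 = s1.idx 2 ^ 2 := by
        rw [e2]
        simp [hs1, cubeStep, exec, IdxExpr.eval, Store.tick, h9]
        ring
      have e10 : s1.idx 10 = s1.idx 2 ^ 3 := by
        rw [e2]
        simp [hs1, cubeStep, exec, IdxExpr.eval, Store.tick, h9, h10]
        ring
      have et : s1.time ≤ s.time + 40 := by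
        simp [hs1, cubeStep, exec, IdxExpr.cost, Test.cost, Store.tick]
      have := ih s1 e9 e10 (by omega) (by
        intro k hk
        rw [e0]
        rw [e2] at hk
        rcases (Nat.lt_succ_iff.1 hk).lt_or_eq with h1 | rfl
        · exact hlt k h1
        · exact h') (by rw [e0]; exact hend)
      rw [e0] at this
      refine ⟨this.1, this.2.1, ?_⟩
      have := this.2.2
      rw [e2] at this
      omega
    · have h' : s.idx 0 ≤ s.idx 2 ^ 3 := by rw [← h10]; exact not_lt.1 h
      have hg := hend _ h' hlt
      refine ⟨rfl, hg, ?_⟩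
      simp only [Store.tick, Test.cost, IdxExpr.cost]
      omega

lemma exec_initProgram (T : ℕ) (hs : s = exec tape initProgram (Store.start T)) :
    s.idx 2 = gridSize T ∧ s.idx 3 = gridSize T + 1 ∧ s.idx 5 = 0 ∧ s.idx 6 = 0 ∧ s.draws = 0 ∧
      s.reg 5 = 8 * gridSize T * (1 + Real.log T) ∧ (∀ a i, s.arr a i = 0) ∧ s.space = 0 ∧
      s.time ≤ 40 * gridSize T + 100 := by
  set s1 := exec tape (.loop (.reg 0) (.idxLt (.reg 10) (.reg 0)) cubeStep) (Store.start T)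
    with hs1
  have h := iterate_cubeStep (tape := tape) T ((Store.start T).tick ((IdxExpr.reg 0).cost + 1))
    (by simp [Store.start, Store.tick]) (by simp [Store.start, Store.tick])
    (by simp [Store.start, Store.tick]) (by simp [Store.start, Store.tick])
  have e : s1 = iterate (.idxLt (.reg 10) (.reg 0)) (exec tape cubeStep) T
      ((Store.start T).tick ((IdxExpr.reg 0).cost + 1)) := by
    rw [hs1, exec]
    congr 1
  rw [← e] at h
  obtain ⟨h0, h2, ht⟩ := h
  replace h0 : s1.idx 0 = T := h0
  replace h2 : s1.idx 2 = gridSize T := h2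
  replace ht : s1.time + 0 ≤ 2 + 40 * gridSize T + 40 := by
    simpa [Store.start, Store.tick, IdxExpr.cost, add_comm, add_left_comm] using ht
  have hspace : s.space = 0 := by
    rw [hs]
    refine exec_invariant (φ := fun | .setCell _ _ _ => False | _ => True)
      (I := fun s' => s'.space = 0) (fun _ _ h => h)
      (fun _ _ _ _ h => h) (fun _ _ _ _ h => h) (fun _ _ _ _ h => h.elim) (fun _ _ _ h => h)
      initProgram ?_ _ rfl
    simp [initProgram, cubeStep, Program.All]
  have harr : ∀ a i, s.arr a i = 0 := fun a i => by
    rw [hs, Program.KeepsArr.exec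
      (by simp [initProgram, cubeStep, Program.KeepsArr, Program.All])]
    rfl
  have h5 : s.idx 5 = 0 := by
    rw [hs, Program.KeepsIdx.exec
      (by simp [initProgram, cubeStep, Program.KeepsIdx, Program.All])]
    rfl
  have h6 : s.idx 6 = 0 := by
    rw [hs, Program.KeepsIdx.exec
      (by simp [initProgram, cubeStep, Program.KeepsIdx, Program.All])]
    rfl
  -- Initialization shares the tape of auction 0, so the first number must still be unused when the
  -- first bid is drawn.
  have hd : s.draws = 0 := by
    rw [hs, Program.Deterministic.exec
      (by simp [initProgram, cubeStep, Program.Deterministic, Program.All])]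
    rfl
  have hs' : s = exec tape (.setReg 5 (.mul (.mul (.ofIdx (.const 8)) (.ofIdx (.reg 2)))
        (.add (.ofIdx (.const 1)) (.log (.ofIdx (.reg 0))))))
      (exec tape (.setIdx 3 (.add (.reg 2) (.const 1))) s1) := hs
  refine ⟨?_, ?_, h5, h6, hd, ?_, harr, hspace, ?_⟩
  · rw [hs']; simp [exec, Store.tick, h2]
  · rw [hs']; simp [exec, Store.tick, IdxExpr.eval, h2]
  · rw [hs']; simp [exec, Store.tick, IdxExpr.eval, RealExpr.eval, h2, h0]
  · rw [hs']
    simp only [exec, IdxExpr.cost, RealExpr.cost, Store.tick]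
    omega

/-- The machine is in block `j` of the play `ξ`, and `k` auctions of the block are over. -/
structure Tracks (m : ℕ → unitInterval) (K : ℕ) (X : ℝ) (ξ : ℕ → ℕ × ℕ) (j k : ℕ)
    (s : Store) : Prop where
  idx_two : s.idx 2 = K
  idx_three : s.idx 3 = K + 1
  idx_five : s.idx 5 = k
  idx_six : s.idx 6 = j * (K + 1)
  reg_five : s.reg 5 = X
  arr_zero : ∀ a < K + 1, s.arr 0 a = estimate m K X ξ j a
  arr_one : ∀ a < K + 1, s.arr 1 a = losses m K ξ j k a
  arr_two : ∀ a < K + 1, s.arr 2 a =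
    ∑ c ∈ Finset.range k, mass K X ξ j c * prob m K X ξ j c a
  arr_three : ∀ a < K + 1, s.arr 3 a = count ξ (j * (K + 1)) a
  arr_four : ∀ a < K + 1, s.arr 4 a = count ξ (j * (K + 1) + k) a

/-- The arrays agree with the estimates only at indices up to $K$; this suffices because a weight
reads a single entry. -/
lemma weight_congr {K n : ℕ} {Y Y' : ℕ → ℝ} {a : ℕ} (h : Y a = Y' a) (c : ℕ) :
    weight K n Y c a = weight K n Y' c a := by
  rw [weight, weight, h]

lemma rank_congr {k : ℕ} {θ θ' : ℕ → ℝ} (h : ∀ i < k, θ i = θ' i) (x : ℝ) :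
    rank k θ x = rank k θ' x :=
  Finset.sum_congr rfl fun i hi => by rw [h i (Finset.mem_range.1 hi)]

lemma Tracks.bid {ξ : ℕ → ℕ × ℕ} {j k : ℕ} (h : Tracks m K X ξ j k s) (hd : s.draws = 0)
    {s' : Store} (hs' : s' = exec tape bidProgram s) :
    Tracks m K X ξ j k s' ∧ s'.idx 7 = roundVal K (s.reg 0) ∧
      s'.idx 8 = sample K (j * (K + 1)) (estimate m K X ξ j) (roundVal K (s.reg 0)) (tape 0) ∧
      s'.reg 1 = (s'.idx 8 : ℝ) / K := by
  have hidx : ∀ r, r ≠ 4 → r ≠ 7 → r ≠ 8 → s'.idx r = s.idx r := by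
    intro r h4 h7 h8
    rw [hs']
    refine Program.KeepsIdx.exec ?_
    simp [bidProgram, roundProgram, sumProgram, sampleProgram, forLoop, Program.KeepsIdx,
      Program.All, h4, h7, h8]
  have harr : ∀ a, s'.arr a = s.arr a := by
    intro a
    rw [hs']
    refine Program.KeepsArr.exec ?_
    simp [bidProgram, roundProgram, sumProgram, sampleProgram, forLoop, Program.KeepsArr,
      Program.All]
  have hr5 : s'.reg 5 = s.reg 5 := by
    rw [hs']
    refine Program.KeepsReg.exec ?_
    simp [bidProgram, roundProgram, sumProgram, sampleProgram, forLoop, Program.KeepsReg,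
      Program.All]
  have ht : Tracks m K X ξ j k s' := by
    constructor
    · rw [hidx 2 (by norm_num) (by norm_num) (by norm_num)]; exact h.idx_two
    · rw [hidx 3 (by norm_num) (by norm_num) (by norm_num)]; exact h.idx_three
    · rw [hidx 5 (by norm_num) (by norm_num) (by norm_num)]; exact h.idx_five
    · rw [hidx 6 (by norm_num) (by norm_num) (by norm_num)]; exact h.idx_six
    · rw [hr5]; exact h.reg_five
    · rw [harr]; exact h.arr_zero
    · rw [harr]; exact h.arr_one
    · rw [harr]; exact h.arr_two
    · rw [harr]; exact h.arr_three
    · rw [harr]; exact h.arr_four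
  set s1 := exec tape (.rand 2) s with hs1
  set s2 := exec tape roundProgram s1 with hs2
  set s3 := exec tape (sumProgram 7) s2 with hs3
  set s4 := exec tape sampleProgram s3 with hs4
  have hs5 : s' = exec tape (.setReg 1 (.div (.ofIdx (.reg 8)) (.ofIdx (.reg 2)))) s4 := hs'
  have hi5 : s'.idx = s4.idx := by rw [hs5]; simp [exec, Store.tick]
  -- what the parts leave unchanged
  have a2 : s2.arr 0 = s.arr 0 := by
    rw [hs2, Program.KeepsArr.exec (by
      simp [roundProgram, forLoop, Program.KeepsArr, Program.All])]
    rfl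
  have a3 : s3.arr 0 = s.arr 0 := by
    rw [hs3, Program.KeepsArr.exec (by
      simp [sumProgram, forLoop, Program.KeepsArr, Program.All]), a2]
  have i2 : ∀ r, r ≠ 4 → r ≠ 7 → s2.idx r = s.idx r := by
    intro r h4 h7
    rw [hs2, Program.KeepsIdx.exec (by
      simp [roundProgram, forLoop, Program.KeepsIdx, Program.All, h4, h7])]
    rfl
  have i3 : ∀ r, r ≠ 4 → s3.idx r = s2.idx r := by
    intro r h4
    rw [hs3, Program.KeepsIdx.exec (by
      simp [sumProgram, forLoop, Program.KeepsIdx, Program.All, h4])]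
  have i4 : ∀ r, r ≠ 4 → r ≠ 8 → s4.idx r = s3.idx r := by
    intro r h4 h8
    rw [hs4, Program.KeepsIdx.exec (by
      simp [sampleProgram, forLoop, Program.KeepsIdx, Program.All, h4, h8])]
  have r2 : s3.reg 2 = tape 0 := by
    rw [hs3, Program.KeepsReg.exec (by
      simp [sumProgram, forLoop, Program.KeepsReg, Program.All]),
      hs2, Program.KeepsReg.exec (by
      simp [roundProgram, forLoop, Program.KeepsReg, Program.All]), hs1]
    simp [exec, hd]
  have e7 : s2.idx 7 = roundVal K (s.reg 0) := by
    rw [hs2, exec_roundProgram]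
    have h1 : s1.idx 2 = K := h.idx_two
    have h2 : s1.reg 0 = s.reg 0 := by rw [hs1]; simp [exec]
    rw [h1, h2]
  have e3 : s3.reg 3 = ∑ i ∈ Finset.range (K + 1),
      weight K (j * (K + 1)) (estimate m K X ξ j) (roundVal K (s.reg 0)) i := by
    rw [hs3, exec_sumProgram (by norm_num), i2 3 (by norm_num) (by norm_num),
      i2 2 (by norm_num) (by norm_num), i2 6 (by norm_num) (by norm_num), a2, e7, h.idx_two,
      h.idx_three, h.idx_six]
    exact Finset.sum_congr rfl fun i hi => weight_congr (h.arr_zero i (Finset.mem_range.1 hi)) _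
  have e8 : s4.idx 8 = sample K (j * (K + 1)) (estimate m K X ξ j) (roundVal K (s.reg 0))
      (tape 0) := by
    rw [hs4, exec_sampleProgram, i3 2 (by norm_num), i3 6 (by norm_num), i3 7 (by norm_num),
      i2 2 (by norm_num) (by norm_num), i2 6 (by norm_num) (by norm_num), a3, e7, r2, e3,
      h.idx_two, h.idx_six, sample]
    refine rank_congr (fun i hi => ?_) _
    refine Finset.sum_congr rfl fun i' hi' => weight_congr (h.arr_zero i' ?_) _
    have := Finset.mem_range.1 hi'
    omega
  refine ⟨ht, ?_, ?_, ?_⟩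
  · rw [hi5, i4 7 (by norm_num) (by norm_num), i3 7 (by norm_num), e7]
  · rw [hi5, e8]
  · rw [hi5, hs5, exec_setReg_self]
    have : s4.idx 2 = K := by rw [← hi5]; exact ht.idx_two
    simp [RealExpr.eval, IdxExpr.eval, this]

end FirstPrice

namespace FirstPrice

open RealRAM

variable {tape : ℕ → unitInterval} {s : Store} {m : ℕ → unitInterval} {K : ℕ} {X : ℝ}
  {ξ ξ' : ℕ → ℕ × ℕ} {j k : ℕ}

/-- All tracked quantities are adapted, so the play may be extended by the current auction before it
is recorded. -/
lemma Tracks.congr (h : Tracks m K X ξ j k s) (hξ : ∀ i < j * (K + 1) + k, ξ i = ξ' i) :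
    Tracks m K X ξ' j k s := by
  have hξ0 : ∀ i < j * (K + 1), ξ i = ξ' i := fun i hi => hξ i (by omega)
  refine ⟨h.idx_two, h.idx_three, h.idx_five, h.idx_six, h.reg_five, fun a ha => ?_,
    fun a ha => ?_, fun a ha => ?_, fun a ha => ?_, fun a ha => ?_⟩
  · exact (h.arr_zero a ha).trans (congrFun (adapted_estimate j ξ ξ' hξ0) a)
  · exact (h.arr_one a ha).trans (adapted_losses j k a ξ ξ' hξ)
  · have h1 : mass K X ξ j = mass K X ξ' j := adapted_mass j ξ ξ' hξ0
    have h2 : prob m K X ξ j = prob m K X ξ' j := adapted_prob j ξ ξ' hξ0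
    rw [← h1, ← h2]
    exact h.arr_two a ha
  · exact (h.arr_three a ha).trans (adapted_count _ a ξ ξ' hξ0)
  · exact (h.arr_four a ha).trans (adapted_count _ a ξ ξ' hξ)

lemma Tracks.record (h : Tracks m K X ξ j k s) (hk : k < K + 1)
    (hc : s.idx 7 = (ξ (j * (K + 1) + k)).1) (ha : s.idx 8 = (ξ (j * (K + 1) + k)).2)
    (hcK : s.idx 7 < K + 1) (haK : s.idx 8 < K + 1)
    (hw : 1 - (s.idx 1 : ℝ) = lost m K (j * (K + 1) + k) (s.idx 8)) :
    Tracks m K X ξ j (k + 1)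
      (exec tape (.setIdx 5 (.add (.reg 5) (.const 1)))
        (exec tape (.setCell 1 (.clamp (.reg 8)) (.add (.cell 1 (.reg 8))
            (.sub (.ofIdx (.const 1)) (.ofIdx (.reg 1)))))
          (exec tape (.setCell 4 (.clamp (.reg 7)) (.add (.cell 4 (.reg 7)) (.ofIdx (.const 1))))
            (exec tape freqProgram (exec tape (sumProgram 5) s))))) := by
  set s1 := exec tape (sumProgram 5) s with hs1
  set s2 := exec tape freqProgram s1 with hs2
  set s3 := exec tape (.setCell 4 (.clamp (.reg 7)) (.add (.cell 4 (.reg 7)) (.ofIdx (.const 1))))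
    s2 with hs3
  set s4 := exec tape (.setCell 1 (.clamp (.reg 8)) (.add (.cell 1 (.reg 8))
    (.sub (.ofIdx (.const 1)) (.ofIdx (.reg 1))))) s3 with hs4
  have i1 : ∀ r, r ≠ 4 → s1.idx r = s.idx r := by
    intro r h4
    rw [hs1, Program.KeepsIdx.exec (by
      simp [sumProgram, forLoop, Program.KeepsIdx, Program.All, h4])]
  have i2 : ∀ r, r ≠ 4 → s2.idx r = s.idx r := by
    intro r h4
    rw [hs2, Program.KeepsIdx.exec (by
      simp [freqProgram, forLoop, Program.KeepsIdx, Program.All, h4]), i1 r h4]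
  have i4 : s4.idx = s2.idx := rfl
  have a1 : ∀ r, s1.arr r = s.arr r := by
    intro r
    rw [hs1, Program.KeepsArr.exec (by
      simp [sumProgram, forLoop, Program.KeepsArr, Program.All])]
  have a2 : ∀ r, r ≠ 2 → s2.arr r = s.arr r := by
    intro r hr
    rw [hs2, Program.KeepsArr.exec (by
      simp [freqProgram, forLoop, Program.KeepsArr, Program.All, hr]), a1 r]
  have r5 : s1.reg 5 = s.reg 5 := by
    rw [hs1, Program.KeepsReg.exec (by
      simp [sumProgram, forLoop, Program.KeepsReg, Program.All])]
  have r5' : s2.reg 5 = s.reg 5 := by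
    rw [hs2, Program.KeepsReg.exec (by
      simp [freqProgram, forLoop, Program.KeepsReg, Program.All]), r5]
  have e3 : s3.arr 4 = Function.update (s.arr 4) (s.idx 7) (s.arr 4 (s.idx 7) + 1) := by
    rw [hs3, exec_setCell_arr (by
      change s2.idx 7 ≤ s2.idx 2
      rw [i2 7 (by norm_num), i2 2 (by norm_num), h.idx_two]; omega)]
    simp only [RealExpr.eval, IdxExpr.eval, i2 7 (by norm_num), a2 4 (by norm_num), Nat.cast_one]
  have a3 : ∀ r, r ≠ 4 → s3.arr r = s2.arr r := fun r hr => Function.update_of_ne hr _ _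
  have a4 : ∀ r, r ≠ 1 → s4.arr r = s3.arr r := fun r hr => Function.update_of_ne hr _ _
  have e4 : s4.arr 1 = Function.update (s.arr 1) (s.idx 8)
      (s.arr 1 (s.idx 8) + (1 - (s.idx 1 : ℝ))) := by
    have i3 : s3.idx = s2.idx := rfl
    rw [hs4, exec_setCell_arr (by
      change s2.idx 8 ≤ s2.idx 2
      rw [i2 8 (by norm_num), i2 2 (by norm_num), h.idx_two]; omega)]
    simp only [RealExpr.eval, IdxExpr.eval, i3, i2 8 (by norm_num), i2 1 (by norm_num),
      a3 1 (by norm_num), a2 1 (by norm_num), Nat.cast_one]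
  -- Register `5` contains `k`, so the term added is that of the rounded value `k`, whatever value
  -- was observed.
  have e2 : ∀ a < K + 1, s2.arr 2 a = s.arr 2 a + mass K X ξ j k * prob m K X ξ j k a := by
    intro a ha
    rw [hs2, exec_freqProgram (by
        rw [i1 3 (by norm_num), i1 2 (by norm_num), h.idx_two, h.idx_three])
      (by rw [i1 3 (by norm_num), h.idx_three]; exact ha), hs1, exec_sumProgram (by norm_num),
      ← hs1, a1, a1, a1, r5, i1 2 (by norm_num), i1 5 (by norm_num), i1 6 (by norm_num),
      h.idx_two, h.idx_three, h.idx_five, h.idx_six, h.reg_five, h.arr_three k hk,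
      weight_congr (h.arr_zero a ha), Finset.sum_congr rfl fun i hi =>
        weight_congr (h.arr_zero i (Finset.mem_range.1 hi)) k]
    rfl
  have i5 : ∀ r, r ≠ 5 → (exec tape (.setIdx 5 (.add (.reg 5) (.const 1))) s4).idx r =
      s2.idx r := fun r hr => Function.update_of_ne hr _ _
  refine ⟨?_, ?_, ?_, ?_, ?_, fun a ha' => ?_, fun a ha' => ?_, fun a ha' => ?_, fun a ha' => ?_,
    fun a ha' => ?_⟩
  · rw [i5 2 (by norm_num), i2 2 (by norm_num), h.idx_two]
  · rw [i5 3 (by norm_num), i2 3 (by norm_num), h.idx_three]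
  · rw [exec_setIdx_self]
    simp only [IdxExpr.eval, i4, i2 5 (by norm_num), h.idx_five]
  · rw [i5 6 (by norm_num), i2 6 (by norm_num), h.idx_six]
  · exact r5'.trans h.reg_five
  · change s4.arr 0 a = _
    rw [a4 0 (by norm_num), a3 0 (by norm_num), a2 0 (by norm_num), h.arr_zero a ha']
  · change s4.arr 1 a = _
    rw [e4, losses, Finset.sum_range_succ, ← losses, ← h.arr_one a ha', hw, ← ha]
    by_cases haa : a = s.idx 8
    · subst haa
      rw [Function.update_self, if_pos rfl]
    · rw [Function.update_of_ne haa, if_neg (Ne.symm haa), add_zero]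
  · change s4.arr 2 a = _
    rw [a4 2 (by norm_num), a3 2 (by norm_num), e2 a ha', h.arr_two a ha', Finset.sum_range_succ]
  · change s4.arr 3 a = _
    rw [a4 3 (by norm_num), a3 3 (by norm_num), a2 3 (by norm_num), h.arr_three a ha']
  · change s4.arr 4 a = _
    rw [a4 4 (by norm_num), e3, ← add_assoc, count, Finset.sum_range_succ, ← count,
      ← h.arr_four a ha', ← hc]
    by_cases haa : a = s.idx 7
    · subst haa
      rw [Function.update_self, if_pos rfl]
    · rw [Function.update_of_ne haa, if_neg (Ne.symm haa), add_zero]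

/-- After $K+1$ auctions array `2` contains all terms of `freqEst`, and the quotient added to array
`0` is exactly the increment of `estimate`. -/
lemma Tracks.endBlock (h : Tracks m K X ξ j (K + 1) s) :
    Tracks m K X ξ (j + 1) 0 (exec tape (.seq blockProgram
      (.seq (.setIdx 6 (.add (.reg 6) (.reg 3))) (.setIdx 5 (.const 0)))) s) := by
  rw [exec]
  have hb := fun a (ha : a < K + 1) => exec_blockProgram (tape := tape) (s := s)
    (by rw [h.idx_two, h.idx_three]) (a := a) (by rwa [h.idx_three])
  set s1 := exec tape blockProgram s with hs1
  have i1 : ∀ r, r ≠ 4 → s1.idx r = s.idx r := by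
    intro r h4
    rw [hs1, Program.KeepsIdx.exec (by
      simp [blockProgram, forLoop, Program.KeepsIdx, Program.All, h4])]
  have r1 : s1.reg 5 = s.reg 5 := by
    rw [hs1, Program.KeepsReg.exec (by
      simp [blockProgram, forLoop, Program.KeepsReg, Program.All])]
  have a1 : s1.arr 4 = s.arr 4 := by
    rw [hs1, Program.KeepsArr.exec (by
      simp [blockProgram, forLoop, Program.KeepsArr, Program.All])]
  set s2 := exec tape (.seq (.setIdx 6 (.add (.reg 6) (.reg 3))) (.setIdx 5 (.const 0))) s1 with hs2
  have i2 : ∀ r, r ≠ 5 → r ≠ 6 → s2.idx r = s1.idx r := fun r h5 h6 =>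
    (Function.update_of_ne h5 _ _).trans (Function.update_of_ne h6 _ _)
  have harr : s2.arr = s1.arr := rfl
  refine ⟨?_, ?_, ?_, ?_, ?_, fun a ha => ?_, fun a ha => ?_, fun a ha => ?_, fun a ha => ?_,
    fun a ha => ?_⟩
  · rw [i2 2 (by norm_num) (by norm_num), i1 2 (by norm_num), h.idx_two]
  · rw [i2 3 (by norm_num) (by norm_num), i1 3 (by norm_num), h.idx_three]
  · exact exec_setIdx_self (tape := tape)
  · have : s2.idx 6 = s1.idx 6 + s1.idx 3 := by
      rw [hs2]; simp [exec, Store.tick, IdxExpr.eval]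
    rw [this, i1 6 (by norm_num), i1 3 (by norm_num), h.idx_six, h.idx_three]
    ring
  · exact r1.trans h.reg_five
  · rw [harr, (hb a ha).1, h.arr_zero a ha, h.arr_one a ha, h.arr_two a ha]
    rfl
  · rw [harr, (hb a ha).2.1]
    rfl
  · rw [harr, (hb a ha).2.2.1]
    rfl
  · rw [harr, (hb a ha).2.2.2, h.arr_four a ha, Nat.succ_mul]
  · rw [harr, a1, h.arr_four a ha, Nat.succ_mul, add_zero]

lemma Tracks.update (h : Tracks m K X ξ j k s) (hk : k < K + 1)
    (hc : s.idx 7 = (ξ (j * (K + 1) + k)).1) (ha : s.idx 8 = (ξ (j * (K + 1) + k)).2)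
    (hcK : s.idx 7 < K + 1) (haK : s.idx 8 < K + 1)
    (hw : 1 - (s.idx 1 : ℝ) = lost m K (j * (K + 1) + k) (s.idx 8)) :
    ∃ j' k', j * (K + 1) + k + 1 = j' * (K + 1) + k' ∧ k' < K + 1 ∧
      Tracks m K X ξ j' k' (exec tape updateProgram s) := by
  have h1 := h.record (tape := tape) hk hc ha hcK haK hw
  rw [updateProgram]
  -- These are the equations for `seq` and `ite`; elementary commands stay folded.
  simp only [exec.eq_6, exec.eq_7]
  set s1 := exec tape (.setIdx 5 (.add (.reg 5) (.const 1))) _ with hs1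
  have htest : (Test.idxLt (.reg 5) (.reg 3)).eval s1 ↔ k + 1 < K + 1 := by
    simp only [Test.eval, IdxExpr.eval, h1.idx_five, h1.idx_three]
  by_cases hlt : k + 1 < K + 1
  · rw [if_pos (htest.2 hlt)]
    refine ⟨j, k + 1, by ring, hlt, ?_⟩
    exact ⟨h1.idx_two, h1.idx_three, h1.idx_five, h1.idx_six, h1.reg_five, h1.arr_zero,
      h1.arr_one, h1.arr_two, h1.arr_three, h1.arr_four⟩
  · rw [if_neg (mt htest.1 hlt)]
    have hkK : k + 1 = K + 1 := by omega
    refine ⟨j + 1, 0, by rw [add_assoc, hkK]; ring, by omega, ?_⟩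
    rw [hkK] at h1
    have h2 : Tracks m K X ξ j (K + 1) (s1.tick ((Test.idxLt (.reg 5) (.reg 3)).cost + 1)) :=
      ⟨h1.idx_two, h1.idx_three, h1.idx_five, h1.idx_six, h1.reg_five, h1.arr_zero,
        h1.arr_one, h1.arr_two, h1.arr_three, h1.arr_four⟩
    exact h2.endBlock (tape := tape)

end FirstPrice

namespace FirstPrice

open RealRAM

variable {T : ℕ} {m : ℕ → unitInterval} {K : ℕ} {X : ℝ}
  {ξ : ℕ → ℕ × ℕ} {j k t : ℕ} {s : Store}

lemma Tracks.afterBid (h : Tracks m K X ξ j k s) (hd : s.draws = 0) (hk : k < K + 1)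
    (z : unitInterval × (ℕ → unitInterval)) :
    Tracks m K X ξ j k (afterBid bidder z s) ∧
      (afterBid bidder z s).idx 7 = (nextPlay m K X (j * (K + 1) + k) ξ z).1 ∧
      (afterBid bidder z s).idx 8 = (nextPlay m K X (j * (K + 1) + k) ξ z).2 ∧
      (afterBid bidder z s).reg 1 = ((nextPlay m K X (j * (K + 1) + k) ξ z).2 : ℝ) / K := by
  set s0 : Store := { s with reg := Function.update s.reg 0 (z.1 : ℝ) } with hs0
  have h0 : Tracks m K X ξ j k s0 := by
    refine ⟨h.idx_two, h.idx_three, h.idx_five, h.idx_six, ?_, h.arr_zero, h.arr_one, h.arr_two,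
      h.arr_three, h.arr_four⟩
    rw [hs0]
    simpa using h.reg_five
  have hv : s0.reg 0 = z.1 := by simp [hs0]
  obtain ⟨h1, h2, h3, h4⟩ := h0.bid (tape := z.2) hd rfl
  have hdiv : (j * (K + 1) + k) / (K + 1) = j := by
    rw [Nat.add_comm, Nat.add_mul_div_right _ _ (Nat.succ_pos K), Nat.div_eq_of_lt hk, zero_add]
  rw [hv] at h2 h3
  have h3' : (exec z.2 bidProgram s0).idx 8 = (nextPlay m K X (j * (K + 1) + k) ξ z).2 := by
    rw [h3, nextPlay, hdiv]
  exact ⟨h1, h2, h3', h4.trans (by rw [h3'])⟩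

open Classical in
lemma store_succ (A : Bidder) (T : ℕ) (m : ℕ → unitInterval) (ω : Outcome) (t : ℕ) :
    ∃ w : ℕ, w = (if (m t : ℝ) ≤ bidAt A T m ω t then 1 else 0) ∧
      store A T m ω (t + 1) = { exec (ω t).2 A.update
        { afterBid A (ω t) (store A T m ω t) with
          idx := Function.update (afterBid A (ω t) (store A T m ω t)).idx 1 w } with draws := 0 } :=
  ⟨_, rfl, rfl⟩

/-- Induction over auctions. The draw counter is reset after each auction, so every bid uses the
first number of its own tape, as `nextPlay` does. -/
lemma store_tracks (m : ℕ → unitInterval) (T : ℕ) (hK : K = gridSize T)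
    (hX : X = 8 * K * (1 + Real.log T)) (ω : Outcome) (t : ℕ) :
    ∃ j k, t = j * (K + 1) + k ∧ k < K + 1 ∧
      Tracks m K X (play m K X ω t) j k (store bidder T m ω t) ∧
      (store bidder T m ω t).draws = 0 ∧ (store bidder T m ω t).space ≤ K + 1 := by
  induction t with
  | zero =>
    obtain ⟨h2, h3, h5, h6, hd, hr, ha, hs, -⟩ :=
      exec_initProgram (tape := (ω 0).2) T (s := store bidder T m ω 0) rfl
    rw [← hK] at h2 h3 hr
    refine ⟨0, 0, by simp, by omega, ⟨h2, h3, h5, by simpa using h6, by rw [hr, hX],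
      fun a _ => ?_, fun a _ => ?_, fun a _ => ?_, fun a _ => ?_, fun a _ => ?_⟩, hd, by omega⟩
    all_goals rw [ha]; simp [estimate, losses, count]
  | succ t ih =>
    obtain ⟨j, k, ht, hk, htr, hd, hsp⟩ := ih
    obtain ⟨h1, h7, h8, h9⟩ := htr.afterBid hd hk (ω t)
    rw [← ht] at h7 h8 h9
    obtain ⟨w, hw, hst⟩ := store_succ bidder T m ω t
    set s0 := FirstPrice.afterBid bidder (ω t) (store bidder T m ω t) with hs0
    set s1 : Store := { s0 with idx := Function.update s0.idx 1 w } with hs1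
    have i1 : ∀ r, r ≠ 1 → s1.idx r = s0.idx r := fun r hr => Function.update_of_ne hr _ _
    have h1' : Tracks m K X (play m K X ω t) j k s1 :=
      ⟨(i1 2 (by norm_num)).trans h1.idx_two, (i1 3 (by norm_num)).trans h1.idx_three,
        (i1 5 (by norm_num)).trans h1.idx_five, (i1 6 (by norm_num)).trans h1.idx_six,
        h1.reg_five, h1.arr_zero, h1.arr_one, h1.arr_two, h1.arr_three, h1.arr_four⟩
    have hcong := h1'.congr (ξ' := play m K X ω (t + 1)) fun i hi =>
      (play_eq_of_lt (Nat.le_succ t) ω i (by omega)).symm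
    have hplay : play m K X ω (t + 1) (j * (K + 1) + k) =
        nextPlay m K X t (play m K X ω t) (ω t) := by
      rw [← ht, play_apply (Nat.lt_succ_self t)]
    have hb : bidAt bidder T m ω t = (s1.idx 8 : ℝ) / K := by
      rw [i1 8 (by norm_num), h8]
      exact h9
    obtain ⟨j', k', hjk, hk', htr'⟩ := hcong.update (tape := (ω t).2) hk
      (by rw [hplay, i1 7 (by norm_num), h7]) (by rw [hplay, i1 8 (by norm_num), h8])
      (by rw [i1 7 (by norm_num), h7]; exact nextPlay_fst_lt ..)
      (by rw [i1 8 (by norm_num), h8]; exact nextPlay_snd_lt ..)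
      (by
        -- The submitted bid is exactly the grid bid, so the win signal is 1 minus `lost`.
        have : s1.idx 1 = w := by simp [hs1]
        rw [this, hw, lost, ← hb, ← ht]
        split_ifs <;> norm_num)
    have hsp0 : s0.space ≤ s0.idx 2 + 1 := by
      have h2 : s0.idx 2 = (store bidder T m ω t).idx 2 := by
        rw [h1.idx_two, htr.idx_two]
      rw [h2]
      refine bidProgram_tame.space_le
        (s := { store bidder T m ω t with
          reg := Function.update (store bidder T m ω t).reg 0 ((ω t).1 : ℝ) }) ?_
      change (store bidder T m ω t).space ≤ (store bidder T m ω t).idx 2 + 1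
      rw [htr.idx_two]
      exact hsp
    have hsp1 : (exec (ω t).2 updateProgram s1).space ≤ K + 1 := by
      rw [← h1'.idx_two]
      refine updateProgram_tame.space_le ?_
      rw [i1 2 (by norm_num)]
      exact hsp0
    rw [hst]
    refine ⟨j', k', by rw [← hjk, ht], hk', ?_, rfl, hsp1⟩
    exact ⟨htr'.idx_two, htr'.idx_three, htr'.idx_five, htr'.idx_six, htr'.reg_five,
      htr'.arr_zero, htr'.arr_one, htr'.arr_two, htr'.arr_three, htr'.arr_four⟩

lemma bidAt_eq (m : ℕ → unitInterval) (hK : K = gridSize T) (hX : X = 8 * K * (1 + Real.log T))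
    (ω : Outcome) (ht : t < T) :
    bidAt bidder T m ω t = ((play m K X ω T t).2 : ℝ) / K := by
  obtain ⟨j, k, hjk, hk, htr, hd, -⟩ := store_tracks m T hK hX ω t
  have := (htr.afterBid hd hk (ω t)).2.2.2
  rw [← hjk] at this
  rw [play_apply ht]
  exact this

lemma play_snd_lt (ω : Outcome) (ht : t < T) : (play m K X ω T t).2 < K + 1 := by
  rw [play_apply ht]
  exact nextPlay_snd_lt ..

lemma bidAt_mem (m : ℕ → unitInterval) (ω : Outcome) (ht : t < T) :
    bidAt bidder T m ω t ∈ Set.Icc (0 : ℝ) 1 := by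
  rw [bidAt_eq m rfl rfl ω ht]
  refine ⟨by positivity, div_le_one_of_le₀ ?_ (Nat.cast_nonneg _)⟩
  exact_mod_cast Nat.lt_succ_iff.1 (play_snd_lt ω ht)

lemma store_time_succ_le (m : ℕ → unitInterval) (ω : Outcome) (T t : ℕ) :
    (store bidder T m ω (t + 1)).time ≤ (store bidder T m ω t).time + 2000 * (gridSize T + 2) := by
  obtain ⟨j, k, hjk, hk, htr, hd, -⟩ := store_tracks m T rfl rfl ω t
  have h1 := (htr.afterBid hd hk (ω t)).1
  obtain ⟨w, -, hst⟩ := store_succ bidder T m ω t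
  have hb : (afterBid bidder (ω t) (store bidder T m ω t)).time ≤
      (store bidder T m ω t).time + bidProgram.cost (gridSize T + 1) :=
    bidProgram_tame.time_le
      (s := { store bidder T m ω t with
        reg := Function.update (store bidder T m ω t).reg 0 ((ω t).1 : ℝ) })
      (htr.idx_two.trans_le (Nat.le_succ _)) htr.idx_three.le
  have hu := updateProgram_tame.time_le (tape := (ω t).2) (n := gridSize T + 1)
    (s := { afterBid bidder (ω t) (store bidder T m ω t) with
      idx := Function.update (afterBid bidder (ω t) (store bidder T m ω t)).idx 1 w })
    (((Function.update_of_ne (by norm_num : 2 ≠ 1) w _).trans h1.idx_two).trans_le (Nat.le_succ _))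
    ((Function.update_of_ne (by norm_num : 3 ≠ 1) w _).trans h1.idx_three).le
  have hb' := bidProgram_cost (gridSize T + 1)
  have hu' := updateProgram_cost (gridSize T + 1)
  rw [hst]
  change (exec (ω t).2 updateProgram _).time ≤ _
  refine hu.trans ?_
  change (afterBid bidder (ω t) (store bidder T m ω t)).time + _ ≤ _
  omega

end FirstPrice

/-! ### From the grid back to the auctions -/

namespace FirstPrice

open RealRAM

variable {T : ℕ} {m : ℕ → unitInterval} {K : ℕ} {X : ℝ} {t : ℕ}

/-- On a win, rounding down only lowers the value. On a defeat the utility is 0, while the loss is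
at least $c/K$ because $a+(c-a)^+\ge c$. -/
lemma le_utility (hK : 1 ≤ K) (t a : ℕ) {v : ℝ} (hv : 0 ≤ v) :
    (roundVal K v : ℝ) / K - loss m K t (roundVal K v) a ≤ utility v ((a : ℝ) / K) (m t) := by
  have hK0 : (0 : ℝ) < K := by exact_mod_cast hK
  have h1 := roundVal_le_mul hK hv
  rw [loss, lost, utility, ← sub_div]
  split_ifs with h
  · rw [div_le_iff₀ hK0, sub_mul, div_mul_cancel₀ _ hK0.ne']
    linarith
  · have h2 : (roundVal K v : ℝ) ≤ a + ((roundVal K v - a : ℕ) : ℝ) := by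
      exact_mod_cast (by omega : roundVal K v ≤ a + (roundVal K v - a))
    exact div_nonpos_of_nonpos_of_nonneg (by linarith) hK0.le

/-- The bid `β` is rounded up, so it keeps all its wins; payment and value each change by at most
$1/K$. If the rounded bid exceeds the rounded value, `β` gains at most $1/K$ and the bid 0 does as
well. The choice does not depend on the auction, so it serves the whole sequence. -/
lemma exists_utility_le (hK : 1 ≤ K) (m : ℕ → unitInterval) {v β : ℝ} (hv : v ≤ 1) (hβ : 0 ≤ β) :
    ∃ b < K + 1, ∀ t, utility v β (m t) ≤
      (roundVal K v : ℝ) / K - loss m K t (roundVal K v) b + 2 / K := by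
  have hK0 : (0 : ℝ) < K := by exact_mod_cast hK
  have h1 : v * K ≤ roundVal K v + 1 := mul_le_roundVal hv
  have hcK : roundVal K v ≤ K := rank_le ..
  set c := roundVal K v with hc
  have hloss : ∀ t b, b ≤ c → loss m K t c b ≤ (c : ℝ) / K := by
    intro t b hb
    rw [loss, Nat.cast_sub hb]
    have : (b : ℝ) ≤ c := by exact_mod_cast hb
    gcongr
    nlinarith [lost_le_one (m := m) (K := K) t b]
  by_cases hb : ⌈β * K⌉₊ ≤ c
  · refine ⟨⌈β * K⌉₊, by omega, fun t => ?_⟩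
    have hb1 := Nat.le_ceil (β * K)
    have hb2 := (Nat.ceil_lt_add_one (by positivity : 0 ≤ β * K)).le
    rw [utility]
    split_ifs with h
    · have hl : lost m K t ⌈β * K⌉₊ = 0 := if_pos (h.trans ((le_div_iff₀ hK0).2 hb1))
      rw [loss, hl, mul_zero, add_zero, ← sub_div, ← add_div, le_div_iff₀ hK0]
      linarith
    · have := hloss t _ hb
      have : 0 ≤ 2 / (K : ℝ) := by positivity
      linarith
  · refine ⟨0, by omega, fun t => ?_⟩
    have h2 := hloss t 0 (Nat.zero_le _)
    have h3 : (c : ℝ) < β * K := Nat.lt_ceil.1 (not_le.1 hb)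
    have h4 : utility v β (m t) ≤ 2 / K := by
      rw [utility]
      split_ifs with h
      · rw [le_div_iff₀ hK0]
        linarith
      · positivity
    linarith

lemma abs_utility_le {v b : ℝ} (hv : v ∈ Set.Icc (0 : ℝ) 1) (hb : b ∈ Set.Icc (0 : ℝ) 1) (x : ℝ) :
    |utility v b x| ≤ 1 := by
  rw [utility]
  split_ifs
  · rw [abs_le]
    constructor <;> linarith [hv.1, hv.2, hb.1, hb.2]
  · simp

lemma measurable_utility (x : ℝ) : Measurable fun z : ℝ × ℝ => utility z.1 z.2 x := by
  classical
  have h : (fun z : ℝ × ℝ => utility z.1 z.2 x) =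
      fun z => if x ≤ z.2 then z.1 - z.2 else 0 := by
    funext z
    rw [utility]
  rw [h]
  exact Measurable.ite (measurableSet_le measurable_const measurable_snd)
    (measurable_fst.sub measurable_snd) measurable_const

lemma integrable_utility {Ω : Type*} [MeasurableSpace Ω] {μ : Measure Ω} [IsFiniteMeasure μ]
    {v b : Ω → ℝ} (hv : Measurable v) (hb : Measurable b) (hv' : ∀ ω, v ω ∈ Set.Icc (0 : ℝ) 1)
    (hb' : ∀ ω, b ω ∈ Set.Icc (0 : ℝ) 1) (x : ℝ) :
    Integrable (fun ω => utility (v ω) (b ω) x) μ :=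
  Integrable.of_bound ((measurable_utility x).comp (hv.prodMk hb)).aestronglyMeasurable 1
    (Filter.Eventually.of_forall fun ω => abs_utility_le (hv' ω) (hb' ω) x)

variable (ν : Measure unitInterval) [IsProbabilityMeasure ν]

lemma measurePreserving_value (t : ℕ) :
    MeasurePreserving (fun ω : Outcome => (ω t).1) (law ν) ν :=
  measurePreserving_fst.comp (measurePreserving_eval_infinitePi _ t)

/-- The mapping `β` may vary among values with the same rounding, but for each single value its grid
substitute is no better than the best bid in hindsight `b c`. -/
lemma integral_sum_utility_le (hK : 1 ≤ K) (m : ℕ → unitInterval) (T : ℕ)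
    {β : unitInterval → unitInterval} (hβ : Measurable β) {b : ℕ → ℕ}
    (hb : ∀ c, ∀ b' < K + 1, ∑ t ∈ Finset.range T, loss m K t c (b c) ≤
      ∑ t ∈ Finset.range T, loss m K t c b') :
    ∑ t ∈ Finset.range T, ∫ v : unitInterval, utility v (β v) (m t) ∂ν ≤
      ∑ c ∈ Finset.range (K + 1), valueLaw ν K c * (T * ((c : ℝ) / K)) -
        ∑ t ∈ Finset.range T, ∑ c ∈ Finset.range (K + 1), valueLaw ν K c * loss m K t c (b c) +
        T * (2 / K) := by
  have hint : ∀ t, Integrable (fun v : unitInterval => utility v (β v) (m t)) ν := fun t =>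
    integrable_utility measurable_subtype_coe (measurable_subtype_coe.comp hβ) (fun v => v.2)
      (fun v => (β v).2) _
  set g : ℕ → ℝ := fun c => T * ((c : ℝ) / K) - ∑ t ∈ Finset.range T, loss m K t c (b c) +
    T * (2 / K) with hg
  have hgint : Integrable (fun v : unitInterval => g (roundVal K v)) ν := by
    refine Integrable.of_bound
      ((measurable_of_countable g).comp
        ((measurable_roundVal K).comp measurable_subtype_coe)).aestronglyMeasurable
      (∑ c ∈ Finset.range (K + 1), |g c|) (Filter.Eventually.of_forall fun v => ?_)
    exact Finset.single_le_sum (f := fun c => |g c|) (fun _ _ => abs_nonneg _)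
      (Finset.mem_range.2 (Nat.lt_succ_iff.2 (rank_le ..)))
  rw [← integral_finsetSum _ fun t _ => hint t]
  calc ∫ v : unitInterval, ∑ t ∈ Finset.range T, utility v (β v) (m t) ∂ν
      ≤ ∫ v : unitInterval, g (roundVal K v) ∂ν := by
        refine integral_mono (integrable_finsetSum _ fun t _ => hint t) hgint fun v => ?_
        obtain ⟨b', hb', h⟩ := exists_utility_le hK m (v := v) (β := β v) v.2.2 (β v).2.1
        refine (Finset.sum_le_sum fun t _ => h t).trans ?_
        rw [Finset.sum_add_distrib, Finset.sum_sub_distrib]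
        simp only [Finset.sum_const, Finset.card_range, nsmul_eq_mul, hg]
        linarith [hb (roundVal K v) b' hb']
    _ = _ := by
        rw [integral_roundVal, Finset.sum_comm (s := Finset.range T)]
        simp only [hg, mul_add, mul_sub, Finset.sum_add_distrib, Finset.sum_sub_distrib,
          ← Finset.sum_mul, valueLaw_sum, one_mul, Finset.mul_sum]

lemma measurable_bid (hK : K = gridSize T) (hX : X = 8 * K * (1 + Real.log T))
    (m : ℕ → unitInterval) (ht : t < T) : Measurable fun ω : Outcome => bidAt bidder T m ω t := by
  have h : (fun ω : Outcome => bidAt bidder T m ω t) =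
      (simplePlay m K X T).map fun ξ => ((ξ t).2 : ℝ) / K := by
    funext ω
    exact bidAt_eq m hK hX ω ht
  rw [h]
  exact SimpleFunc.measurable _

lemma integrable_utility_bid (m : ℕ → unitInterval) (ht : t < T) :
    Integrable (fun ω => utility (ω t).1 (bidAt bidder T m ω t) (m t)) (law ν) :=
  integrable_utility
    (measurable_subtype_coe.comp (measurePreserving_value ν t).measurable)
    (measurable_bid rfl rfl m ht) (fun ω => (ω t).1.2) (fun ω => bidAt_mem m ω ht) _

lemma integrable_utility_mapping (m : ℕ → unitInterval) {β : unitInterval → unitInterval}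
    (hβ : Measurable β) (t : ℕ) :
    Integrable (fun ω : Outcome => utility (ω t).1 (β (ω t).1) (m t)) (law ν) :=
  integrable_utility
    (measurable_subtype_coe.comp (measurePreserving_value ν t).measurable)
    (measurable_subtype_coe.comp (hβ.comp (measurePreserving_value ν t).measurable))
    (fun ω => (ω t).1.2) (fun ω => (β (ω t).1).2) _

theorem integrable_regret (m : ℕ → unitInterval) (T : ℕ) {β : unitInterval → unitInterval}
    (hβ : Measurable β) : Integrable (regret bidder T m β) (law ν) :=
  integrable_finsetSum _ fun t ht => (integrable_utility_mapping ν m hβ t).sub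
    (integrable_utility_bid ν m (Finset.mem_range.1 ht))

lemma integral_utility_mapping (m : ℕ → unitInterval) {β : unitInterval → unitInterval}
    (hβ : Measurable β) (t : ℕ) :
    ∫ ω : Outcome, utility (ω t).1 (β (ω t).1) (m t) ∂law ν =
      ∫ v : unitInterval, utility v (β v) (m t) ∂ν := by
  have h := measurePreserving_value ν t
  have h' := integral_map (μ := law ν) h.measurable.aemeasurable
    (f := fun v : unitInterval => utility v (β v) (m t))
    ((measurable_utility _).comp (measurable_subtype_coe.prodMk
      (measurable_subtype_coe.comp hβ))).aestronglyMeasurable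
  rw [h.map_eq] at h'
  exact h'.symm

theorem integral_regret_le (hT : 1 ≤ T) (m : ℕ → unitInterval) {β : unitInterval → unitInterval}
    (hβ : Measurable β) : ∫ ω, regret bidder T m β ω ∂law ν ≤
      102 * (gridSize T : ℝ) ^ 2 * (1 + Real.log T) ^ 2 := by
  obtain ⟨K, hK⟩ : ∃ K, K = gridSize T := ⟨_, rfl⟩
  obtain ⟨X, hX⟩ : ∃ X, X = 8 * (K : ℝ) * (1 + Real.log T) := ⟨_, rfl⟩
  have hK1 : 1 ≤ K := by rw [hK]; exact gridSize_pos hT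
  have hTK : T ≤ K ^ 3 := by rw [hK]; exact le_gridSize_pow T
  have hKT : K ≤ T := by rw [hK]; exact gridSize_le hT
  have hE := isPlay_integral ν m K X T
  -- The adversary is oblivious, so the best bid in hindsight for each rounded value is
  -- deterministic.
  choose b hb hbmin using fun c => Finset.exists_min_image (Finset.range (K + 1))
    (fun a => ∑ t ∈ Finset.range T, loss m K t c a) ⟨0, by simp⟩
  have h1 := integral_sum_utility_le ν hK1 m T hβ (b := b) fun c b' hb' =>
    hbmin c b' (Finset.mem_range.2 hb')
  have h2 := hE.regret_le hT hK1 hKT hTK hX (valueLaw_nonneg ν) (valueLaw_sum ν) b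
    fun c => Finset.mem_range.1 (hb c)
  have h3 : ∀ t ∈ Finset.range T, ∑ c ∈ Finset.range (K + 1), valueLaw ν K c * ((c : ℝ) / K) -
      ∫ ω, loss m K t (play m K X ω T t).1 (play m K X ω T t).2 ∂law ν ≤
      ∫ ω, utility (ω t).1 (bidAt bidder T m ω t) (m t) ∂law ν := by
    intro t ht
    have ht' := Finset.mem_range.1 ht
    have h4 := hE.cond_value (t := t) ht' (G := fun _ => 1) (fun _ _ _ => rfl)
      (fun c => (c : ℝ) / K)
    rw [hE.one, mul_one] at h4
    simp only [one_mul] at h4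
    rw [← h4, ← integral_sub (integrable_play ν T fun ξ => ((ξ t).1 : ℝ) / K)
      (integrable_play ν T fun ξ => loss m K t (ξ t).1 (ξ t).2)]
    refine integral_mono ((integrable_play ν T fun ξ => ((ξ t).1 : ℝ) / K).sub
      (integrable_play ν T fun ξ => loss m K t (ξ t).1 (ξ t).2)) (integrable_utility_bid ν m ht')
      fun ω => ?_
    have h5 : (play m K X ω T t).1 = roundVal K (ω t).1 := by
      rw [play_apply ht']
      rfl
    dsimp only
    rw [bidAt_eq m hK hX ω ht', h5]
    exact le_utility hK1 t _ (ω t).1.2.1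
  have h4 := Finset.sum_le_sum h3
  rw [Finset.sum_sub_distrib, Finset.sum_const, Finset.card_range, nsmul_eq_mul,
    Finset.mul_sum] at h4
  have h5 : ∫ ω, regret bidder T m β ω ∂law ν =
      ∑ t ∈ Finset.range T, ∫ v : unitInterval, utility v (β v) (m t) ∂ν -
      ∑ t ∈ Finset.range T, ∫ ω, utility (ω t).1 (bidAt bidder T m ω t) (m t) ∂law ν := by
    simp only [regret]
    have h10 := fun t (ht : t ∈ Finset.range T) => (integrable_utility_mapping ν m hβ t).sub
      (integrable_utility_bid ν m (Finset.mem_range.1 ht))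
    simp only [Pi.sub_def] at h10
    rw [integral_finsetSum _ h10, ← Finset.sum_sub_distrib]
    refine Finset.sum_congr rfl fun t ht => ?_
    rw [integral_sub (integrable_utility_mapping ν m hβ t)
      (integrable_utility_bid ν m (Finset.mem_range.1 ht)), integral_utility_mapping ν m hβ]
  have h6 : ∑ c ∈ Finset.range (K + 1), valueLaw ν K c * (T * ((c : ℝ) / K)) =
      ∑ c ∈ Finset.range (K + 1), (T : ℝ) * (valueLaw ν K c * ((c : ℝ) / K)) :=
    Finset.sum_congr rfl fun c _ => by ring
  have hK0 : (0 : ℝ) < K := by exact_mod_cast hK1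
  -- The rounding cost, which raises the constant from 100 to 102.
  have h7 : (T : ℝ) * (2 / K) ≤ 2 * (K : ℝ) ^ 2 := by
    have : (T : ℝ) ≤ (K : ℝ) ^ 3 := by exact_mod_cast hTK
    rw [mul_div_assoc', div_le_iff₀ hK0]
    linarith
  have h8 : (1 : ℝ) ≤ (1 + Real.log T) ^ 2 :=
    one_le_pow₀ (by linarith [Real.log_nonneg (by exact_mod_cast hT : (1 : ℝ) ≤ T)])
  have h9 : 2 * (K : ℝ) ^ 2 ≤ 2 * (K : ℝ) ^ 2 * (1 + Real.log T) ^ 2 :=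
    le_mul_of_one_le_right (by positivity) h8
  rw [h5, ← hK]
  rw [h6] at h1
  linarith

end FirstPrice

theorem mainTheorem2 :
    ∃ (A : FirstPrice.Bidder) (C : ℝ) (a : ℕ),
      ∀ (T : ℕ), 1 ≤ T → ∀ (m : ℕ → unitInterval),
        -- bids are legal; running time per auction and memory are of order `T ^ (1 / 3)`
        (∀ ω : FirstPrice.Outcome,
          ((FirstPrice.store A T m ω 0).time : ℝ) ≤ C * (T : ℝ) ^ (1 / 3 : ℝ) ∧
          (∀ t < T,
            FirstPrice.bidAt A T m ω t ∈ Set.Icc (0 : ℝ) 1 ∧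
            ((FirstPrice.store A T m ω (t + 1)).time : ℝ) ≤
              (FirstPrice.store A T m ω t).time + C * (T : ℝ) ^ (1 / 3 : ℝ)) ∧
          (∀ t ≤ T,
            ((FirstPrice.store A T m ω t).space : ℝ) ≤ C * (T : ℝ) ^ (1 / 3 : ℝ))) ∧
        -- expected regret against every fixed mapping from values to bids
        (∀ (ν : MeasureTheory.Measure unitInterval) [MeasureTheory.IsProbabilityMeasure ν]
          (β : unitInterval → unitInterval), Measurable β →
          MeasureTheory.Integrable (FirstPrice.regret A T m β) (FirstPrice.law ν) ∧
          ∫ ω, FirstPrice.regret A T m β ω ∂(FirstPrice.law ν) ≤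
            C * (T : ℝ) ^ (2 / 3 : ℝ) * (1 + Real.log T) ^ a) := by
  -- The constant comes from the time per auction: $2000(K+2)$ with $K\le 2T^{1/3}$ and $1\le
  -- T^{1/3}$. The regret needs only $4\cdot 102$.
  refine ⟨FirstPrice.bidder, 8000, 2, fun T hT m => ?_⟩
  have hT' : (1 : ℝ) ≤ T := by exact_mod_cast hT
  have h1 : (1 : ℝ) ≤ (T : ℝ) ^ (1 / 3 : ℝ) := Real.one_le_rpow hT' (by norm_num)
  have hK := FirstPrice.gridSize_le_rpow hT
  refine ⟨fun ω => ⟨?_, fun t ht => ⟨FirstPrice.bidAt_mem m ω ht, ?_⟩, fun t _ => ?_⟩,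
    fun ν _ β hβ => ⟨FirstPrice.integrable_regret ν m T hβ, ?_⟩⟩
  · obtain ⟨-, -, -, -, -, -, -, -, h⟩ := FirstPrice.exec_initProgram (tape := (ω 0).2) T
      (s := FirstPrice.store FirstPrice.bidder T m ω 0) rfl
    have h' : ((FirstPrice.store FirstPrice.bidder T m ω 0).time : ℝ) ≤
      40 * FirstPrice.gridSize T + 100 := by exact_mod_cast h
    linarith
  · have h : ((FirstPrice.store FirstPrice.bidder T m ω (t + 1)).time : ℝ) ≤
        (FirstPrice.store FirstPrice.bidder T m ω t).time +
          2000 * (FirstPrice.gridSize T + 2) := by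
      exact_mod_cast FirstPrice.store_time_succ_le m ω T t
    linarith
  · obtain ⟨-, -, -, -, -, -, h⟩ := FirstPrice.store_tracks m T rfl rfl ω t
    have h' : ((FirstPrice.store FirstPrice.bidder T m ω t).space : ℝ) ≤
      FirstPrice.gridSize T + 1 := by exact_mod_cast h
    linarith
  · refine (FirstPrice.integral_regret_le ν hT m hβ).trans ?_
    have h2 : (FirstPrice.gridSize T : ℝ) ^ 2 ≤ 4 * (T : ℝ) ^ (2 / 3 : ℝ) := by
      have h3 : (T : ℝ) ^ (2 / 3 : ℝ) = ((T : ℝ) ^ (1 / 3 : ℝ)) ^ 2 := by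
        rw [← Real.rpow_natCast, ← Real.rpow_mul (by linarith)]
        norm_num
      rw [h3]
      nlinarith [Nat.cast_nonneg (α := ℝ) (FirstPrice.gridSize T)]
    have h4 : (0 : ℝ) ≤ (T : ℝ) ^ (2 / 3 : ℝ) := by positivity
    refine mul_le_mul_of_nonneg_right ?_ (sq_nonneg _)
    linarith
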